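/- Let $\mathbb K=\mathbb R$ or $\mathbb C$, let $V=\mathbb K^d$, and let $\mathfrak g$ be a finite-dimensional, graded Lie subalgebra of the Lie algebra of polynomial vector fields on $V$ that is a maximal proper subalgebra of it. Graded means that $\mathfrak g$ is the direct sum of the spaces $\mathfrak g_p$ of its elements with components homogeneous of degree $p+1$ $(p\ge -1)$. Let $\mathfrak h_0=[\mathfrak g_0,\mathfrak g_0]$ be the semisimple part of the Lie algebra $\mathfrak g_0$ of linear vector fields in $\mathfrak g$. For a vector space or Lie algebra $E$ over $\mathbb K$ put $\widetilde E=E\otimes_{\mathbb R}\mathbb C$ if $\mathbb K=\mathbb R$ and $\widetilde E=E$ if $\mathbb K=\mathbb C$. Assume that $\widetilde{\mathfrak h_0}$ is simple. Let $\delta\in\mathbb R$, and let $\mathcal S=\bigoplus_{k\ge 0}\mathcal S^k$ be the symbol space, where $\mathcal S^k$ is the space of smooth ($\mathbb K=\mathbb R$) or holomorphic ($\mathbb K=\mathbb C$) sections of $V\times(\vee^kV\otimes\Delta^\delta V)$, $\Delta^\delta V$ being the line of $\delta$-densities. Writing symbols as functions $P(x,\xi)$ that are polynomial in $\xi\in V^*$,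 a vector field $X=\sum_i X^i\partial_i$ acts on $\mathcal S$ by $$L_XP=\sum_iX^i\partial_iP-\sum_{i,j}(\partial_jX^i)\,\xi_i\,\frac{\partial P}{\partial\xi_j}+\delta\sum_i(\partial_iX^i)P .$$ The space $\mathfrak g_{-1}$ of constant vector fields in $\mathfrak g$ is identified with $V$. The algebra $\mathfrak h_0$ acts on $\mathfrak g_{-1}$ by the adjoint action and on $\vee^k\mathfrak g_{-1}=\vee^kV$ through the natural action of the opposite of the Jacobian matrix. Fix a Cartan subalgebra of $\widetilde{\mathfrak h_0}$ and a system of simple roots. Let $S$ be the sum of the positive roots and $(\cdot,\cdot)$ the form on weights induced by the Killing form of $\widetilde{\mathfrak h_0}$. For an irreducible $\mathfrak h_0$-module $E$, let $\mu_E$ be the highest weight of $\widetilde E$ if $\widetilde E$ is irreducible over $\widetilde{\mathfrak h_0}$; otherwise let $\mu_E$ be the highest weight of $E$ regarded as a complex representation of $\widetilde{\mathfrak h_0}$ by means of a complex structure on $E$ commuting with $\mathfrak h_0$. Then the Killing form $\beta$ of $\mathfrak g$ is nondegenerate, the highest weights below exist, and the Casimir operator $\mathcal C=\sum_iL_{e_i}L_{e_i^*}$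 on $\mathcal S$, where $(e_i)$ is any basis of $\mathfrak g$ and $(e_i^*)$ its dual basis for $\beta$, is diagonalizable, i.e. $\mathcal S$ is the sum of its eigenspaces. Moreover, for every $k\in\mathbb N$ and every irreducible $\mathfrak h_0$-submodule $I_{k,p}$ of $\vee^k\mathfrak g_{-1}$, the restriction of $\mathcal C$ to the sections of $V\times(I_{k,p}\otimes\Delta^\delta V)$ is the identity times the real scalar $$\frac1{2d}(d\delta-k)\bigl(d(\delta-1)-k\bigr)+\frac{\dim\mathfrak h_0}{2(\mu_{\mathfrak g_{-1}},\mu_{\mathfrak g_{-1}}+S)\,d+\dim\mathfrak h_0}\,(\mu_{I_{k,p}},\mu_{I_{k,p}}+S),$$ where $\dim\mathfrak h_0$ is the dimension of $\mathfrak h_0$ over $\mathbb K$. -/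

import Mathlib

open scoped ContDiff TensorProduct

noncomputable section

namespace IFFT

/-! ### Polynomial vector fields -/

section VectorFields

variable (𝕜 : Type*) [RCLike 𝕜] (d : ℕ)

/-- The Lie algebra of polynomial vector fields on `V = 𝕜 ^ d`: the field `∑ Xⁱ ∂ᵢ` is the
derivation of the polynomial algebra sending the coordinate `xᵢ` to `Xⁱ`. -/
abbrev PolyVect : Type _ :=
  Derivation 𝕜 (MvPolynomial (Fin d) 𝕜) (MvPolynomial (Fin d) 𝕜)

variable {𝕜 d}

/-- The `i`-th component of a polynomial vector field. -/
def comp (X : PolyVect 𝕜 d) (i : Fin d) : MvPolynomial (Fin d) 𝕜 := X (MvPolynomial.X i)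

variable (𝕜 d) in
/-- The polynomial vector fields whose components are homogeneous of degree `n`
(`n = 0`: constant fields, `n = 1`: linear fields, `n = 2`: quadratic fields). -/
def coeffDeg (n : ℕ) : Submodule 𝕜 (PolyVect 𝕜 d) where
  carrier := {X | ∀ i, (comp X i).IsHomogeneous n}
  add_mem' hX hY i := (hX i).add (hY i)
  zero_mem' _ := MvPolynomial.isHomogeneous_zero _ _ _
  smul_mem' c _ hX i :=
    (MvPolynomial.homogeneousSubmodule (Fin d) 𝕜 n).smul_mem c (hX i)

/-- A Lie subalgebra of polynomial vector fields is graded if it is the sum of its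
intersections with the spaces of homogeneous vector fields. -/
def IsGraded (g : LieSubalgebra 𝕜 (PolyVect 𝕜 d)) : Prop :=
  g.toSubmodule = ⨆ n : ℕ, g.toSubmodule ⊓ coeffDeg 𝕜 d n

/-- The Jacobian matrix at the origin of a vector field; for a linear vector field this is its
(constant) Jacobian matrix `(∂ⱼ Xⁱ)`. -/
def jac (X : PolyVect 𝕜 d) : Matrix (Fin d) (Fin d) 𝕜 :=
  fun i j ↦ MvPolynomial.constantCoeff (MvPolynomial.pderiv j (comp X i))

theorem apply_eq_sum (X : PolyVect 𝕜 d) (p : MvPolynomial (Fin d) 𝕜) :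
    X p = ∑ j, MvPolynomial.pderiv j p * comp X j := by
  have hs : ∀ q : MvPolynomial (Fin d) 𝕜,
      (∑ j, (comp X j) • (MvPolynomial.pderiv (R := 𝕜) j)) q =
        ∑ j, MvPolynomial.pderiv j q * comp X j := by
    intro q
    have := congrFun (map_sum (Derivation.coeFnAddMonoidHom
      (R := 𝕜) (A := MvPolynomial (Fin d) 𝕜) (M := MvPolynomial (Fin d) 𝕜))
      (fun j ↦ (comp X j) • (MvPolynomial.pderiv (R := 𝕜) j)) Finset.univ) q
    simp only [Finset.sum_apply] at this
    refine this.trans (Finset.sum_congr rfl fun j _ ↦ ?_)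
    exact mul_comm _ _
  have h : X = ∑ j, (comp X j) • (MvPolynomial.pderiv (R := 𝕜) j) := by
    apply MvPolynomial.derivation_ext
    intro i
    rw [hs]
    simp [comp, MvPolynomial.pderiv_X, Pi.single_apply]
  conv_lhs => rw [h]
  exact hs p

theorem isHomogeneous_apply {X : PolyVect 𝕜 d} (hX : X ∈ coeffDeg 𝕜 d 1) {n : ℕ}
    {p : MvPolynomial (Fin d) 𝕜} (hp : p.IsHomogeneous n) : (X p).IsHomogeneous n := by
  rcases Nat.eq_zero_or_pos n with rfl | hn
  · obtain ⟨c, rfl⟩ : ∃ c, p = MvPolynomial.C c :=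
      ⟨_, (MvPolynomial.totalDegree_eq_zero_iff_eq_C).1
        ((MvPolynomial.totalDegree_zero_iff_isHomogeneous _).2 hp)⟩
    rw [← MvPolynomial.algebraMap_eq, Derivation.map_algebraMap]
    exact MvPolynomial.isHomogeneous_zero _ _ _
  · rw [apply_eq_sum]
    refine MvPolynomial.IsHomogeneous.sum _ _ _ fun j _ ↦ ?_
    have := (hp.pderiv (i := j)).mul (hX j)
    rwa [Nat.sub_add_cancel hn] at this

theorem isHomogeneous_apply' {n : ℕ} {X : PolyVect 𝕜 d} (hX : X ∈ coeffDeg 𝕜 d n)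
    {p : MvPolynomial (Fin d) 𝕜} (hp : p.IsHomogeneous 1) : (X p).IsHomogeneous n := by
  rw [apply_eq_sum]
  refine MvPolynomial.IsHomogeneous.sum _ _ _ fun j _ ↦ ?_
  have := (hp.pderiv (i := j)).mul (hX j)
  simpa using this

theorem lie_mem_coeffDeg {X Y : PolyVect 𝕜 d} {n : ℕ} (hX : X ∈ coeffDeg 𝕜 d 1)
    (hY : Y ∈ coeffDeg 𝕜 d n) : ⁅X, Y⁆ ∈ coeffDeg 𝕜 d n := by
  intro i
  simp only [comp, Derivation.commutator_apply]
  exact (isHomogeneous_apply hX (hY i)).sub (isHomogeneous_apply' hY (hX i))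

theorem comp_eq_of_linear {X : PolyVect 𝕜 d} (hX : X ∈ coeffDeg 𝕜 d 1) (i : Fin d) :
    comp X i = ∑ j, jac X i j • MvPolynomial.X j := by
  have h := (hX i).sum_X_mul_pderiv
  rw [one_smul] at h
  conv_lhs => rw [← h]
  refine Finset.sum_congr rfl fun j _ ↦ ?_
  have h0 : (MvPolynomial.pderiv j (comp X i)).IsHomogeneous 0 := (hX i).pderiv
  rw [MvPolynomial.totalDegree_eq_zero_iff_eq_C.1
    ((MvPolynomial.totalDegree_zero_iff_isHomogeneous _).2 h0)]
  rw [mul_comm, ← MvPolynomial.smul_eq_C_mul]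
  rfl

theorem jac_lie {X Y : PolyVect 𝕜 d} (hX : X ∈ coeffDeg 𝕜 d 1) (hY : Y ∈ coeffDeg 𝕜 d 1) :
    jac ⁅X, Y⁆ = jac Y * jac X - jac X * jac Y := by
  have key : ∀ {X Y : PolyVect 𝕜 d}, X ∈ coeffDeg 𝕜 d 1 → Y ∈ coeffDeg 𝕜 d 1 → ∀ i k,
      MvPolynomial.constantCoeff (MvPolynomial.pderiv k (X (comp Y i))) =
        (jac Y * jac X) i k := by
    intro X Y hX hY i k
    rw [comp_eq_of_linear hY, Matrix.mul_apply]
    simp only [map_sum, Derivation.map_smul]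
    refine Finset.sum_congr rfl fun j _ ↦ ?_
    simp [MvPolynomial.smul_eq_C_mul, jac, comp]
  ext i k
  rw [Matrix.sub_apply, ← key hX hY, ← key hY hX, ← map_sub, ← map_sub]
  rfl

theorem jac_add (X Y : PolyVect 𝕜 d) : jac (X + Y) = jac X + jac Y := by
  ext i j; simp [jac, comp]

theorem jac_smul (c : 𝕜) (X : PolyVect 𝕜 d) : jac (c • X) = c • jac X := by
  ext i j; simp [jac, comp]

/-- The degree zero part `g₀` (linear vector fields) of a Lie algebra `g` of vector fields. -/
def g0 (g : LieSubalgebra 𝕜 (PolyVect 𝕜 d)) : LieSubalgebra 𝕜 (PolyVect 𝕜 d) where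
  toSubmodule := g.toSubmodule ⊓ coeffDeg 𝕜 d 1
  lie_mem' hx hy := ⟨g.lie_mem hx.1 hy.1, lie_mem_coeffDeg hx.2 hy.2⟩

theorem span_lie_le (g : LieSubalgebra 𝕜 (PolyVect 𝕜 d)) :
    Submodule.span 𝕜 {Z | ∃ X ∈ g0 g, ∃ Y ∈ g0 g, ⁅X, Y⁆ = Z} ≤ (g0 g).toSubmodule := by
  rw [Submodule.span_le]
  rintro _ ⟨X, hX, Y, hY, rfl⟩
  exact (g0 g).lie_mem hX hY

/-- The semisimple part `h₀ = [g₀, g₀]` of the reductive Lie algebra `g₀`. -/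
def h0 (g : LieSubalgebra 𝕜 (PolyVect 𝕜 d)) : LieSubalgebra 𝕜 (PolyVect 𝕜 d) where
  toSubmodule := Submodule.span 𝕜 {Z | ∃ X ∈ g0 g, ∃ Y ∈ g0 g, ⁅X, Y⁆ = Z}
  lie_mem' {x y} hx hy :=
    Submodule.subset_span ⟨x, span_lie_le g hx, y, span_lie_le g hy, rfl⟩

theorem h0_le_g0 (g : LieSubalgebra 𝕜 (PolyVect 𝕜 d)) {X : PolyVect 𝕜 d} (hX : X ∈ h0 g) :
    X ∈ g ∧ X ∈ coeffDeg 𝕜 d 1 :=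
  span_lie_le g hX

instance (g : LieSubalgebra 𝕜 (PolyVect 𝕜 d)) [FiniteDimensional 𝕜 g] :
    FiniteDimensional 𝕜 (h0 g) :=
  haveI : FiniteDimensional 𝕜 g.toSubmodule := ‹FiniteDimensional 𝕜 g›
  Submodule.finiteDimensional_of_le (S₁ := (h0 g).toSubmodule) (S₂ := g.toSubmodule)
    fun _ hX ↦ (h0_le_g0 g hX).1

/-- The degree `-1` part `g₋₁` (constant vector fields) of `g`, as a module over `h₀` for the
adjoint action. -/
def gMinusOne (g : LieSubalgebra 𝕜 (PolyVect 𝕜 d)) :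
    LieSubmodule 𝕜 (h0 g) (PolyVect 𝕜 d) where
  toSubmodule := g.toSubmodule ⊓ coeffDeg 𝕜 d 0
  lie_mem {x} _ hm :=
    ⟨g.lie_mem (h0_le_g0 g x.2).1 hm.1, lie_mem_coeffDeg (h0_le_g0 g x.2).2 hm.2⟩

end VectorFields

/-! ### Symmetric tensors as `h₀`-modules -/

section Tensors

variable (𝕜 : Type*) [RCLike 𝕜] (d : ℕ)

/-- The symmetric algebra `⨁ₖ ∨ᵏ V` of `V = 𝕜 ^ d`, i.e. the polynomials on `V*` in the variables
`ξ₁, …, ξ_d` (`ξⱼ` being the `j`-th basis vector of `V`). -/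
def SymAlg : Type _ := MvPolynomial (Fin d) 𝕜

instance : AddCommGroup (SymAlg 𝕜 d) := inferInstanceAs (AddCommGroup (MvPolynomial (Fin d) 𝕜))
instance : Module 𝕜 (SymAlg 𝕜 d) := inferInstanceAs (Module 𝕜 (MvPolynomial (Fin d) 𝕜))

/-- The symmetric power `∨ᵏ V`: the homogeneous polynomials of degree `k`. -/
def symPow (k : ℕ) : Submodule 𝕜 (SymAlg 𝕜 d) :=
  MvPolynomial.homogeneousSubmodule (Fin d) 𝕜 k

variable {𝕜 d}

/-- The natural action on the symmetric algebra of `V` of the opposite of the Jacobian matrix of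
a linear vector field: the derivation extending `ξⱼ ↦ ∑ᵢ (-∂ⱼXⁱ) ξᵢ`. -/
def rho (X : PolyVect 𝕜 d) : PolyVect 𝕜 d :=
  MvPolynomial.mkDerivation 𝕜 fun j ↦ ∑ i, (-jac X i j) • MvPolynomial.X i

theorem rho_X (X : PolyVect 𝕜 d) (j : Fin d) :
    rho X (MvPolynomial.X j) = ∑ i, (-jac X i j) • MvPolynomial.X i :=
  MvPolynomial.mkDerivation_X _ _ _

theorem rho_add (X Y : PolyVect 𝕜 d) : rho (X + Y) = rho X + rho Y := by
  apply MvPolynomial.derivation_ext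
  intro j
  rw [Derivation.add_apply, rho_X, rho_X, rho_X, ← Finset.sum_add_distrib]
  refine Finset.sum_congr rfl fun i _ ↦ ?_
  rw [jac_add, Matrix.add_apply, neg_add, add_smul]

theorem rho_smul (c : 𝕜) (X : PolyVect 𝕜 d) : rho (c • X) = c • rho X := by
  apply MvPolynomial.derivation_ext
  intro j
  rw [Derivation.smul_apply, rho_X, rho_X, Finset.smul_sum]
  refine Finset.sum_congr rfl fun i _ ↦ ?_
  rw [jac_smul, Matrix.smul_apply, smul_smul, smul_eq_mul, mul_neg]

theorem rho_lie {X Y : PolyVect 𝕜 d} (hX : X ∈ coeffDeg 𝕜 d 1) (hY : Y ∈ coeffDeg 𝕜 d 1) :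
    rho ⁅X, Y⁆ = ⁅rho X, rho Y⁆ := by
  have key : ∀ (X Y : PolyVect 𝕜 d) (j : Fin d), rho X (rho Y (MvPolynomial.X j)) =
      ∑ k, (jac X * jac Y) k j • MvPolynomial.X k := by
    intro X Y j
    rw [rho_X]
    simp only [map_sum, Derivation.map_smul, rho_X, Finset.smul_sum, smul_smul, neg_mul_neg,
      Matrix.mul_apply, Finset.sum_smul]
    rw [Finset.sum_comm]
    refine Finset.sum_congr rfl fun k _ ↦ Finset.sum_congr rfl fun i _ ↦ ?_
    rw [mul_comm]
  apply MvPolynomial.derivation_ext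
  intro j
  rw [Derivation.commutator_apply, key, key, rho_X, jac_lie hX hY, ← Finset.sum_sub_distrib]
  refine Finset.sum_congr rfl fun k _ ↦ ?_
  rw [← sub_smul, Matrix.sub_apply, neg_sub]

instance (g : LieSubalgebra 𝕜 (PolyVect 𝕜 d)) : LieRingModule (h0 g) (SymAlg 𝕜 d) where
  bracket X Q := rho X.1 (show MvPolynomial (Fin d) 𝕜 from Q)
  add_lie X Y Q := by
    change rho (X.1 + Y.1) _ = _
    rw [rho_add]; rfl
  lie_add X Q R := map_add (rho X.1) _ _
  leibniz_lie X Y Q := by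
    change rho X.1 (rho Y.1 _) = rho ⁅X.1, Y.1⁆ _ + rho Y.1 (rho X.1 _)
    rw [rho_lie (h0_le_g0 g X.2).2 (h0_le_g0 g Y.2).2, Derivation.commutator_apply]
    exact (sub_add_cancel _ _).symm

instance (g : LieSubalgebra 𝕜 (PolyVect 𝕜 d)) : LieModule 𝕜 (h0 g) (SymAlg 𝕜 d) where
  smul_lie c X Q := by
    change rho (c • X.1) _ = _
    rw [rho_smul]; rfl
  lie_smul c X Q := Derivation.map_smul (rho X.1) c _

end Tensors

/-! ### Symbols and their Lie derivative -/

section Symbols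

variable (𝕜 : Type*) [RCLike 𝕜] (d : ℕ)

/-- The algebra of `𝕜`-valued functions on `𝕜 ^ d` that are smooth over `𝕜`: the `C^∞` functions
if `𝕜 = ℝ` and the holomorphic functions if `𝕜 = ℂ`. -/
def SmoothFun : Subalgebra 𝕜 ((Fin d → 𝕜) → 𝕜) where
  carrier := {f | ContDiff 𝕜 ∞ f}
  mul_mem' {f f'} (hf : ContDiff 𝕜 ∞ f) (hf' : ContDiff 𝕜 ∞ f') :=
    show ContDiff 𝕜 ∞ (f * f') from hf.mul hf'
  add_mem' {f f'} (hf : ContDiff 𝕜 ∞ f) (hf' : ContDiff 𝕜 ∞ f') :=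
    show ContDiff 𝕜 ∞ (f + f') from hf.add hf'
  algebraMap_mem' c := show ContDiff 𝕜 ∞ (fun _ : Fin d → 𝕜 ↦ c) from contDiff_const

/-- The symbol space `S = ⨁ₖ Sᵏ`, where `Sᵏ` is the space of sections of `V × (∨ᵏ V ⊗ Δ^δ V)`:
polynomials in `ξ₁, …, ξ_d` whose coefficients are smooth functions on `V`. The line `Δ^δ V` is
trivialized by the standard basis of `V = 𝕜 ^ d`; the weight `δ` enters through the Lie
derivative. -/
abbrev Symbol : Type _ := MvPolynomial (Fin d) (SmoothFun 𝕜 d)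

variable {𝕜 d}

/-- The partial derivative `∂ᵢ` on smooth functions. -/
def partialFun (i : Fin d) : SmoothFun 𝕜 d →ₗ[𝕜] SmoothFun 𝕜 d where
  toFun f := ⟨fun x ↦ fderiv 𝕜 f.1 x (Pi.single i 1), by
    have hf : ContDiff 𝕜 ∞ f.1 := f.2
    exact (hf.fderiv_right (m := ∞) (by simp)).clm_apply contDiff_const⟩
  map_add' f g := by
    have hf : ContDiff 𝕜 ∞ f.1 := f.2
    have hg : ContDiff 𝕜 ∞ g.1 := g.2
    apply Subtype.ext
    funext x
    change fderiv 𝕜 (f.1 + g.1) x _ = fderiv 𝕜 f.1 x _ + fderiv 𝕜 g.1 x _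
    rw [fderiv_add (hf.differentiable (by simp)).differentiableAt
      (hg.differentiable (by simp)).differentiableAt]
    rfl
  map_smul' c f := by
    have hf : ContDiff 𝕜 ∞ f.1 := f.2
    apply Subtype.ext
    funext x
    change fderiv 𝕜 (c • f.1) x _ = c • fderiv 𝕜 f.1 x _
    rw [fderiv_const_smul (hf.differentiable (by simp)).differentiableAt]
    rfl

theorem coeff_sum_partialFun (i : Fin d) (P : Symbol 𝕜 d) (n : Fin d →₀ ℕ) :
    MvPolynomial.coeff n (∑ m ∈ P.support, MvPolynomial.monomial m (partialFun i (P.coeff m))) =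
      partialFun i (P.coeff n) := by
  classical
  simp only [MvPolynomial.coeff_sum, MvPolynomial.coeff_monomial]
  rw [Finset.sum_ite_eq']
  split_ifs with h
  · rfl
  · rw [MvPolynomial.notMem_support_iff.1 h, map_zero]

/-- The derivative `∂ᵢ` of symbols along the base `V`, acting on the coefficients. -/
def partialBase (i : Fin d) : Symbol 𝕜 d →ₗ[𝕜] Symbol 𝕜 d where
  toFun P := ∑ m ∈ P.support, MvPolynomial.monomial m (partialFun i (P.coeff m))
  map_add' P Q := by
    ext1 n
    rw [MvPolynomial.coeff_add, coeff_sum_partialFun, coeff_sum_partialFun,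
      coeff_sum_partialFun, MvPolynomial.coeff_add, map_add]
  map_smul' c P := by
    ext1 n
    rw [RingHom.id_apply, MvPolynomial.coeff_smul, coeff_sum_partialFun, coeff_sum_partialFun,
      MvPolynomial.coeff_smul, map_smul]

/-- The coordinate function `xⁱ`. -/
def coord (i : Fin d) : SmoothFun 𝕜 d := ⟨fun x ↦ x i, show ContDiff 𝕜 ∞ (fun x : Fin d → 𝕜 ↦ x i) from
    contDiff_apply 𝕜 𝕜 i⟩

/-- A polynomial function on `V`, seen as a symbol of degree zero. -/
def baseFun : MvPolynomial (Fin d) 𝕜 →ₐ[𝕜] Symbol 𝕜 d :=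
  (IsScalarTower.toAlgHom 𝕜 (SmoothFun 𝕜 d) (Symbol 𝕜 d)).comp (MvPolynomial.aeval coord)

/-- The natural Lie derivative of symbols valued in `δ`-densities in the direction of a
polynomial vector field:
`L_X P = ∑ᵢ Xⁱ ∂ᵢ P - ∑ᵢⱼ (∂ⱼ Xⁱ) ξᵢ (∂ P / ∂ξⱼ) + δ ∑ᵢ (∂ᵢ Xⁱ) P`. -/
def lieDerivFun (δ : ℝ) (X : PolyVect 𝕜 d) (P : Symbol 𝕜 d) : Symbol 𝕜 d :=
  ∑ i, baseFun (comp X i) * partialBase i P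
    - ∑ i, ∑ j, baseFun (MvPolynomial.pderiv j (comp X i)) * MvPolynomial.X i
        * MvPolynomial.pderiv j P
    + (δ : 𝕜) • ∑ i, baseFun (MvPolynomial.pderiv i (comp X i)) * P

/-- The Lie derivative of symbols as a linear map from vector fields to endomorphisms of `S`. -/
def lieDeriv (δ : ℝ) : PolyVect 𝕜 d →ₗ[𝕜] Module.End 𝕜 (Symbol 𝕜 d) :=
  LinearMap.mk₂ 𝕜 (lieDerivFun δ)
    (fun X Y P ↦ by
      simp only [lieDerivFun, comp, Derivation.add_apply, map_add, add_mul,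
        Finset.sum_add_distrib, smul_add]
      abel)
    (fun c X P ↦ by
      simp only [lieDerivFun, comp, Derivation.smul_apply, Derivation.map_smul, map_smul,
        smul_mul_assoc, ← Finset.smul_sum, smul_add, smul_sub, smul_comm c (δ : 𝕜)])
    (fun X P Q ↦ by
      simp only [lieDerivFun, map_add, mul_add, Finset.sum_add_distrib, smul_add]
      abel)
    (fun c X P ↦ by
      have h : ∀ j : Fin d, MvPolynomial.pderiv j (c • P) = c • MvPolynomial.pderiv j P := by
        intro j
        rw [← algebraMap_smul (SmoothFun 𝕜 d) c P, Derivation.map_smul, algebraMap_smul]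
      simp only [lieDerivFun, map_smul, h, mul_smul_comm,
        ← Finset.smul_sum, smul_add, smul_sub, smul_comm c (δ : 𝕜)])

/-- The value at a point `x ∈ V` of a symbol. -/
def value (x : Fin d → 𝕜) (P : Symbol 𝕜 d) : SymAlg 𝕜 d :=
  MvPolynomial.map ((Pi.evalRingHom (fun _ : Fin d → 𝕜 ↦ 𝕜) x).comp
    (SmoothFun 𝕜 d).val.toRingHom) P

/-- The sections of `V × (I ⊗ Δ^δ V)`, for a subspace `I` of the symmetric algebra of `V`. -/
def sections (I : Submodule 𝕜 (SymAlg 𝕜 d)) : Set (Symbol 𝕜 d) :=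
  {P | ∀ x, value x P ∈ I}

end Symbols

/-! ### Casimir operators -/

section Casimir

variable {𝕜 L M ι : Type*} [Field 𝕜] [AddCommGroup L] [Module 𝕜 L]
  [AddCommGroup M] [Module 𝕜 M] [Fintype ι] [DecidableEq ι]

/-- The Casimir operator `∑ᵢ ρ(eᵢ) ρ(eᵢ*)` of `ρ`, where `(eᵢ*)` is the basis dual to `(eᵢ)` with
respect to the nondegenerate form `β`, i.e. `β(eᵢ, eⱼ*) = δᵢⱼ`. -/
def casimir (ρ : L →ₗ[𝕜] Module.End 𝕜 M) (β : LinearMap.BilinForm 𝕜 L) (hβ : β.Nondegenerate)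
    (e : Module.Basis ι 𝕜 L) : Module.End 𝕜 M :=
  ∑ i, ρ (e i) * ρ (β.flip.dualBasis hβ.flip e i)

/-- The Casimir operator of a Lie algebra `g` of polynomial vector fields acting on the symbol
space by the Lie derivative, with respect to the Killing form of `g`; `e` is a basis of `g`. -/
def symbolCasimir {𝕜 ι : Type*} [RCLike 𝕜] {d : ℕ} [Fintype ι] [DecidableEq ι]
    (g : LieSubalgebra 𝕜 (PolyVect 𝕜 d)) (δ : ℝ) (hβ : (killingForm 𝕜 g).Nondegenerate)
    (e : Module.Basis ι 𝕜 g) : Module.End 𝕜 (Symbol 𝕜 d) :=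
  casimir (M := Symbol 𝕜 d) ((lieDeriv δ).comp g.toSubmodule.subtype) (killingForm 𝕜 g) hβ e

end Casimir

/-! ### Highest weights -/

section HighestWeight

variable {L : Type*} [LieRing L] [LieAlgebra ℂ L] [FiniteDimensional ℂ L]
  [LieAlgebra.IsKilling ℂ L] {C : LieSubalgebra ℂ L} [C.IsCartanSubalgebra]

/-- The form `(·, ·)` on the dual of a Cartan subalgebra induced by the Killing form (on the real
span of the roots it is the usual scalar product). -/
def weightForm (μ ν : Module.Dual ℂ C) : ℂ :=
  killingForm ℂ L ((LieAlgebra.IsKilling.cartanEquivDual C).symm μ : L)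
    ((LieAlgebra.IsKilling.cartanEquivDual C).symm ν : L)

open Classical in
/-- The sum `S` of the positive roots with respect to a simple root system `B`. -/
def sumPosRoots (B : (LieAlgebra.IsKilling.rootSystem C).Base) : Module.Dual ℂ C :=
  ∑ α : C.root with B.IsPos α, (LieAlgebra.IsKilling.rootSystem C).root α

/-- `v` is a highest weight vector of weight `μ`. -/
def IsHighestWeightVector {M : Type*} [AddCommGroup M] [Module ℂ M] [LieRingModule L M]
    (B : (LieAlgebra.IsKilling.rootSystem C).Base) (μ : Module.Dual ℂ C) (v : M) : Prop :=
  v ≠ 0 ∧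
  (∀ α : C.root, B.IsPos α → ∀ x ∈ LieAlgebra.rootSpace C (α : LieModule.Weight ℂ C L),
    ⁅x, v⁆ = 0) ∧
  ∀ h : C, ⁅(h : L), v⁆ = μ h • v

end HighestWeight

section ComplexStructure

variable {𝕜 : Type*} [RCLike 𝕜] [Algebra 𝕜 ℂ]

/-- A complex structure on an `h`-module `E`: a complex scalar multiplication extending the
given one and commuting with `h`. -/
structure ComplexStructure (𝕜 h E : Type*) [RCLike 𝕜] [Algebra 𝕜 ℂ] [LieRing h] [LieAlgebra 𝕜 h]
    [AddCommGroup E] [Module 𝕜 E] [LieRingModule h E] where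
  scalar : ℂ →ₐ[𝕜] Module.End 𝕜 E
  scalar_lie : ∀ (z : ℂ) (x : h) (e : E), scalar z ⁅x, e⁆ = ⁅x, scalar z e⁆

variable {h E : Type*} [LieRing h] [LieAlgebra 𝕜 h] [AddCommGroup E] [Module 𝕜 E]
  [LieRingModule h E] [LieModule 𝕜 h E]

/-- The space `E` seen as a complex vector space through a complex structure. -/
def ComplexStructure.Carrier (_ : ComplexStructure 𝕜 h E) : Type _ := E

variable (J : ComplexStructure 𝕜 h E)

instance : AddCommGroup J.Carrier := inferInstanceAs (AddCommGroup E)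
instance : Module ℂ J.Carrier := Module.compHom E J.scalar.toRingHom

/-- The action of `ℂ ⊗ h` on `E` through a complex structure: `(z ⊗ x) e = z (x e)`. -/
def ComplexStructure.act : ℂ ⊗[𝕜] h →ₗ[𝕜] Module.End 𝕜 E :=
  TensorProduct.lift
    ((LinearMap.mul 𝕜 (Module.End 𝕜 E)).compl₁₂ J.scalar.toLinearMap
      (LieModule.toEnd 𝕜 h E : h →ₗ[𝕜] Module.End 𝕜 E))

theorem ComplexStructure.act_tmul (z : ℂ) (x : h) (e : E) :
    J.act (z ⊗ₜ x) e = J.scalar z ⁅x, e⁆ := rfl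

theorem ComplexStructure.act_lie (a b : ℂ ⊗[𝕜] h) (e : E) :
    J.act ⁅a, b⁆ e = J.act a (J.act b e) - J.act b (J.act a e) := by
  induction a using TensorProduct.induction_on with
  | zero => simp
  | add a₁ a₂ h₁ h₂ =>
    simp only [add_lie, map_add, LinearMap.add_apply, h₁, h₂]; abel
  | tmul z x =>
    induction b using TensorProduct.induction_on with
    | zero => simp
    | add b₁ b₂ h₁ h₂ =>
      simp only [lie_add, map_add, LinearMap.add_apply, h₁, h₂]; abel
    | tmul w y =>
      rw [LieAlgebra.ExtendScalars.bracket_tmul]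
      simp only [act_tmul]
      rw [← J.scalar_lie, ← J.scalar_lie, ← Module.End.mul_apply, ← Module.End.mul_apply,
        ← map_mul, ← map_mul, mul_comm w z, ← map_sub, lie_lie]

instance : LieRingModule (ℂ ⊗[𝕜] h) J.Carrier where
  bracket a e := J.act a (show E from e)
  add_lie a b e := by
    change J.act (a + b) _ = _
    rw [map_add]; rfl
  lie_add a e f := map_add (J.act a) _ _
  leibniz_lie a b e := by
    change J.act a (J.act b _) = J.act ⁅a, b⁆ _ + J.act b (J.act a _)
    rw [J.act_lie]
    exact (sub_add_cancel _ _).symm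

variable [FiniteDimensional ℂ (ℂ ⊗[𝕜] h)] [LieAlgebra.IsKilling ℂ (ℂ ⊗[𝕜] h)]
  {C : LieSubalgebra ℂ (ℂ ⊗[𝕜] h)} [C.IsCartanSubalgebra]

variable (𝕜 E) in
/-- `μ` is the highest weight `μ_E` of the irreducible `h`-module `E`. If `ℂ ⊗ E` is irreducible
over `ℂ ⊗ h`, it is the highest weight of `ℂ ⊗ E`. Otherwise, it is the highest weight of `E`
seen as a complex representation of `ℂ ⊗ h` through a complex structure on `E`. -/
def IsHighestWeight (B : (LieAlgebra.IsKilling.rootSystem C).Base) (μ : Module.Dual ℂ C) : Prop :=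
  (LieModule.IsIrreducible ℂ (ℂ ⊗[𝕜] h) (ℂ ⊗[𝕜] E) ∧
    ∃ v : ℂ ⊗[𝕜] E, IsHighestWeightVector B μ v) ∨
  (¬ LieModule.IsIrreducible ℂ (ℂ ⊗[𝕜] h) (ℂ ⊗[𝕜] E) ∧
    ∃ (J : ComplexStructure 𝕜 h E) (v : J.Carrier), IsHighestWeightVector B μ v)

end ComplexStructure

end IFFT

end

/-! The structure of 𝔤 is determined first; then the Casimir operator is computed at one point at a
time.

Maximality enters through one dichotomy: a proper subalgebra containing 𝔤 equals 𝔤, and an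
infinite-dimensional one is everything. Applied to 𝔤 + 𝕜E, with E the Euler field, it gives E ∈ 𝔤.
Applied to stabilizers of spaces of polynomials, it shows that 𝔤 contains all constant fields
(`constField_mem_of_isCoatom`) and that 𝔤₀ acts irreducibly on V (`eq_bot_or_eq_top_of_stable`).
Applied to the projective algebra, it gives a nonzero quadratic field in 𝔤. A nonzero abelian ideal
would contain the constants and force that quadratic field to vanish, so 𝔤 is semisimple and its
Killing form κ is nondegenerate.

By invariance under ad E, κ pairs degree m only with degree 2 - m (degrees of the components). Hence
𝔤 = 𝔤₋₁ ⊕ 𝔤₀ ⊕ 𝔤₁ with 𝔤₁ dual to 𝔤₋₁. Since 𝔥₀ is absolutely simple, the centre of 𝔤₀ consists of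
multiples of E (`eq_smul_euler_of_central`), so 𝔤₀ = 𝔥₀ + 𝕜E. Traces on the three pieces give κ(E,
E) = 2d and κ = s κ₀ on 𝔥₀, where κ₀ is the Killing form of 𝔥₀, s = 1 + 2t, and t is the ratio of
the trace form of 𝔤₋₁ to κ₀. The trace of the Casimir operator of 𝔥₀ on 𝔤₋₁ gives t dim 𝔥₀ = d(μ,
μ+S); the fraction in the statement is s⁻¹.

The Casimir operator does not depend on the pair of dual families (`IsDualPair.sum_eq`). At a point
x one uses the constants eᵢ with their quadratic duals εᵢ, E with E/2d, and a family of 𝔥₀ with its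
κ₀-dual divided by s, all translated from 0 to x. The translated εᵢ vanish to second order at x, so
the terms εᵢeᵢ contribute nothing, while the terms eᵢεᵢ contribute the action of ∑[eᵢ, εᵢ] = -E/2.
On the fibre the operator is therefore -E/2 + E²/2d + s⁻¹C₀, with C₀ the Casimir operator of 𝔥₀
(`valueHom_symbolCasimir`). On ∨ᵏV, E acts by dδ - k, which yields the first summand of the
eigenvalue.

On an irreducible module C₀ is the real scalar (ν, ν+S): this is the classical computation on a
highest weight vector, made in the complexification or through a complex structure
(`casEnd_eq_of_isHighestWeight`). Diagonalizability follows from complete reducibility of ∨ᵏV under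
𝔥₀, proved over 𝕜 by means of the Casimir operator itself. -/

noncomputable section

namespace IFFT

/-! ### Dual families for a bilinear form -/

section DualPair

variable {K L N : Type*} [Field K] [AddCommGroup L] [Module K L] [AddCommGroup N] [Module K N]
  {ι ι' : Type*} [Fintype ι] [Fintype ι']

/-- Two finite families are dual with respect to a bilinear form if they reproduce every vector. -/
def IsDualPair (β : LinearMap.BilinForm K L) (u w : ι → L) : Prop :=
  ∀ x, ∑ i, β x (w i) • u i = x

theorem IsDualPair.right {β : LinearMap.BilinForm K L} (hβ : β.Nondegenerate) {u w : ι → L}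
    (h : IsDualPair β u w) (y : L) : ∑ i, β (u i) y • w i = y := by
  rw [← sub_eq_zero]
  refine hβ.2 _ fun x ↦ ?_
  rw [map_sub, map_sum, sub_eq_zero]
  conv_rhs => rw [← h x, map_sum, LinearMap.sum_apply]
  simp [mul_comm]

/-- Expanding each vector of `u` in `u'` and moving the coefficients to the second slot recombines
`w` into `w'`: the tensor ∑ uᵢ ⊗ wᵢ is canonical. This allows the dual families to be changed
freely, even from one point of V to another. -/
theorem IsDualPair.sum_eq {β : LinearMap.BilinForm K L} (hβ : β.Nondegenerate) {u w : ι → L}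
    {u' w' : ι' → L} (h : IsDualPair β u w) (h' : IsDualPair β u' w') (f : L →ₗ[K] L →ₗ[K] N) :
    ∑ i, f (u i) (w i) = ∑ j, f (u' j) (w' j) := by
  calc ∑ i, f (u i) (w i) = ∑ i, f (∑ j, β (u i) (w' j) • u' j) (w i) := by simp_rw [h' _]
    _ = ∑ j, f (u' j) (∑ i, β (u i) (w' j) • w i) := by
      simp only [map_sum, LinearMap.sum_apply, map_smul, LinearMap.smul_apply]
      exact Finset.sum_comm
    _ = _ := by simp_rw [h.right hβ]

/-- The flips put the dual basis in the second slot of `β`, the convention used to define `casimir`.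
-/
theorem isDualPair_dualBasis [DecidableEq ι] (β : LinearMap.BilinForm K L) (hβ : β.Nondegenerate)
    (e : Module.Basis ι K L) : IsDualPair β e (β.flip.dualBasis hβ.flip e) := by
  have h : ∀ i j, β (e i) (β.flip.dualBasis hβ.flip e j) = if i = j then 1 else 0 := fun i j ↦
    LinearMap.BilinForm.apply_dualBasis_left hβ.flip e j i
  intro x
  suffices hs : ∑ i, (β.flip (β.flip.dualBasis hβ.flip e i)).smulRight (e i) = LinearMap.id by
    simpa using LinearMap.congr_fun hs x
  refine e.ext fun j ↦ ?_
  simp [h]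

theorem exists_isDualPair [FiniteDimensional K L] (β : LinearMap.BilinForm K L)
    (hβ : β.Nondegenerate) :
    ∃ u w : Fin (Module.finrank K L) → L, IsDualPair β u w :=
  ⟨_, _, isDualPair_dualBasis β hβ (Module.finBasis K L)⟩

/-- The families need not be bases: the reproducing property alone writes f as the tensor ∑ φᵢ ⊗
f(uᵢ), whose contraction is the trace. -/
theorem trace_eq_sum_dual [FiniteDimensional K L] (u : ι → L) (φ : ι → Module.Dual K L)
    (h : ∀ x, ∑ i, φ i x • u i = x) (f : Module.End K L) :
    LinearMap.trace K L f = ∑ i, φ i (f (u i)) := by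
  have hf : f = dualTensorHom K L L (∑ i, φ i ⊗ₜ f (u i)) := by
    ext x
    conv_lhs => rw [← h x]
    simp [map_sum]
  conv_lhs => rw [hf]
  rw [LinearMap.trace_eq_contract_apply]
  simp

theorem IsDualPair.trace_eq [FiniteDimensional K L] {β : LinearMap.BilinForm K L} {u w : ι → L}
    (h : IsDualPair β u w) (f : Module.End K L) :
    LinearMap.trace K L f = ∑ i, β (f (u i)) (w i) :=
  trace_eq_sum_dual u (fun i ↦ β.flip (w i)) h f

theorem IsDualPair.finrank_eq [FiniteDimensional K L] {β : LinearMap.BilinForm K L} {u w : ι → L}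
    (h : IsDualPair β u w) : (Module.finrank K L : K) = ∑ i, β (u i) (w i) := by
  rw [← LinearMap.trace_id]
  exact h.trace_eq LinearMap.id

end DualPair

/-! ### Casimir operators on Lie modules -/

section CasimirEnd

variable {K L : Type*} [Field K] [LieRing L] [LieAlgebra K L] {ι ι' : Type*} [Fintype ι] [Fintype ι']
  (M : Type*) [AddCommGroup M] [Module K M] [LieRingModule L M] [LieModule K L M]

variable (K) in
/-- The operator `∑ uᵢ wᵢ` on a Lie module. -/
def casEnd (u w : ι → L) : Module.End K M :=
  ∑ i, LieModule.toEnd K L M (u i) * LieModule.toEnd K L M (w i)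

variable {M}

theorem casEnd_apply (u w : ι → L) (m : M) : casEnd K M u w m = ∑ i, ⁅u i, ⁅w i, m⁆⁆ := by
  simp [casEnd]

theorem casEnd_eq {β : LinearMap.BilinForm K L} (hβ : β.Nondegenerate) {u w : ι → L}
    {u' w' : ι' → L} (h : IsDualPair β u w) (h' : IsDualPair β u' w') :
    casEnd K M u w = casEnd K M u' w' := by
  simpa [casEnd] using h.sum_eq hβ h' ((LinearMap.mul K (Module.End K M)).compl₁₂
    (LieModule.toEnd K L M : L →ₗ[K] Module.End K M)
    (LieModule.toEnd K L M : L →ₗ[K] Module.End K M))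

/-- By invariance of β, the coefficients of ad y on `u` and on `w` are opposite transposes, so the
two contributions of the Leibniz rule cancel. -/
theorem casEnd_lie {β : LinearMap.BilinForm K L} (hβ : β.Nondegenerate)
    (hinv : ∀ x y z, β ⁅x, y⁆ z = β x ⁅y, z⁆) {u w : ι → L} (h : IsDualPair β u w)
    (y : L) (m : M) : casEnd K M u w ⁅y, m⁆ = ⁅y, casEnd K M u w m⁆ := by
  have h1 : ∀ i, ⁅y, u i⁆ = ∑ j, β ⁅y, u i⁆ (w j) • u j := fun i ↦ (h _).symm
  have h2 : ∀ j, ∑ i, β ⁅y, u i⁆ (w j) • w i = -⁅y, w j⁆ := by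
    intro j
    rw [← h.right hβ ⁅y, w j⁆, ← Finset.sum_neg_distrib]
    refine Finset.sum_congr rfl fun i _ ↦ ?_
    rw [← hinv, ← lie_skew, map_neg, LinearMap.neg_apply, neg_smul]
  have h3 : ∑ i, ⁅⁅y, u i⁆, ⁅w i, m⁆⁆ = -∑ j, ⁅u j, ⁅⁅y, w j⁆, m⁆⁆ := by
    calc ∑ i, ⁅⁅y, u i⁆, ⁅w i, m⁆⁆ = ∑ i, ⁅∑ j, β ⁅y, u i⁆ (w j) • u j, ⁅w i, m⁆⁆ := by
          simp_rw [← h1]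
      _ = ∑ j, ⁅u j, ⁅∑ i, β ⁅y, u i⁆ (w j) • w i, m⁆⁆ := by
          simp only [sum_lie, lie_sum, smul_lie, lie_smul]
          exact Finset.sum_comm
      _ = _ := by simp_rw [h2, neg_lie, lie_neg, Finset.sum_neg_distrib]
  rw [casEnd_apply, casEnd_apply, lie_sum, ← sub_eq_zero, ← neg_eq_zero, neg_sub,
    ← Finset.sum_sub_distrib]
  have h4 : ∀ i, ⁅y, ⁅u i, ⁅w i, m⁆⁆⁆ - ⁅u i, ⁅w i, ⁅y, m⁆⁆⁆ =
      ⁅⁅y, u i⁆, ⁅w i, m⁆⁆ + ⁅u i, ⁅⁅y, w i⁆, m⁆⁆ := by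
    intro i
    rw [leibniz_lie y (u i), leibniz_lie y (w i), lie_add]
    abel
  simp_rw [h4, Finset.sum_add_distrib, h3]
  exact neg_add_cancel _

/-- The trace of each product uᵢwᵢ is t β(uᵢ, wᵢ), and ∑ β(uᵢ, wᵢ) is the dimension of L. -/
theorem trace_casEnd [FiniteDimensional K L] [FiniteDimensional K M]
    {β : LinearMap.BilinForm K L} {u w : ι → L}
    (h : IsDualPair β u w) {t : K} (ht : LieModule.traceForm K L M = t • β) :
    LinearMap.trace K M (casEnd K M u w) = t * Module.finrank K L := by
  rw [h.finrank_eq, casEnd, map_sum, Finset.mul_sum]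
  refine Finset.sum_congr rfl fun i _ ↦ ?_
  have := LinearMap.congr_fun₂ ht (u i) (w i)
  rw [LieModule.traceForm_apply_apply] at this
  simpa [Module.End.mul_eq_comp] using this

/-- The kernel of `c - a`, as a Lie submodule, for an operator `c` commuting with the action. -/
def eigenLieSubmodule (c : Module.End K M) (hc : ∀ (y : L) m, c ⁅y, m⁆ = ⁅y, c m⁆) (a : K) :
    LieSubmodule K L M where
  toSubmodule := c.eigenspace a
  lie_mem {x m} hm := by
    have hm' : c m = a • m := Module.End.mem_eigenspace_iff.1 hm
    change ⁅x, m⁆ ∈ c.eigenspace a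
    rw [Module.End.mem_eigenspace_iff, hc, hm', lie_smul]

theorem mem_eigenLieSubmodule {c : Module.End K M} {hc : ∀ (y : L) m, c ⁅y, m⁆ = ⁅y, c m⁆} {a : K}
    {m : M} : m ∈ eigenLieSubmodule c hc a ↔ c m = a • m :=
  Module.End.mem_eigenspace_iff

/-- Schur's lemma in the form that needs neither an algebraically closed field nor finite dimension,
because an eigenvector is supplied. -/
theorem eq_smul_of_eigenvector [LieModule.IsIrreducible K L M] (c : Module.End K M)
    (hc : ∀ (y : L) m, c ⁅y, m⁆ = ⁅y, c m⁆) {a : K} {v : M} (hv : v ≠ 0) (hcv : c v = a • v)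
    (m : M) : c m = a • m := by
  have hne : eigenLieSubmodule c hc a ≠ ⊥ := fun h ↦ hv <| by
    rw [← LieSubmodule.mem_bot (R := K) (L := L), ← h]
    exact mem_eigenLieSubmodule.2 hcv
  have htop := (eq_bot_or_eq_top (eigenLieSubmodule c hc a)).resolve_left hne
  exact mem_eigenLieSubmodule.1 (htop ▸ LieSubmodule.mem_top m)

end CasimirEnd

/-! ### Lie algebras whose complexification is simple -/

section AbsolutelySimple

variable {K L : Type*} [Field K] [Algebra K ℂ] [LieRing L] [LieAlgebra K L]

theorem baseChange_lie (f : L →ₗ[K] L) (hf : ∀ x y : L, f ⁅x, y⁆ = ⁅x, f y⁆) (x y : ℂ ⊗[K] L) :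
    f.baseChange ℂ ⁅x, y⁆ = ⁅x, f.baseChange ℂ y⁆ := by
  induction x using TensorProduct.induction_on with
  | zero => simp
  | add a b ha hb => simp only [add_lie, map_add, ha, hb]
  | tmul z a =>
    induction y using TensorProduct.induction_on with
    | zero => simp
    | add c d hc hd => simp only [lie_add, map_add, hc, hd]
    | tmul w b => simp [hf]

variable (K L) in
theorem nontrivial_of_baseChange_isSimple [LieAlgebra.IsSimple ℂ (ℂ ⊗[K] L)] : Nontrivial L := by
  by_contra h
  rw [not_nontrivial_iff_subsingleton] at h
  have := LieAlgebra.IsSimple.nontrivial ℂ (ℂ ⊗[K] L)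
  obtain ⟨x, hx⟩ := exists_ne (0 : ℂ ⊗[K] L)
  refine hx ?_
  induction x using TensorProduct.induction_on with
  | zero => rfl
  | add a b ha hb =>
    by_cases h1 : a = 0
    · by_cases h2 : b = 0
      · simp [h1, h2]
      · exact absurd (hb h2) h2
    · exact absurd (ha h1) h1
  | tmul z a => rw [Subsingleton.elim a 0, TensorProduct.tmul_zero]

variable [FiniteDimensional K L] [LieAlgebra.IsSimple ℂ (ℂ ⊗[K] L)]

/-- Over ℂ the adjoint module is irreducible, so the base change of f is a scalar. Comparing traces
shows that this scalar is tr f / dim L, hence lies in K. Simplicity over K alone would not suffice: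
a complex simple algebra seen over ℝ has a complex centroid. -/
theorem exists_smul_of_commutes [CharZero K] (f : L →ₗ[K] L) (hf : ∀ x y : L, f ⁅x, y⁆ = ⁅x, f y⁆) :
    ∃ c : K, ∀ x, f x = c • x := by
  have hnt := LieAlgebra.IsSimple.nontrivial ℂ (ℂ ⊗[K] L)
  have hnt' := nontrivial_of_baseChange_isSimple K L
  obtain ⟨a, ha⟩ := Module.End.exists_eigenvalue (f.baseChange ℂ : Module.End ℂ (ℂ ⊗[K] L))
  obtain ⟨v, hv⟩ := ha.exists_hasEigenvector
  have key := eq_smul_of_eigenvector (L := ℂ ⊗[K] L) (f.baseChange ℂ)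
    (baseChange_lie f hf) hv.2 hv.apply_eq_smul
  have h1 : f.baseChange ℂ = a • LinearMap.id := LinearMap.ext key
  have htr := congrArg (LinearMap.trace ℂ _) h1
  rw [LinearMap.trace_baseChange, map_smul, LinearMap.trace_id, Module.finrank_baseChange,
    smul_eq_mul] at htr
  have hd : (Module.finrank K L : K) ≠ 0 := by
    exact_mod_cast Module.finrank_pos.ne'
  have ha' : a = algebraMap K ℂ (LinearMap.trace K L f / Module.finrank K L) := by
    rw [map_div₀, htr, map_natCast, mul_div_assoc, div_self, mul_one]
    exact_mod_cast Module.finrank_pos.ne'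
  refine ⟨LinearMap.trace K L f / Module.finrank K L, fun x ↦ ?_⟩
  have h2 : f = (LinearMap.trace K L f / Module.finrank K L) • LinearMap.id := by
    refine LinearMap.baseChangeHom_injective K L ℂ ?_
    change f.baseChange ℂ = ((LinearMap.trace K L f / Module.finrank K L) •
      (LinearMap.id : L →ₗ[K] L)).baseChange ℂ
    rw [LinearMap.baseChange_smul, h1, ha', algebraMap_smul, LinearMap.baseChange_id]
  exact LinearMap.congr_fun h2 x

variable (K L) in
theorem isSimple_of_baseChange : LieAlgebra.IsSimple K L where
  eq_bot_or_eq_top I := by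
    have hbc : ∀ x : L, (1 : ℂ) ⊗ₜ[K] x ∈ I.baseChange ℂ → x ∈ I := by
      intro x hx
      by_contra hxI
      obtain ⟨f, hf, hfI⟩ := Submodule.exists_dual_map_eq_bot_of_notMem
        (p := I.toSubmodule) hxI inferInstance
      have hz : ∀ y ∈ I.baseChange ℂ, f.baseChange ℂ y = 0 := by
        intro y hy
        rw [LieSubmodule.mem_baseChange_iff] at hy
        induction hy using Submodule.span_induction with
        | mem z hz =>
          obtain ⟨w, hw, rfl⟩ := hz
          have : f w = 0 := by
            rw [← Submodule.mem_bot K, ← hfI]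
            exact Submodule.mem_map_of_mem hw
          simp [this]
        | zero => simp
        | add a b _ _ ha hb => rw [map_add, ha, hb, add_zero]
        | smul c a _ ha => rw [map_smul, ha, smul_zero]
      have h0 := hz _ hx
      have h1 : f x • (1 : ℂ) = 0 := by simpa using h0
      exact hf ((smul_eq_zero.1 h1).resolve_right one_ne_zero)
    have hinj : Function.Injective (fun x : L ↦ (1 : ℂ) ⊗ₜ[K] x) :=
      fun x y hxy ↦ by
        have := (Module.FaithfullyFlat.tensorProduct_mk_injective (A := K) (B := ℂ) L)
        exact this hxy
    rcases LieAlgebra.IsSimple.eq_bot_or_eq_top (R := ℂ) (I.baseChange ℂ) with h | h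
    · left
      rw [LieSubmodule.eq_bot_iff]
      intro x hx
      have := LieSubmodule.tmul_mem_baseChange_of_mem (1 : ℂ) hx
      rw [h, LieSubmodule.mem_bot] at this
      exact hinj (this.trans (TensorProduct.tmul_zero _ _).symm)
    · right
      rw [eq_top_iff]
      intro x _
      exact hbc x (h ▸ LieSubmodule.mem_top _)
  non_abelian h := by
    refine LieAlgebra.IsSimple.non_abelian (R := ℂ) (L := ℂ ⊗[K] L) ⟨fun x y ↦ ?_⟩
    induction x using TensorProduct.induction_on with
    | zero => simp
    | add a b ha hb => simp only [add_lie, ha, hb, add_zero]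
    | tmul z a =>
      induction y using TensorProduct.induction_on with
      | zero => simp
      | add c d hc hd => simp only [lie_add, hc, hd, add_zero]
      | tmul w b => rw [LieAlgebra.ExtendScalars.bracket_tmul, h.trivial, TensorProduct.tmul_zero]

variable [CharZero K]

/-- An invariant form is κ(A·, ·) for an operator A commuting with the adjoint action, and such an A
is a scalar. -/
theorem exists_eq_smul_killingForm (hκ : (killingForm K L).Nondegenerate)
    (φ : LinearMap.BilinForm K L)
    (hφ : ∀ x y z, φ ⁅x, y⁆ z = φ x ⁅y, z⁆) : ∃ t : K, φ = t • killingForm K L := by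
  let A : L →ₗ[K] L := ((killingForm K L).toDual hκ).symm.toLinearMap ∘ₗ φ
  have hA : ∀ x y, killingForm K L (A x) y = φ x y := fun x y ↦
    LinearMap.BilinForm.apply_toDual_symm_apply (hB := hκ) (φ x) y
  obtain ⟨t, ht⟩ := exists_smul_of_commutes A fun x y ↦ by
    rw [← sub_eq_zero]
    refine hκ.1 _ fun z ↦ ?_
    rw [map_sub, LinearMap.sub_apply, hA, ← lie_skew x (A y), map_neg, LinearMap.neg_apply,
      LieModule.traceForm_apply_lie_apply, hA, ← hφ, ← lie_skew y x, map_neg, LinearMap.neg_apply]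
    abel
  refine ⟨t, LinearMap.ext₂ fun x y ↦ ?_⟩
  rw [← hA, ht]
  simp

end AbsolutelySimple

/-! ### Simple algebras are perfect -/

section Perfect

variable {K L : Type*} [Field K] [LieRing L] [LieAlgebra K L]

variable (K L) in
theorem derivedSeries_one_eq_top [LieAlgebra.IsSimple K L] :
    LieAlgebra.derivedSeries K L 1 = ⊤ := by
  refine (LieAlgebra.IsSimple.eq_bot_or_eq_top _).resolve_left fun h ↦
    LieAlgebra.IsSimple.non_abelian (R := K) (L := L) ?_
  rw [LieAlgebra.derivedSeries_def, ← LieAlgebra.abelian_iff_derived_one_eq_bot] at h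
  exact (lie_abelian_iff_equiv_lie_abelian LieIdeal.topEquiv).1 h

/-- Since L = [L, L], a linear condition on elements of L has to be verified on brackets only. -/
theorem eq_top_of_lie_mem [LieAlgebra.IsSimple K L] (p : Submodule K L)
    (h : ∀ x y : L, ⁅x, y⁆ ∈ p) : p = ⊤ := by
  have h1 := congrArg LieSubmodule.toSubmodule (derivedSeries_one_eq_top K L)
  rw [LieAlgebra.derivedSeries_def, LieAlgebra.derivedSeriesOfIdeal_succ,
    LieAlgebra.derivedSeriesOfIdeal_zero, LieSubmodule.lieIdeal_oper_eq_linear_span'] at h1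
  rw [eq_top_iff]
  refine le_trans h1.ge ?_
  rw [Submodule.span_le]
  rintro _ ⟨x, _, y, _, rfl⟩
  exact h x y

end Perfect

end IFFT

end

noncomputable section

namespace IFFT

/-! ### Irreducible submodules and nilpotent Casimir operators -/

section Semisimplicity

variable {K L : Type*} [Field K] [LieRing L] [LieAlgebra K L] {ι : Type*} [Fintype ι]
  {M N : Type*} [AddCommGroup M] [Module K M] [LieRingModule L M] [LieModule K L M]
  [AddCommGroup N] [Module K N] [LieRingModule L N] [LieModule K L N]

theorem isIrreducible_of_isAtom {A : LieSubmodule K L M} (hA : IsAtom A) :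
    LieModule.IsIrreducible K L A := by
  have : Nontrivial A := (LieSubmodule.nontrivial_iff_ne_bot K L M).2 hA.1
  refine LieModule.IsIrreducible.mk fun P hP ↦ ?_
  have h1 : P.map A.incl ≤ A := by
    rw [LieSubmodule.map_le_iff_le_comap]
    intro x _
    exact x.2
  have h2 : P.map A.incl ≠ ⊥ := fun h ↦ hP <| by
    rw [LieSubmodule.eq_bot_iff] at h ⊢
    intro x hx
    exact Subtype.ext (h _ (LieSubmodule.mem_map_of_mem hx))
  have h3 := (hA.le_iff.1 h1).resolve_left h2
  rw [eq_top_iff]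
  intro x _
  have h4 : (x : M) ∈ P.map A.incl := by rw [h3]; exact x.2
  obtain ⟨y, hy, hyx⟩ := (LieSubmodule.mem_map _).1 h4
  rwa [← Subtype.ext hyx]

theorem casEnd_map (u w : ι → L) (f : M →ₗ⁅K,L⁆ N) (m : M) :
    f (casEnd K M u w m) = casEnd K N u w (f m) := by
  simp [casEnd_apply, map_sum]

theorem casEnd_pow_map (u w : ι → L) (f : M →ₗ⁅K,L⁆ N) (n : ℕ) (m : M) :
    f ((casEnd K M u w ^ n) m) = (casEnd K N u w ^ n) (f m) := by
  induction n generalizing m with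
  | zero => simp
  | succ n ih => rw [pow_succ, pow_succ, Module.End.mul_apply, Module.End.mul_apply, ih, casEnd_map]

/-- A nilpotent operator has a nonzero kernel vector, which Schur's lemma takes as an eigenvector of
eigenvalue 0. -/
theorem casEnd_eq_zero_of_isNilpotent [LieModule.IsIrreducible K L M] {u w : ι → L}
    (hc : ∀ (y : L) (m : M), casEnd K M u w ⁅y, m⁆ = ⁅y, casEnd K M u w m⁆)
    (hnil : IsNilpotent (casEnd K M u w)) : casEnd K M u w = 0 := by
  have hnt := LieModule.nontrivial_of_isIrreducible K L M
  obtain ⟨v, hv, hv0⟩ : ∃ v, casEnd K M u w v = 0 ∧ v ≠ 0 := by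
    by_contra! hcon
    have hinj : Function.Injective (casEnd K M u w) :=
      (injective_iff_map_eq_zero _).2 hcon
    obtain ⟨n, hn⟩ := hnil
    obtain ⟨x, hx⟩ := exists_ne (0 : M)
    refine hx (hinj.iterate n ?_)
    rw [← Module.End.coe_pow, hn]
    simp
  ext m
  simpa using eq_smul_of_eigenvector (K := K) _ hc hv0 (hv.trans (zero_smul K v).symm) m

end Semisimplicity

/-! ### Weyl's theorem over a field embedded in ℂ -/

section Weyl

variable {K L : Type*} [Field K] [LieRing L] [LieAlgebra K L] {ι : Type*} [Fintype ι]

theorem lie_eq_zero_of_lie_lie_eq_zero [LieAlgebra.IsSimple K L] {M : Type*} [AddCommGroup M]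
    [Module K M] [LieRingModule L M] [LieModule K L M] (h : ∀ (x y : L) (m : M), ⁅x, ⁅y, m⁆⁆ = 0)
    (x : L) (m : M) : ⁅x, m⁆ = 0 := by
  have h1 := eq_top_of_lie_mem (LinearMap.ker (LieModule.toEnd K L M : L →ₗ[K] Module.End K M))
    fun x y ↦ by
      rw [LinearMap.mem_ker]
      ext m
      change ⁅⁅x, y⁆, m⁆ = 0
      rw [lie_lie, h, h, sub_zero]
  have h2 : x ∈ LinearMap.ker (LieModule.toEnd K L M : L →ₗ[K] Module.End K M) :=
    h1 ▸ Submodule.mem_top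
  exact LinearMap.congr_fun (LinearMap.mem_ker.1 h2) m

/-- A representation of a simple Lie algebra by nilpotent endomorphisms on an irreducible module is
trivial. -/
theorem isTrivial_of_traceForm_eq_zero [CharZero K] [LieAlgebra.IsSimple K L] {M : Type*} [AddCommGroup M]
    [Module K M] [LieRingModule L M] [LieModule K L M] [FiniteDimensional K M]
    [LieModule.IsIrreducible K L M] (h : LieModule.traceForm K L M = 0) :
    LieModule.IsTrivial L M := by
  -- Cartan's criterion makes the derived algebra act nilpotently, and the derived algebra is all of
  -- L. A nonzero nilpotent module has nonzero invariants, which exhaust an irreducible one.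
  have h1 := LieModule.isNilpotent_derivedSeries_of_traceForm_eq_zero h
  have h2 : LieModule.IsNilpotent L M := by
    rw [LieModule.isNilpotent_iff_forall' (R := K)] at h1 ⊢
    intro x
    exact h1 ⟨x, derivedSeries_one_eq_top K L ▸ LieSubmodule.mem_top x⟩
  have hnt := LieModule.nontrivial_of_isIrreducible K L M
  have h3 : LieModule.maxTrivSubmodule K L M ≠ ⊥ := by
    have := LieModule.nontrivial_max_triv_of_isNilpotent K L M
    exact (LieSubmodule.nontrivial_iff_ne_bot K L M).1 this
  have h4 := (eq_bot_or_eq_top _).resolve_left h3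
  exact (LieModule.isTrivial_iff_max_triv_eq_top K L M).2 h4

variable [CharZero K] [FiniteDimensional K L] [Algebra K ℂ] [LieAlgebra.IsSimple ℂ (ℂ ⊗[K] L)]
  {u w : ι → L} (h : IsDualPair (killingForm K L) u w)

include h

/-- The trace form is t times the Killing form, and t dim L is the trace of the Casimir operator;
hence t = 0. -/
theorem isTrivial_of_casEnd_eq_zero {M : Type*} [AddCommGroup M]
    [Module K M] [LieRingModule L M] [LieModule K L M] [FiniteDimensional K M]
    [LieModule.IsIrreducible K L M] (hc : casEnd K M u w = 0) :
    LieModule.IsTrivial L M := by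
  have := isSimple_of_baseChange K L
  have hnt := nontrivial_of_baseChange_isSimple K L
  obtain ⟨t, ht⟩ := exists_eq_smul_killingForm
    (LieAlgebra.IsKilling.killingForm_nondegenerate K L) (LieModule.traceForm K L M)
    (LieModule.traceForm_apply_lie_apply K L M)
  have h1 := trace_casEnd h ht
  rw [hc, map_zero] at h1
  have h2 : t = 0 := (mul_eq_zero.1 h1.symm).resolve_right <| by
    exact_mod_cast Module.finrank_pos.ne'
  rw [h2, zero_smul] at ht
  exact isTrivial_of_traceForm_eq_zero ht

theorem casEnd_killing_lie {M : Type*} [AddCommGroup M] [Module K M] [LieRingModule L M]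
    [LieModule K L M] (y : L) (m : M) : casEnd K M u w ⁅y, m⁆ = ⁅y, casEnd K M u w m⁆ := by
  have := isSimple_of_baseChange K L
  exact casEnd_lie (LieAlgebra.IsKilling.killingForm_nondegenerate K L)
    (LieModule.traceForm_apply_lie_apply K L L) h y m

/-- Induction on the dimension: L acts trivially on an irreducible submodule and on the quotient by
it, so double brackets vanish, and perfectness removes one bracket. Consequently the generalized
0-eigenspace of the Casimir operator consists of invariants. -/
theorem isTrivial_of_isNilpotent_casEnd (n : ℕ) : ∀ {M : Type*} [AddCommGroup M]
    [Module K M] [LieRingModule L M] [LieModule K L M] [FiniteDimensional K M],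
    Module.finrank K M = n → IsNilpotent (casEnd K M u w) → LieModule.IsTrivial L M := by
  have := isSimple_of_baseChange K L
  induction n using Nat.strong_induction_on with
  | _ n ih =>
  intro M _ _ _ _ _ hn hnil
  rcases subsingleton_or_nontrivial M with hM | hM
  · exact ⟨fun _ _ ↦ Subsingleton.elim _ _⟩
  obtain ⟨A, hA, -⟩ := (eq_bot_or_exists_atom_le (⊤ : LieSubmodule K L M)).resolve_left top_ne_bot
  have hAi := isIrreducible_of_isAtom hA
  obtain ⟨k, hk⟩ := hnil
  have hA0 : LieModule.IsTrivial L A := by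
    refine isTrivial_of_casEnd_eq_zero h (casEnd_eq_zero_of_isNilpotent (casEnd_killing_lie h)
      ⟨k, LinearMap.ext fun x ↦ Subtype.ext ?_⟩)
    exact (casEnd_pow_map u w A.incl k x).trans (by rw [hk]; rfl)
  have hQ : LieModule.IsTrivial L (M ⧸ A) := by
    refine ih _ ?_ rfl ⟨k, LinearMap.ext fun q ↦ ?_⟩
    · have h1 := A.toSubmodule.finrank_quotient_add_finrank
      have h2 : 0 < Module.finrank K A.toSubmodule := by
        have : Nontrivial A.toSubmodule := (LieSubmodule.nontrivial_iff_ne_bot K L M).2 hA.1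
        exact Module.finrank_pos
      change Module.finrank K (M ⧸ A.toSubmodule) < n
      omega
    · obtain ⟨m, rfl⟩ := LieSubmodule.Quotient.surjective_mk' A q
      rw [← casEnd_pow_map, hk]
      simp
  refine ⟨fun x m ↦ lie_eq_zero_of_lie_lie_eq_zero (K := K) (fun x y m ↦ ?_) x m⟩
  have h1 : ⁅y, m⁆ ∈ A := by
    rw [← LieSubmodule.Quotient.mk_eq_zero, LieModuleHom.map_lie]
    exact hQ.trivial _ _
  exact congrArg Subtype.val (hA0.trivial x ⟨_, h1⟩)

/-- Taking invariants is exact on finite-dimensional modules. -/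
theorem exists_invariant_lift {M N : Type*} [AddCommGroup M] [Module K M] [LieRingModule L M]
    [LieModule K L M] [FiniteDimensional K M] [AddCommGroup N] [Module K N] [LieRingModule L N]
    [LieModule K L N] [FiniteDimensional K N] (f : M →ₗ⁅K,L⁆ N) (hf : Function.Surjective f)
    {n : N} (hn : ∀ x : L, ⁅x, n⁆ = 0) : ∃ m, f m = n ∧ ∀ x : L, ⁅x, m⁆ = 0 := by
  -- One power k ≥ 1 gives the Fitting decompositions of both M and N. The component m₀ of a
  -- preimage in the kernel is invariant. The image of the other component is also invariant, hence
  -- lies in both the kernel and the range of the k-th power on N, and is zero.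
  obtain ⟨k, ⟨hk1, hk2⟩, hk3⟩ :=
    ((((casEnd K M u w).eventually_isCompl_ker_pow_range_pow).and
      ((casEnd K N u w).eventually_isCompl_ker_pow_range_pow)).and
      (Filter.eventually_ge_atTop 1)).exists
  obtain ⟨m, rfl⟩ := hf n
  obtain ⟨m₀, hm₀, m₁, ⟨m', rfl⟩, rfl⟩ :=
    Submodule.mem_sup.1 (hk1.sup_eq_top ▸ Submodule.mem_top : m ∈ _)
  let P : LieSubmodule K L M :=
    { toSubmodule := LinearMap.ker (casEnd K M u w ^ k)
      lie_mem := fun {x m} hm ↦ by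
        have hcomm : ∀ j (m : M), (casEnd K M u w ^ j) ⁅x, m⁆ = ⁅x, (casEnd K M u w ^ j) m⁆ := by
          intro j
          induction j with
          | zero => simp
          | succ j ih =>
            intro m
            rw [pow_succ, Module.End.mul_apply, Module.End.mul_apply, casEnd_killing_lie h, ih]
        change (casEnd K M u w ^ k) ⁅x, m⁆ = 0
        rw [hcomm, show (casEnd K M u w ^ k) m = 0 from hm, lie_zero] }
  have hP : LieModule.IsTrivial L P := by
    refine isTrivial_of_isNilpotent_casEnd h _ rfl ⟨k, LinearMap.ext fun x ↦ Subtype.ext ?_⟩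
    exact (casEnd_pow_map u w P.incl k x).trans x.2
  have hm₀' : ∀ x : L, ⁅x, m₀⁆ = 0 := fun x ↦ congrArg Subtype.val (hP.trivial x ⟨m₀, hm₀⟩)
  refine ⟨m₀, ?_, hm₀'⟩
  set y := f ((casEnd K M u w ^ k) m') with hy
  have hy0 : ∀ x : L, ⁅x, y⁆ = 0 := by
    intro x
    have := hn x
    rwa [map_add, lie_add, ← LieModuleHom.map_lie, hm₀', map_zero, zero_add] at this
  have hy1 : y ∈ LinearMap.ker (casEnd K N u w ^ k) := by
    rw [LinearMap.mem_ker, ← Nat.sub_add_cancel hk3, pow_succ, Module.End.mul_apply, casEnd_apply]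
    simp [hy0]
  have hy2 : y ∈ LinearMap.range (casEnd K N u w ^ k) := ⟨f m', (casEnd_pow_map u w f k m').symm⟩
  have hy3 : y = 0 := (Submodule.disjoint_def.1 hk2.disjoint) y hy1 hy2
  rw [map_add, ← hy, hy3, add_zero]

/-- **Weyl's theorem**: a submodule of a finite-dimensional module is an equivariant retract. -/
theorem exists_equivariant_projection {M : Type*} [AddCommGroup M] [Module K M] [LieRingModule L M]
    [LieModule K L M] [FiniteDimensional K M] (N : LieSubmodule K L M) :
    ∃ φ : M →ₗ⁅K,L⁆ N, ∀ n : N, φ n = n := by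
  let F : (M →ₗ[K] N) →ₗ⁅K,L⁆ (N →ₗ[K] N) :=
    { LinearMap.lcomp K N N.toSubmodule.subtype with
      map_lie' := fun {x φ} ↦ by
        refine LinearMap.ext fun (n : N) ↦ ?_
        change ⁅x, φ⁆ (n : M) = ⁅x, φ (n : M)⁆ - φ ((⁅x, n⁆ : N) : M)
        rw [LieHom.lie_apply, LieSubmodule.coe_bracket] }
  have hF : Function.Surjective F := fun ψ ↦ by
    obtain ⟨φ, hφ⟩ := LinearMap.exists_extend (p := N.toSubmodule) ψ
    exact ⟨φ, hφ⟩
  -- The identity of N is an invariant of Hom(N, N). An invariant lift of it to Hom(M, N) is an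
  -- equivariant projection.
  obtain ⟨φ, hφ, hφ'⟩ := exists_invariant_lift h F hF (n := LinearMap.id) fun x ↦ by
    ext n
    simp [LieHom.lie_apply]
  refine ⟨{ φ with map_lie' := fun {x m} ↦ ?_ }, fun n ↦ LinearMap.congr_fun hφ n⟩
  have := LinearMap.congr_fun (hφ' x) m
  rw [LieHom.lie_apply, LinearMap.zero_apply, sub_eq_zero] at this
  exact this.symm

/-- If the sum of the eigenspaces were proper, an equivariant projection onto it would have a
nonzero kernel, which contains an irreducible submodule. The Casimir operator is scalar there, so
that submodule already lies in the sum. -/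
theorem iSup_eigenspace_casEnd {M : Type*} [AddCommGroup M] [Module K M] [LieRingModule L M]
    [LieModule K L M] [FiniteDimensional K M]
    (hs : ∀ A : LieSubmodule K L M, LieModule.IsIrreducible K L A →
      ∃ a : K, ∀ x : A, casEnd K A u w x = a • x) :
    ⨆ a : K, (casEnd K M u w).eigenspace a = ⊤ := by
  set N : LieSubmodule K L M := ⨆ a : K, eigenLieSubmodule _ (casEnd_killing_lie h) a with hN
  suffices hN' : N = ⊤ by
    have := congrArg LieSubmodule.toSubmodule hN'
    rwa [hN, LieSubmodule.iSup_toSubmodule] at this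
  by_contra hne
  obtain ⟨φ, hφ⟩ := exists_equivariant_projection h N
  have hker : φ.ker ≠ ⊥ := by
    intro hb
    refine hne (eq_top_iff.2 fun m _ ↦ ?_)
    have h1 : m - φ m ∈ φ.ker := by
      rw [LieModuleHom.mem_ker, map_sub, hφ, sub_self]
    rw [hb, LieSubmodule.mem_bot, sub_eq_zero] at h1
    rw [h1]
    exact (φ m).2
  obtain ⟨A, hA, hAk⟩ := (eq_bot_or_exists_atom_le φ.ker).resolve_left hker
  obtain ⟨a, ha⟩ := hs A (isIrreducible_of_isAtom hA)
  refine hA.1 ((LieSubmodule.eq_bot_iff _).2 fun x hx ↦ ?_)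
  have h1 : x ∈ N := by
    refine (le_iSup (fun a : K ↦ eigenLieSubmodule _ (casEnd_killing_lie h) a) a :
      _ ≤ N) (mem_eigenLieSubmodule.2 ?_)
    exact (casEnd_map u w A.incl ⟨x, hx⟩).symm.trans (congrArg Subtype.val (ha ⟨x, hx⟩))
  have h2 := hφ ⟨x, h1⟩
  rw [show φ x = 0 from hAk hx] at h2
  exact (congrArg Subtype.val h2).symm

end Weyl

end IFFT

end

noncomputable section

namespace IFFT

/-! ### Highest weights: the Casimir eigenvalue, its reality, and existence -/

section HighestWeightTheory

open LieAlgebra LieAlgebra.IsKilling LieModule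

variable {L : Type*} [LieRing L] [LieAlgebra ℂ L] [FiniteDimensional ℂ L]
  [LieAlgebra.IsKilling ℂ L] {C : LieSubalgebra ℂ L} [C.IsCartanSubalgebra]
  {M : Type*} [AddCommGroup M] [Module ℂ M] [LieRingModule L M]

theorem killingForm_cartanEquivDual_symm (μ : Module.Dual ℂ C) (h : C) :
    killingForm ℂ L ((cartanEquivDual C).symm μ : L) (h : L) = μ h := by
  have := LinearMap.congr_fun ((cartanEquivDual C).apply_symm_apply μ) h
  exact this

theorem weightForm_eq_apply (μ ν : Module.Dual ℂ C) :
    weightForm μ ν = μ ((cartanEquivDual C).symm ν) :=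
  killingForm_cartanEquivDual_symm μ _

theorem weightForm_comm (μ ν : Module.Dual ℂ C) : weightForm μ ν = weightForm ν μ :=
  LieModule.traceForm_comm ℂ L L _ _

theorem weightForm_add_right (μ ν ν' : Module.Dual ℂ C) :
    weightForm μ (ν + ν') = weightForm μ ν + weightForm μ ν' := by
  simp [weightForm_eq_apply]

theorem exists_root_vectors (α : C.root) :
    ∃ x y : L, x ∈ rootSpace C α.1 ∧ y ∈ rootSpace C (-α.1) ∧ killingForm ℂ L x y = 1 := by
  obtain ⟨h, e, f, ht, he, hf⟩ := exists_isSl2Triple_of_weight_isNonZero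
    (C.isNonZero_coe_root α)
  have h1 := lie_eq_killingForm_smul_of_mem_rootSpace_of_mem_rootSpace_neg he hf
  have h2 : killingForm ℂ L e f ≠ 0 := by
    intro h0
    rw [h0, zero_smul, ht.lie_e_f] at h1
    exact ht.h_ne_zero (by simpa using h1)
  refine ⟨e, (killingForm ℂ L e f)⁻¹ • f, he, SMulMemClass.smul_mem _ hf, ?_⟩
  rw [map_smul, smul_eq_mul, inv_mul_cancel₀ h2]

/-- The dual pair for the Killing form formed by root vectors and a basis of the Cartan
subalgebra. -/
theorem isDualPair_root_vectors {x y : C.root → L} (hx : ∀ α, x α ∈ rootSpace C α.1)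
    (hy : ∀ α, y α ∈ rootSpace C (-α.1)) (hxy : ∀ α, killingForm ℂ L (x α) (y α) = 1)
    {ι : Type*} [Fintype ι] {u w : ι → C} (huw : IsDualPair (traceForm ℂ C L) u w) :
    IsDualPair (killingForm ℂ L) (Sum.elim x fun i ↦ (u i : L)) (Sum.elim y fun i ↦ (w i : L)) := by
  classical
  let F : L →ₗ[ℂ] L := ∑ i, ((killingForm ℂ L).flip
    ((Sum.elim y fun i ↦ (w i : L)) i)).smulRight ((Sum.elim x fun i ↦ (u i : L)) i)
  have hF : ∀ z, F z = ∑ α, killingForm ℂ L z (y α) • x α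
      + ∑ i, killingForm ℂ L z (w i) • (u i : L) := by
    intro z
    simp [F, Fintype.sum_sum_type]
  suffices h : LinearMap.eqLocus F LinearMap.id = ⊤ by
    intro z
    have hz : z ∈ LinearMap.eqLocus F LinearMap.id := h ▸ Submodule.mem_top
    rw [Fintype.sum_sum_type]
    exact (hF z).symm.trans hz
  have htop := congrArg LieSubmodule.toSubmodule (iSup_genWeightSpace_eq_top' ℂ C L)
  rw [LieSubmodule.iSup_toSubmodule, LieSubmodule.top_toSubmodule] at htop
  -- The expansion is linear, so one weight space at a time suffices. Orthogonality of weight spaces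
  -- leaves the Cartan terms on the zero one and a single root term on a line C χ.
  rw [eq_top_iff, ← htop, iSup_le_iff]
  intro χ z hz
  change F z = z
  rw [hF]
  by_cases h0 : χ.IsZero
  · have hz0 : z ∈ rootSpace C (0 : C → ℂ) := by
      have : (χ : C → ℂ) = 0 := h0
      rw [← this]; exact hz
    have hzC : z ∈ C := by
      rw [← LieSubalgebra.mem_toLieSubmodule, ← rootSpace_zero_eq ℂ L C]
      exact hz0
    have h1 : ∀ α, killingForm ℂ L z (y α) = 0 := fun α ↦ by
      refine killingForm_apply_eq_zero_of_mem_rootSpace_of_add_ne_zero ℂ L C hz0 (hy α) ?_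
      rw [zero_add]
      exact neg_ne_zero.2 (C.isNonZero_coe_root α)
    simp only [h1, zero_smul, Finset.sum_const_zero, zero_add]
    have h2 := congrArg (Subtype.val : C → L) (huw ⟨z, hzC⟩)
    simp only [AddSubmonoidClass.coe_finsetSum, SetLike.val_smul] at h2
    exact h2
  · have hχ : χ ∈ C.root := by simpa [LieSubalgebra.root] using h0
    have h1 : ∀ i, killingForm ℂ L z (w i) = 0 := fun i ↦ by
      refine killingForm_apply_eq_zero_of_mem_rootSpace_of_add_ne_zero ℂ L C hz (β := 0) ?_ ?_
      · rw [rootSpace_zero_eq]; exact (w i).2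
      · rw [add_zero]; exact h0
    simp only [h1, zero_smul, Finset.sum_const_zero, add_zero]
    rw [Finset.sum_eq_single (⟨χ, hχ⟩ : C.root)]
    · have hfin := finrank_rootSpace_eq_one χ h0
      have hx0 : (⟨x ⟨χ, hχ⟩, hx ⟨χ, hχ⟩⟩ : rootSpace C χ) ≠ 0 := fun h ↦ by
        have h2 : x ⟨χ, hχ⟩ = 0 := congrArg Subtype.val h
        simpa [h2] using hxy ⟨χ, hχ⟩
      obtain ⟨c, hc⟩ := (finrank_eq_one_iff_of_nonzero' _ hx0).1 hfin ⟨z, hz⟩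
      have hc' : c • x ⟨χ, hχ⟩ = z := congrArg Subtype.val hc
      rw [← hc', map_smul, LinearMap.smul_apply, hxy, smul_eq_mul, mul_one]
    · intro α _ hα
      rw [killingForm_apply_eq_zero_of_mem_rootSpace_of_add_ne_zero ℂ L C hz (hy α), zero_smul]
      intro h
      refine hα (Subtype.ext (DFunLike.coe_injective ?_))
      exact (add_neg_eq_zero.1 h).symm
    · simp

theorem exists_isPos_neg {B : (rootSystem C).Base} {α : C.root} (h : ¬ B.IsPos α) :
    ∃ α' : C.root, B.IsPos α' ∧ α'.1 = -α.1 := by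
  refine ⟨(rootSystem C).reflectionPerm α α, (RootPairing.Base.IsPos.or_neg B α).resolve_left h, ?_⟩
  have h1 : (rootSystem C).root ((rootSystem C).reflectionPerm α α) = -(rootSystem C).root α := by
    rw [RootPairing.root_reflectionPerm, RootPairing.reflection_apply_self]
  refine DFunLike.ext _ _ fun x ↦ ?_
  exact LinearMap.congr_fun h1 x

/-- The Casimir operator acts on a highest weight vector by the expected scalar. -/
theorem casEnd_highestWeightVector [LieModule ℂ L M] {B : (rootSystem C).Base}
    {ν : Module.Dual ℂ C} {v : M} (hv : IsHighestWeightVector B ν v) {ι : Type*} [Fintype ι]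
    {u w : ι → L} (h : IsDualPair (killingForm ℂ L) u w) :
    casEnd ℂ M u w v = weightForm ν (ν + sumPosRoots B) • v := by
  classical
  obtain ⟨hv0, hpos, hC⟩ := hv
  choose x y hx hy hxy using exists_root_vectors (L := L) (C := C)
  obtain ⟨a, b, hab⟩ := exists_isDualPair _ (traceForm_cartan_nondegenerate ℂ L C)
  rw [casEnd_eq (killingForm_nondegenerate ℂ L) h (isDualPair_root_vectors hx hy hxy hab),
    casEnd_apply, Fintype.sum_sum_type]
  -- For α positive, x α kills v and only the bracket [x α, y α] = t_α survives. For α negative, y α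
  -- is a positive root vector and kills v. The root terms thus add up to (ν, S), the Cartan terms
  -- to (ν, ν).
  have h1 : ∀ α : C.root, ⁅x α, ⁅y α, v⁆⁆ =
      (if B.IsPos α then ν ((cartanEquivDual C).symm ((rootSystem C).root α)) else 0) • v := by
    intro α
    split_ifs with hα
    · rw [leibniz_lie, hpos α hα _ (hx α), lie_zero, add_zero,
        lie_eq_killingForm_smul_of_mem_rootSpace_of_mem_rootSpace_neg (hx α) (hy α), hxy, one_smul,
        hC]
      rfl
    · obtain ⟨α', hα', hneg⟩ := exists_isPos_neg hα
      have hy' : y α ∈ rootSpace C (α'.1 : Weight ℂ C L) := by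
        rw [hneg]
        exact hy α
      rw [hpos α' hα' (y α) hy', lie_zero, zero_smul]
  have h2 : ∀ i, ⁅(a i : L), ⁅(b i : L), v⁆⁆ = (ν (a i) * ν (b i)) • v := by
    intro i
    rw [hC, lie_smul, hC, smul_smul, mul_comm]
  simp only [Sum.elim_inl, Sum.elim_inr, h1, h2, ← Finset.sum_smul, ← add_smul]
  congr 1
  rw [weightForm_add_right, add_comm]
  congr 1
  · rw [weightForm_eq_apply]
    conv_rhs => rw [← hab ((cartanEquivDual C).symm ν), map_sum]
    refine Finset.sum_congr rfl fun i _ ↦ ?_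
    rw [map_smul, smul_eq_mul, mul_comm]
    congr 1
    exact (killingForm_cartanEquivDual_symm ν (b i)).symm
  · rw [weightForm_eq_apply, sumPosRoots, map_sum, map_sum, Finset.sum_filter]

theorem highestWeight_coroot [LieModule ℂ L M] [FiniteDimensional ℂ M] {B : (rootSystem C).Base}
    {ν : Module.Dual ℂ C} {v : M} (hv : IsHighestWeightVector B ν v) (α : C.root) :
    ∃ n : ℤ, ν (coroot α.1) = n := by
  have key : ∀ α : C.root, B.IsPos α → ∃ n : ℤ, ν (coroot α.1) = n := by
    intro α hα
    obtain ⟨h, e, f, ht, he, hf⟩ := exists_isSl2Triple_of_weight_isNonZero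
      (C.isNonZero_coe_root α)
    have hh := ht.h_eq_coroot (C.isNonZero_coe_root α) he hf
    have hP : ht.HasPrimitiveVectorWith v (ν (coroot α.1)) :=
      ⟨hv.1, by rw [hh, hv.2.2], hv.2.1 α hα e he⟩
    obtain ⟨n, hn⟩ := hP.exists_nat
    exact ⟨n, by simpa using hn⟩
  by_cases hα : B.IsPos α
  · exact key α hα
  · obtain ⟨α', hα', hneg⟩ := exists_isPos_neg hα
    obtain ⟨n, hn⟩ := key α' hα'
    rw [hneg, coroot_neg, map_neg] at hn
    exact ⟨-n, by rw [Int.cast_neg, ← hn, neg_neg]⟩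

theorem weightForm_self_eq_sum (μ : Module.Dual ℂ C) :
    weightForm μ μ = ∑ α ∈ C.root, (μ ((cartanEquivDual C).symm α)) ^ 2 := by
  have h1 := LinearMap.congr_fun₂ (restrict_killingForm_eq_sum (K := ℂ) (L := L) (H := C))
    ((cartanEquivDual C).symm μ) ((cartanEquivDual C).symm μ)
  refine h1.trans ?_
  rw [LinearMap.sum_apply, LinearMap.sum_apply]
  refine Finset.sum_congr rfl fun α _ ↦ ?_
  rw [LinearMap.smulRight_apply, LinearMap.smul_apply, smul_eq_mul, ← sq,
    ← weightForm_eq_apply μ, weightForm_comm, weightForm_eq_apply]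

/-- With t_α the Killing dual of α, the coroot is 2t_α / α(t_α), and α(t_α) = 4/m, where m is the
Killing square of the coroot. This m is a sum of squares of integers β(coroot), and ν takes an
integer value n on the coroot by sl₂ theory. Hence ν(t_α) = 2n/m. -/
theorem exists_real_apply_symm_root [LieModule ℂ L M] [FiniteDimensional ℂ M]
    {B : (rootSystem C).Base} {ν : Module.Dual ℂ C} {v : M} (hv : IsHighestWeightVector B ν v)
    (α : C.root) : ∃ r : ℝ, ν ((cartanEquivDual C).symm α.1) = r := by
  set t := (cartanEquivDual C).symm α.1 with ht
  have hne : α.1 t ≠ 0 := root_apply_cartanEquivDual_symm_ne_zero (C.isNonZero_coe_root α)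
  obtain ⟨n, hn⟩ := highestWeight_coroot hv α
  have hco : coroot α.1 = (2 * (α.1 t)⁻¹) • t := by
    rw [coroot, ← ht, ← Nat.cast_smul_eq_nsmul ℂ, smul_smul]
    norm_num
  have hkill : killingForm ℂ L (coroot α.1 : L) (coroot α.1 : L) = 4 * (α.1 t)⁻¹ := by
    have h1 := traceForm_coroot α.1 (coroot α.1)
    rw [root_apply_coroot (C.isNonZero_coe_root α)] at h1
    refine h1.trans ?_
    simp only [nsmul_eq_mul, smul_eq_mul]
    push_cast
    rw [← ht]
    ring
  obtain ⟨m, hm⟩ : ∃ m : ℤ, killingForm ℂ L (coroot α.1 : L) (coroot α.1 : L) = m := by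
    have h1 := LinearMap.congr_fun₂ (restrict_killingForm_eq_sum (K := ℂ) (L := L) (H := C))
      (coroot α.1) (coroot α.1)
    refine ⟨∑ β ∈ C.root, (chainBotCoeff α.1 β - chainTopCoeff α.1 β : ℤ) ^ 2, h1.trans ?_⟩
    rw [LinearMap.sum_apply, LinearMap.sum_apply, Int.cast_sum]
    refine Finset.sum_congr rfl fun β _ ↦ ?_
    rw [LinearMap.smulRight_apply, LinearMap.smul_apply, smul_eq_mul, ← sq, Int.cast_pow]
    exact congrArg (· ^ 2) (apply_coroot_eq_cast α.1 β)
  have hα : α.1 t = 4 / m := by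
    rw [← hm, hkill]
    field_simp
  rw [hco, map_smul, smul_eq_mul] at hn
  refine ⟨n * (2 / m), ?_⟩
  push_cast
  rw [← hn, hα]
  have hm0 : (m : ℂ) ≠ 0 := by
    rw [← hm, hkill]
    exact mul_ne_zero (by norm_num) (inv_ne_zero hne)
  field_simp
  norm_num

theorem exists_real_weightForm [LieModule ℂ L M] [FiniteDimensional ℂ M]
    {B : (rootSystem C).Base} {ν : Module.Dual ℂ C} {v : M} (hv : IsHighestWeightVector B ν v) :
    ∃ r : ℝ, weightForm ν (ν + sumPosRoots B) = r := by
  classical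
  choose r hr using exists_real_apply_symm_root hv
  refine ⟨∑ α, r α ^ 2 + ∑ α : C.root with B.IsPos α, r α, ?_⟩
  rw [weightForm_add_right, weightForm_self_eq_sum, weightForm_eq_apply, sumPosRoots, map_sum,
    map_sum, ← Finset.sum_coe_sort]
  push_cast
  congr 1
  · exact Finset.sum_congr rfl fun α _ ↦ by rw [← hr]
  · exact Finset.sum_congr rfl fun α _ ↦ by rw [← hr]; rfl

/-- The simple roots form a basis of the dual of C, so some element of C takes the value 1 on each
of them. It serves to order the weights. -/
theorem exists_forall_root_apply_eq_height (B : (rootSystem C).Base) :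
    ∃ h : C, ∀ α : C.root, α.1 h = (B.height α : ℂ) := by
  let f : Module.Dual ℂ (Module.Dual ℂ C) := B.toWeightBasis.constr ℂ fun _ ↦ (1 : ℂ)
  refine ⟨(Module.evalEquiv ℂ C).symm f, fun α ↦ ?_⟩
  have h1 : ∀ φ : Module.Dual ℂ C, φ ((Module.evalEquiv ℂ C).symm f) = f φ := fun φ ↦ by
    simp
  obtain ⟨c, -, -, hc⟩ := B.exists_root_eq_sum_int α
  have h2 : α.1 ((Module.evalEquiv ℂ C).symm f) = f ((rootSystem C).root α) := h1 (Weight.toLinear ℂ C L α.1)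
  rw [h2, hc, map_sum, RootPairing.Base.height_eq_sum hc, Int.cast_sum]
  refine Finset.sum_congr rfl fun j hj ↦ ?_
  have h3 : f ((rootSystem C).root j) = 1 := by
    have := B.toWeightBasis.constr_basis ℂ (fun _ ↦ (1 : ℂ)) ⟨j, hj⟩
    rwa [RootPairing.Base.toWeightBasis_apply] at this
  rw [map_zsmul, h3, zsmul_eq_mul, mul_one]

/-- A nonzero finite-dimensional module has a highest weight vector. -/
theorem exists_isHighestWeightVector (M : Type*) [AddCommGroup M] [Module ℂ M] [LieRingModule L M]
    [LieModule ℂ L M] [FiniteDimensional ℂ M] [Nontrivial M] (B : (rootSystem C).Base) :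
    ∃ (ν : Module.Dual ℂ C) (v : M), IsHighestWeightVector B ν v := by
  obtain ⟨h₀, hh₀⟩ := exists_forall_root_apply_eq_height B
  have hne : Nonempty (Weight ℂ C M) := by
    by_contra hemp
    rw [not_nonempty_iff] at hemp
    have := iSup_genWeightSpace_eq_top' ℂ C M
    rw [iSup_of_empty] at this
    exact bot_ne_top this
  -- Adding a positive root to a weight raises its value at h₀ by the height of the root, which is
  -- positive. A weight with maximal real part at h₀ is therefore highest.
  obtain ⟨χ, hχ⟩ := Finite.exists_max fun χ : Weight ℂ C M ↦ (χ h₀).re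
  obtain ⟨v, hv0, hv⟩ := exists_forall_lie_eq_smul ℂ C M χ
  refine ⟨χ.toLinear, v, hv0, fun α hα x hx ↦ ?_, hv⟩
  by_contra hne
  have hvw : v ∈ genWeightSpace M χ :=
    weightSpace_le_genWeightSpace M χ ((mem_weightSpace (χ : C → ℂ) v).2 hv)
  have hmem : ⁅x, v⁆ ∈ genWeightSpace M ((α.1 : C → ℂ) + (χ : C → ℂ)) :=
    lie_mem_genWeightSpace_of_mem_genWeightSpace hx hvw
  let χ' : Weight ℂ C M := ⟨(α.1 : C → ℂ) + (χ : C → ℂ), fun hbot ↦ hne (by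
    rw [hbot] at hmem
    exact (LieSubmodule.mem_bot _).1 hmem)⟩
  have h1 := hχ χ'
  have h2 : χ' h₀ = α.1 h₀ + χ h₀ := rfl
  rw [h2, hh₀, Complex.add_re, Complex.intCast_re] at h1
  have h3 : (0 : ℝ) < B.height α := by exact_mod_cast hα
  linarith

end HighestWeightTheory

end IFFT

end

noncomputable section

namespace IFFT

/-! ### Compatibility of the Casimir operator with complexification -/

section BaseChange

variable {𝕜 h E : Type*} [RCLike 𝕜] [Algebra 𝕜 ℂ] [LieRing h] [LieAlgebra 𝕜 h]
  [AddCommGroup E] [Module 𝕜 E] [LieRingModule h E] [LieModule 𝕜 h E]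
  {ι : Type*} [Fintype ι] {u w : ι → h}

theorem IsDualPair.baseChange [FiniteDimensional 𝕜 h] (hd : IsDualPair (killingForm 𝕜 h) u w) :
    IsDualPair (killingForm ℂ (ℂ ⊗[𝕜] h)) (fun i ↦ (1 : ℂ) ⊗ₜ[𝕜] u i)
      (fun i ↦ (1 : ℂ) ⊗ₜ[𝕜] w i) := by
  intro x
  induction x using TensorProduct.induction_on with
  | zero => simp
  | add a b ha hb =>
    simp only [map_add, LinearMap.add_apply, add_smul, Finset.sum_add_distrib, ha, hb]
  | tmul z x =>
    have h1 : ∀ i, killingForm ℂ (ℂ ⊗[𝕜] h) (z ⊗ₜ x) ((1 : ℂ) ⊗ₜ w i) =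
        z * algebraMap 𝕜 ℂ (killingForm 𝕜 h x (w i)) := fun i ↦ by
      have := LinearMap.congr_fun₂ (LieModule.traceForm_baseChange 𝕜 h h ℂ)
        (z ⊗ₜ x) ((1 : ℂ) ⊗ₜ w i)
      rw [this, LinearMap.BilinForm.baseChange_tmul, Algebra.smul_def]
      ring
    simp only [h1]
    conv_rhs => rw [← hd x, TensorProduct.tmul_sum]
    refine Finset.sum_congr rfl fun i _ ↦ ?_
    rw [TensorProduct.tmul_smul, TensorProduct.smul_tmul', TensorProduct.smul_tmul', smul_eq_mul,
      mul_one, Algebra.smul_def, mul_comm]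

theorem casEnd_baseChange (e : E) :
    casEnd ℂ (ℂ ⊗[𝕜] E) (fun i ↦ (1 : ℂ) ⊗ₜ[𝕜] u i) (fun i ↦ (1 : ℂ) ⊗ₜ[𝕜] w i)
      ((1 : ℂ) ⊗ₜ e) = (1 : ℂ) ⊗ₜ casEnd 𝕜 E u w e := by
  simp [casEnd_apply, TensorProduct.tmul_sum]

theorem tmul_one_injective :
    Function.Injective fun e : E ↦ (1 : ℂ) ⊗ₜ[𝕜] e :=
  fun _ _ hxy ↦ Module.FaithfullyFlat.tensorProduct_mk_injective (A := 𝕜) (B := ℂ) E hxy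

end BaseChange

/-! ### Modules with a complex structure -/

section Carrier

variable {𝕜 h E : Type*} [RCLike 𝕜] [Algebra 𝕜 ℂ] [LieRing h] [LieAlgebra 𝕜 h]
  [AddCommGroup E] [Module 𝕜 E] [LieRingModule h E] [LieModule 𝕜 h E]
  {ι : Type*} [Fintype ι] {u w : ι → h} (J : ComplexStructure 𝕜 h E)

instance : Module 𝕜 J.Carrier := inferInstanceAs (Module 𝕜 E)

/-- The identity of `E`, as a map to `E` seen as a complex space. -/
def ComplexStructure.toCarrier : E ≃ₗ[𝕜] J.Carrier := LinearEquiv.refl 𝕜 E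

theorem ComplexStructure.lie_toCarrier (a : ℂ ⊗[𝕜] h) (e : E) :
    ⁅a, J.toCarrier e⁆ = J.toCarrier (J.act a e) := rfl

theorem ComplexStructure.smul_toCarrier (z : ℂ) (e : E) :
    z • J.toCarrier e = J.toCarrier (J.scalar z e) := rfl

instance : IsScalarTower 𝕜 ℂ J.Carrier where
  smul_assoc a z e := by
    obtain ⟨e, rfl⟩ := J.toCarrier.surjective e
    rw [J.smul_toCarrier, J.smul_toCarrier, map_smul, LinearMap.smul_apply, map_smul]

instance [FiniteDimensional 𝕜 E] : FiniteDimensional ℂ J.Carrier :=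
  haveI : Module.Finite 𝕜 J.Carrier := ‹FiniteDimensional 𝕜 E›
  Module.Finite.of_restrictScalars_finite 𝕜 ℂ J.Carrier

theorem ComplexStructure.act_smul (z : ℂ) (a : ℂ ⊗[𝕜] h) (e : E) :
    J.act (z • a) e = J.scalar z (J.act a e) := by
  induction a using TensorProduct.induction_on with
  | zero => simp
  | add a b ha hb => simp only [smul_add, map_add, LinearMap.add_apply, ha, hb]
  | tmul w x =>
    rw [TensorProduct.smul_tmul', J.act_tmul, J.act_tmul, smul_eq_mul, map_mul,
      Module.End.mul_apply]

theorem ComplexStructure.act_scalar (z : ℂ) (a : ℂ ⊗[𝕜] h) (e : E) :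
    J.act a (J.scalar z e) = J.scalar z (J.act a e) := by
  induction a using TensorProduct.induction_on with
  | zero => simp
  | add a b ha hb => simp only [map_add, LinearMap.add_apply, ha, hb]
  | tmul w x =>
    rw [J.act_tmul, J.act_tmul, ← J.scalar_lie, ← Module.End.mul_apply, ← Module.End.mul_apply,
      ← map_mul, ← map_mul, mul_comm]

instance : LieModule ℂ (ℂ ⊗[𝕜] h) J.Carrier where
  smul_lie z a e := J.act_smul z a e
  lie_smul z a e := J.act_scalar z a e

theorem ComplexStructure.one_tmul_lie (x : h) (e : E) :
    ⁅(1 : ℂ) ⊗ₜ[𝕜] x, J.toCarrier e⁆ = J.toCarrier ⁅x, e⁆ := by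
  rw [J.lie_toCarrier, J.act_tmul, map_one, Module.End.one_apply]

theorem ComplexStructure.casEnd_carrier (e : E) :
    casEnd ℂ J.Carrier (fun i ↦ (1 : ℂ) ⊗ₜ[𝕜] u i) (fun i ↦ (1 : ℂ) ⊗ₜ[𝕜] w i) (J.toCarrier e) =
      J.toCarrier (casEnd 𝕜 E u w e) := by
  simp only [casEnd_apply, J.one_tmul_lie, map_sum]

/-- A complex submodule of E is in particular a 𝕜-submodule stable under h. -/
theorem ComplexStructure.isIrreducible [LieModule.IsIrreducible 𝕜 h E] :
    LieModule.IsIrreducible ℂ (ℂ ⊗[𝕜] h) J.Carrier := by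
  have hnt : Nontrivial E := LieModule.nontrivial_of_isIrreducible 𝕜 h E
  have : Nontrivial J.Carrier := hnt
  refine LieModule.IsIrreducible.mk fun N hN ↦ ?_
  let N' : LieSubmodule 𝕜 h E :=
    { (N.toSubmodule.restrictScalars 𝕜).comap J.toCarrier.toLinearMap with
      lie_mem := fun {x e} he ↦ by
        have h1 := N.lie_mem (x := (1 : ℂ) ⊗ₜ[𝕜] x) (m := J.toCarrier e) he
        rwa [J.one_tmul_lie] at h1 }
  have hmem : ∀ e, e ∈ N' ↔ J.toCarrier e ∈ N := fun e ↦ Iff.rfl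
  have hN' : N' ≠ ⊥ := fun h0 ↦ hN <| (LieSubmodule.eq_bot_iff _).2 fun x hx ↦ by
    obtain ⟨e, rfl⟩ := J.toCarrier.surjective x
    rw [(LieSubmodule.eq_bot_iff _).1 h0 e hx, map_zero]
  have htop := (eq_bot_or_eq_top N').resolve_left hN'
  rw [eq_top_iff]
  intro x _
  obtain ⟨e, rfl⟩ := J.toCarrier.surjective x
  rw [← hmem, htop]
  exact LieSubmodule.mem_top e

end Carrier

/-! ### Existence of highest weights, and the Casimir scalar over 𝕜 -/

section Existence

variable {𝕜 h E : Type*} [RCLike 𝕜] [Algebra 𝕜 ℂ] [IsScalarTower ℝ 𝕜 ℂ] [LieRing h]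
  [LieAlgebra 𝕜 h] [AddCommGroup E] [Module 𝕜 E] [LieRingModule h E] [LieModule 𝕜 h E]

theorem algebraMap_ofReal (r : ℝ) : algebraMap 𝕜 ℂ (r : 𝕜) = (r : ℂ) := by
  have := IsScalarTower.algebraMap_apply ℝ 𝕜 ℂ r
  rw [RCLike.algebraMap_eq_ofReal] at this
  exact this.symm

/-- When 𝕜 is a copy of ℂ, its imaginary unit goes to i or to -i: the embedding may be a
conjugation, hence the choice of sign. -/
theorem algebraMap_surjective_of_I_ne_zero (hI : (RCLike.I : 𝕜) ≠ 0) :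
    Function.Surjective (algebraMap 𝕜 ℂ) := by
  have h1 : (algebraMap 𝕜 ℂ RCLike.I) * (algebraMap 𝕜 ℂ RCLike.I) = Complex.I * Complex.I := by
    rw [← map_mul, (RCLike.I_mul_I (K := 𝕜)).resolve_left hI, Complex.I_mul_I]
    simp
  obtain ⟨j, hj⟩ : ∃ j, algebraMap 𝕜 ℂ j = Complex.I := by
    rcases mul_self_eq_mul_self_iff.1 h1 with h | h
    · exact ⟨_, h⟩
    · exact ⟨-RCLike.I, by rw [map_neg, h, neg_neg]⟩
  intro z
  refine ⟨(z.re : 𝕜) + (z.im : 𝕜) * j, ?_⟩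
  rw [map_add, map_mul, hj, algebraMap_ofReal, algebraMap_ofReal, Complex.re_add_im]

theorem exists_complexStructure_of_I_ne_zero (hI : (RCLike.I : 𝕜) ≠ 0) :
    Nonempty (ComplexStructure 𝕜 h E) := by
  let e : 𝕜 ≃ₐ[𝕜] ℂ := AlgEquiv.ofBijective (Algebra.ofId 𝕜 ℂ)
    ⟨(algebraMap 𝕜 ℂ).injective, algebraMap_surjective_of_I_ne_zero hI⟩
  exact ⟨⟨(Algebra.lsmul 𝕜 𝕜 E).comp e.symm.toAlgHom, fun z x m ↦ (lie_smul _ _ _).symm⟩⟩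

theorem eq_ofReal_re (hI : (RCLike.I : 𝕜) = 0) (a : 𝕜) : ((RCLike.re a : ℝ) : 𝕜) = a := by
  have := RCLike.re_add_im a
  rwa [hI, mul_zero, add_zero] at this

theorem algebraMap_eq_re (hI : (RCLike.I : 𝕜) = 0) (a : 𝕜) :
    algebraMap 𝕜 ℂ a = (RCLike.re a : ℝ) := by
  conv_lhs => rw [← eq_ofReal_re hI a]
  exact algebraMap_ofReal _

/-- The real part `ℂ → 𝕜`, when `𝕜` is the field of real numbers. -/
def realPart (hI : (RCLike.I : 𝕜) = 0) : ℂ →ₗ[𝕜] 𝕜 where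
  toFun z := (z.re : 𝕜)
  map_add' z w := by simp
  map_smul' a z := by
    rw [Algebra.smul_def, algebraMap_eq_re hI, Complex.re_ofReal_mul, RCLike.ofReal_mul,
      eq_ofReal_re hI]
    rfl

variable (E) in
/-- The real part `ℂ ⊗ E → E`, when `𝕜` is the field of real numbers. -/
def realPartTensor (hI : (RCLike.I : 𝕜) = 0) : ℂ ⊗[𝕜] E →ₗ[𝕜] E :=
  TensorProduct.lift ((LinearMap.lsmul 𝕜 E).comp (realPart hI))

theorem realPartTensor_tmul (hI : (RCLike.I : 𝕜) = 0) (z : ℂ) (e : E) :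
    realPartTensor E hI (z ⊗ₜ e) = (z.re : 𝕜) • e := rfl

/-- This is z = Re z + i Im z, with Im z written as -Re(iz). -/
theorem realPartTensor_decomp (hI : (RCLike.I : 𝕜) = 0) (t : ℂ ⊗[𝕜] E) :
    t = (1 : ℂ) ⊗ₜ realPartTensor E hI t
      - Complex.I ⊗ₜ realPartTensor E hI (Complex.I • t) := by
  induction t using TensorProduct.induction_on with
  | zero => simp
  | add a b ha hb =>
    conv_lhs => rw [ha, hb]
    simp only [smul_add, map_add, TensorProduct.tmul_add]
    abel
  | tmul z e =>
    rw [TensorProduct.smul_tmul', realPartTensor_tmul, realPartTensor_tmul,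
      TensorProduct.tmul_smul, TensorProduct.tmul_smul, TensorProduct.smul_tmul',
      TensorProduct.smul_tmul', ← TensorProduct.sub_tmul]
    congr 1
    rw [Algebra.smul_def, Algebra.smul_def, algebraMap_ofReal, algebraMap_ofReal]
    simp

theorem realPartTensor_lie (hI : (RCLike.I : 𝕜) = 0) (x : h) (t : ℂ ⊗[𝕜] E) :
    realPartTensor E hI ⁅(1 : ℂ) ⊗ₜ[𝕜] x, t⁆ = ⁅x, realPartTensor E hI t⁆ := by
  induction t using TensorProduct.induction_on with
  | zero => simp
  | add a b ha hb => simp only [lie_add, map_add, ha, hb]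
  | tmul z e =>
    rw [LieAlgebra.ExtendScalars.bracket_tmul, one_mul, realPartTensor_tmul, realPartTensor_tmul,
      lie_smul]

/-- The real points of W form a submodule of E, which is zero because W is proper. So the real part
W → E is injective, and its image is a nonzero submodule, hence all of E. The complex structure of W
is carried to E by this isomorphism. -/
theorem exists_complexStructure_of_I_eq_zero (hI : (RCLike.I : 𝕜) = 0)
    [LieModule.IsIrreducible 𝕜 h E] {W : LieSubmodule ℂ (ℂ ⊗[𝕜] h) (ℂ ⊗[𝕜] E)} (hbot : W ≠ ⊥)
    (htop : W ≠ ⊤) : Nonempty (ComplexStructure 𝕜 h E) := by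
  let N : LieSubmodule 𝕜 h E :=
    { W.toSubmodule.restrictScalars 𝕜 |>.comap (TensorProduct.mk 𝕜 ℂ E 1) with
      lie_mem := fun {x e} he ↦ by
        have := W.lie_mem (x := (1 : ℂ) ⊗ₜ[𝕜] x) he
        rw [TensorProduct.mk_apply, LieAlgebra.ExtendScalars.bracket_tmul, one_mul] at this
        exact this }
  have hN : N = ⊥ := by
    refine (eq_bot_or_eq_top N).resolve_right fun h1 ↦ htop (eq_top_iff.2 fun t _ ↦ ?_)
    induction t using TensorProduct.induction_on with
    | zero => exact W.zero_mem
    | add a b ha hb => exact W.add_mem (ha trivial) (hb trivial)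
    | tmul z e =>
      have h2 : e ∈ N := h1 ▸ LieSubmodule.mem_top e
      have h3 : z • ((1 : ℂ) ⊗ₜ[𝕜] e) ∈ W := SMulMemClass.smul_mem z h2
      rwa [TensorProduct.smul_tmul', smul_eq_mul, mul_one] at h3
  let P := W.toSubmodule.restrictScalars 𝕜
  let f : P →ₗ[𝕜] E := (realPartTensor E hI).comp P.subtype
  have hf : ∀ t : P, f t = realPartTensor E hI t.1 := fun _ ↦ rfl
  have hinj : Function.Injective f := by
    refine (injective_iff_map_eq_zero f).2 fun t ht ↦ Subtype.ext ?_
    have h1 := realPartTensor_decomp hI t.1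
    rw [← hf, ht, TensorProduct.tmul_zero, zero_sub] at h1
    have h2 : Complex.I • t.1 ∈ W := SMulMemClass.smul_mem _ t.2
    have h3 : realPartTensor E hI (Complex.I • t.1) ∈ N := by
      change (1 : ℂ) ⊗ₜ _ ∈ W
      have h4 : Complex.I • t.1 = (1 : ℂ) ⊗ₜ[𝕜] realPartTensor E hI (Complex.I • t.1) := by
        conv_lhs => rw [h1]
        rw [smul_neg, TensorProduct.smul_tmul', ← TensorProduct.neg_tmul, smul_eq_mul,
          Complex.I_mul_I, neg_neg]
      rwa [← h4]
    rw [hN, LieSubmodule.mem_bot] at h3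
    rw [h1, h3, TensorProduct.tmul_zero, neg_zero]
    rfl
  let R : LieSubmodule 𝕜 h E :=
    { LinearMap.range f with
      lie_mem := fun {x e} he ↦ by
        obtain ⟨t, rfl⟩ := he
        exact ⟨⟨⁅(1 : ℂ) ⊗ₜ[𝕜] x, t.1⁆, W.lie_mem t.2⟩, realPartTensor_lie hI x t.1⟩ }
  have hR : R = ⊤ := by
    refine (eq_bot_or_eq_top R).resolve_left fun h1 ↦ hbot ((LieSubmodule.eq_bot_iff _).2
      fun t ht ↦ ?_)
    have h2 : f ⟨t, ht⟩ ∈ R := ⟨_, rfl⟩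
    rw [h1, LieSubmodule.mem_bot] at h2
    exact congrArg Subtype.val (hinj (h2.trans (map_zero f).symm))
  have hsurj : Function.Surjective f := fun e ↦ (hR ▸ LieSubmodule.mem_top e : e ∈ R)
  let φ : P ≃ₗ[𝕜] E := LinearEquiv.ofBijective f ⟨hinj, hsurj⟩
  let Q : ℂ →ₐ[𝕜] Module.End 𝕜 W.toSubmodule := Algebra.lsmul 𝕜 𝕜 W.toSubmodule
  have hφ : ∀ (x : h) (t : P), φ ⟨⁅(1 : ℂ) ⊗ₜ[𝕜] x, t.1⁆, W.lie_mem t.2⟩ = ⁅x, φ t⁆ :=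
    fun x t ↦ realPartTensor_lie hI x t.1
  have hφs : ∀ (x : h) (e : E),
      φ.symm ⁅x, e⁆ = ⟨⁅(1 : ℂ) ⊗ₜ[𝕜] x, (φ.symm e).1⁆, W.lie_mem (φ.symm e).2⟩ := fun x e ↦ by
    rw [LinearEquiv.symm_apply_eq, hφ, LinearEquiv.apply_symm_apply]
  refine ⟨⟨(φ.conjAlgEquiv 𝕜).toAlgHom.comp Q, fun z x e ↦ ?_⟩⟩
  change φ (Q z (φ.symm ⁅x, e⁆)) = ⁅x, φ (Q z (φ.symm e))⁆
  rw [hφs]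
  exact (congrArg φ (Subtype.ext (lie_smul z _ _).symm)).trans (hφ x (Q z (φ.symm e)))

theorem exists_complexStructure [LieModule.IsIrreducible 𝕜 h E]
    (hE : ¬ LieModule.IsIrreducible ℂ (ℂ ⊗[𝕜] h) (ℂ ⊗[𝕜] E)) :
    Nonempty (ComplexStructure 𝕜 h E) := by
  by_cases hI : (RCLike.I : 𝕜) = 0
  · have hnt : Nontrivial E := LieModule.nontrivial_of_isIrreducible 𝕜 h E
    have : Nontrivial (ℂ ⊗[𝕜] E) := tmul_one_injective.nontrivial
    obtain ⟨W, hbot, htop⟩ : ∃ W : LieSubmodule ℂ (ℂ ⊗[𝕜] h) (ℂ ⊗[𝕜] E), W ≠ ⊥ ∧ W ≠ ⊤ := by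
      by_contra! hcon
      exact hE (LieModule.IsIrreducible.mk hcon)
    exact exists_complexStructure_of_I_eq_zero hI hbot htop
  · exact exists_complexStructure_of_I_ne_zero hI

variable [FiniteDimensional 𝕜 h] [FiniteDimensional 𝕜 E] [LieModule.IsIrreducible 𝕜 h E]
  [LieAlgebra.IsKilling ℂ (ℂ ⊗[𝕜] h)] {C : LieSubalgebra ℂ (ℂ ⊗[𝕜] h)} [C.IsCartanSubalgebra]
  (B : (LieAlgebra.IsKilling.rootSystem C).Base)

variable (𝕜 E) in
theorem exists_isHighestWeight : ∃ ν, IsHighestWeight 𝕜 E B ν := by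
  have hnt : Nontrivial E := LieModule.nontrivial_of_isIrreducible 𝕜 h E
  by_cases hE : LieModule.IsIrreducible ℂ (ℂ ⊗[𝕜] h) (ℂ ⊗[𝕜] E)
  · have : Nontrivial (ℂ ⊗[𝕜] E) := tmul_one_injective.nontrivial
    obtain ⟨ν, v, hv⟩ := exists_isHighestWeightVector (ℂ ⊗[𝕜] E) B
    exact ⟨ν, Or.inl ⟨hE, v, hv⟩⟩
  · obtain ⟨J⟩ := exists_complexStructure hE
    have : Nontrivial J.Carrier := hnt
    obtain ⟨ν, v, hv⟩ := exists_isHighestWeightVector J.Carrier B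
    exact ⟨ν, Or.inr ⟨hE, J, v, hv⟩⟩

variable {B}

/-- The Casimir operator of an irreducible module is the real scalar given by its highest
weight. -/
theorem casEnd_eq_of_isHighestWeight {ν : Module.Dual ℂ C} (hν : IsHighestWeight 𝕜 E B ν)
    {ι : Type*} [Fintype ι] {u w : ι → h} (hd : IsDualPair (killingForm 𝕜 h) u w) :
    ∃ r : ℝ, weightForm ν (ν + sumPosRoots B) = r ∧
      ∀ e : E, casEnd 𝕜 E u w e = (r : 𝕜) • e := by
  have hd' := hd.baseChange
  have hcomm : ∀ {M : Type _} [AddCommGroup M] [Module ℂ M] [LieRingModule (ℂ ⊗[𝕜] h) M]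
      [LieModule ℂ (ℂ ⊗[𝕜] h) M] (y : ℂ ⊗[𝕜] h) (m : M),
      casEnd ℂ M (fun i ↦ (1 : ℂ) ⊗ₜ[𝕜] u i) (fun i ↦ (1 : ℂ) ⊗ₜ[𝕜] w i) ⁅y, m⁆ =
        ⁅y, casEnd ℂ M (fun i ↦ (1 : ℂ) ⊗ₜ[𝕜] u i) (fun i ↦ (1 : ℂ) ⊗ₜ[𝕜] w i) m⁆ :=
    fun y m ↦ casEnd_lie (LieAlgebra.IsKilling.killingForm_nondegenerate ℂ _)
      (LieModule.traceForm_apply_lie_apply ℂ _ _) hd' y m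
  rcases hν with ⟨hE, v, hv⟩ | ⟨-, J, v, hv⟩
  · obtain ⟨r, hr⟩ := exists_real_weightForm hv
    refine ⟨r, hr, fun e ↦ tmul_one_injective (𝕜 := 𝕜) (E := E) ?_⟩
    have h1 := casEnd_highestWeightVector hv hd'
    have h2 := eq_smul_of_eigenvector (L := ℂ ⊗[𝕜] h) _ hcomm hv.1 h1 ((1 : ℂ) ⊗ₜ[𝕜] e)
    rw [casEnd_baseChange, hr, ← algebraMap_ofReal (𝕜 := 𝕜), algebraMap_smul] at h2
    exact h2.trans (TensorProduct.tmul_smul (r : 𝕜) (1 : ℂ) e).symm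
  · obtain ⟨r, hr⟩ := exists_real_weightForm hv
    refine ⟨r, hr, fun e ↦ ?_⟩
    have h1 := casEnd_highestWeightVector hv hd'
    have := J.isIrreducible
    have h2 := eq_smul_of_eigenvector (L := ℂ ⊗[𝕜] h) _ hcomm hv.1 h1 (J.toCarrier e)
    rw [J.casEnd_carrier, hr, ← algebraMap_ofReal (𝕜 := 𝕜), algebraMap_smul, ← map_smul] at h2
    exact J.toCarrier.injective h2

end Existence

end IFFT

end

noncomputable section

namespace IFFT

/-! ### Calculus of polynomial vector fields -/

section PolynomialVectorFields

open MvPolynomial (C X pderiv constantCoeff eval IsHomogeneous)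

variable {𝕜 : Type*} [RCLike 𝕜] {d : ℕ}

theorem ext_comp {Y Z : PolyVect 𝕜 d} (h : ∀ i, comp Y i = comp Z i) : Y = Z :=
  MvPolynomial.derivation_ext h

theorem comp_add (Y Z : PolyVect 𝕜 d) (i : Fin d) : comp (Y + Z) i = comp Y i + comp Z i := rfl

theorem comp_smul (c : 𝕜) (Y : PolyVect 𝕜 d) (i : Fin d) : comp (c • Y) i = c • comp Y i := rfl

theorem comp_zero (i : Fin d) : comp (0 : PolyVect 𝕜 d) i = 0 := rfl

theorem comp_lie (Y Z : PolyVect 𝕜 d) (i : Fin d) :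
    comp ⁅Y, Z⁆ i = Y (comp Z i) - Z (comp Y i) :=
  Derivation.commutator_apply _

theorem comp_polySmul (p : MvPolynomial (Fin d) 𝕜) (Y : PolyVect 𝕜 d) (i : Fin d) :
    comp (p • Y) i = p * comp Y i := rfl

theorem apply_C (Y : PolyVect 𝕜 d) (c : 𝕜) : Y (C c) = 0 := by
  rw [← MvPolynomial.algebraMap_eq, Derivation.map_algebraMap]

/-- The constant vector field with value `v`. -/
def constField : (Fin d → 𝕜) →ₗ[𝕜] PolyVect 𝕜 d where
  toFun v := MvPolynomial.mkDerivation 𝕜 fun i ↦ C (v i)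
  map_add' v w := ext_comp fun i ↦ by simp [comp, MvPolynomial.mkDerivation_X]
  map_smul' c v := ext_comp fun i ↦ by
    simp [comp, MvPolynomial.mkDerivation_X, MvPolynomial.smul_eq_C_mul]

theorem comp_constField (v : Fin d → 𝕜) (i : Fin d) : comp (constField v) i = C (v i) :=
  MvPolynomial.mkDerivation_X _ _ _

theorem constField_apply (v : Fin d → 𝕜) (p : MvPolynomial (Fin d) 𝕜) :
    constField v p = ∑ j, v j • pderiv j p := by
  rw [apply_eq_sum]
  refine Finset.sum_congr rfl fun j _ ↦ ?_
  rw [comp_constField, mul_comm, ← MvPolynomial.smul_eq_C_mul]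

theorem constField_single (j : Fin d) (p : MvPolynomial (Fin d) 𝕜) :
    constField (Pi.single j 1) p = pderiv j p := by
  rw [constField_apply, Finset.sum_eq_single j]
  · simp
  · intro i _ hi
    simp [Pi.single_eq_of_ne hi]
  · simp

theorem comp_lie_constField (v : Fin d → 𝕜) (Y : PolyVect 𝕜 d) (i : Fin d) :
    comp ⁅constField v, Y⁆ i = constField v (comp Y i) := by
  rw [comp_lie, comp_constField, apply_C, sub_zero]

theorem lie_constField_constField (v w : Fin d → 𝕜) :
    ⁅(constField v : PolyVect 𝕜 d), constField w⁆ = 0 := by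
  refine ext_comp fun i ↦ ?_
  rw [comp_lie_constField, comp_constField, apply_C, comp_zero]

theorem lie_constField_comm (v w : Fin d → 𝕜) (Y : PolyVect 𝕜 d) :
    ⁅constField v, ⁅constField w, Y⁆⁆ = ⁅constField w, ⁅constField v, Y⁆⁆ := by
  have h := lie_lie (constField v) (constField w : PolyVect 𝕜 d) Y
  rw [lie_constField_constField, zero_lie] at h
  exact sub_eq_zero.1 h.symm

theorem constField_mem (v : Fin d → 𝕜) : constField v ∈ coeffDeg 𝕜 d 0 := by
  intro i
  rw [comp_constField]
  exact MvPolynomial.isHomogeneous_C _ _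

/-- The value at `x` of a polynomial vector field. -/
def evalAt (x : Fin d → 𝕜) : PolyVect 𝕜 d →ₗ[𝕜] (Fin d → 𝕜) where
  toFun Y i := eval x (comp Y i)
  map_add' Y Z := by funext i; simp [comp_add]
  map_smul' c Y := by funext i; simp [comp_smul, MvPolynomial.smul_eval]

theorem evalAt_apply (x : Fin d → 𝕜) (Y : PolyVect 𝕜 d) (i : Fin d) :
    evalAt x Y i = eval x (comp Y i) := rfl

theorem evalAt_constField (x v : Fin d → 𝕜) : evalAt x (constField v) = v := by
  funext i
  rw [evalAt_apply, comp_constField, MvPolynomial.eval_C]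

theorem constField_injective : Function.Injective (constField (𝕜 := 𝕜) (d := d)) :=
  fun v w h ↦ by rw [← evalAt_constField 0 v, h, evalAt_constField]

theorem eval_apply (Y : PolyVect 𝕜 d) (x : Fin d → 𝕜) (p : MvPolynomial (Fin d) 𝕜) :
    eval x (Y p) = eval x (constField (evalAt x Y) p) := by
  rw [apply_eq_sum, constField_apply, map_sum, map_sum]
  refine Finset.sum_congr rfl fun j _ ↦ ?_
  rw [map_mul, MvPolynomial.smul_eval, mul_comm, evalAt_apply]

theorem exists_eq_C {p : MvPolynomial (Fin d) 𝕜} (hp : p.IsHomogeneous 0) : ∃ c, p = C c :=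
  ⟨_, (MvPolynomial.totalDegree_eq_zero_iff_eq_C).1
    ((MvPolynomial.totalDegree_zero_iff_isHomogeneous _).2 hp)⟩

theorem eq_constField {Y : PolyVect 𝕜 d} (hY : Y ∈ coeffDeg 𝕜 d 0) (x : Fin d → 𝕜) :
    Y = constField (evalAt x Y) := by
  refine ext_comp fun i ↦ ?_
  obtain ⟨c, hc⟩ := exists_eq_C (hY i)
  rw [comp_constField, evalAt_apply, hc, MvPolynomial.eval_C]

theorem isHomogeneous_apply_of_mem {Y : PolyVect 𝕜 d} {m n : ℕ} (hY : Y ∈ coeffDeg 𝕜 d m)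
    {p : MvPolynomial (Fin d) 𝕜} (hp : p.IsHomogeneous n) : (Y p).IsHomogeneous (m + n - 1) := by
  rcases Nat.eq_zero_or_pos n with rfl | hn
  · obtain ⟨c, rfl⟩ := exists_eq_C hp
    rw [apply_C]
    exact MvPolynomial.isHomogeneous_zero _ _ _
  · rw [apply_eq_sum]
    refine MvPolynomial.IsHomogeneous.sum _ _ _ fun j _ ↦ ?_
    have := (hp.pderiv (i := j)).mul (hY j)
    rwa [show n - 1 + m = m + n - 1 by omega] at this

theorem lie_mem_coeffDeg_add {Y Z : PolyVect 𝕜 d} {m n : ℕ} (hY : Y ∈ coeffDeg 𝕜 d m)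
    (hZ : Z ∈ coeffDeg 𝕜 d n) : ⁅Y, Z⁆ ∈ coeffDeg 𝕜 d (m + n - 1) := by
  intro i
  rw [comp_lie]
  refine (isHomogeneous_apply_of_mem hY (hZ i)).sub ?_
  rw [add_comm]
  exact isHomogeneous_apply_of_mem hZ (hY i)

theorem lie_constField_mem {Y : PolyVect 𝕜 d} {n : ℕ} (v : Fin d → 𝕜)
    (hY : Y ∈ coeffDeg 𝕜 d (n + 1)) : ⁅constField v, Y⁆ ∈ coeffDeg 𝕜 d n := by
  have := lie_mem_coeffDeg_add (constField_mem v) hY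
  rwa [show 0 + (n + 1) - 1 = n by omega] at this

theorem lie_constField_eq_zero {Y : PolyVect 𝕜 d} (v : Fin d → 𝕜) (hY : Y ∈ coeffDeg 𝕜 d 0) :
    ⁅constField v, Y⁆ = 0 := by
  rw [eq_constField hY 0, lie_constField_constField]

/-- The Euler vector field. -/
def euler : PolyVect 𝕜 d := MvPolynomial.mkDerivation 𝕜 X

theorem comp_euler (i : Fin d) : comp (euler : PolyVect 𝕜 d) i = X i :=
  MvPolynomial.mkDerivation_X _ _ _

theorem euler_mem : (euler : PolyVect 𝕜 d) ∈ coeffDeg 𝕜 d 1 := by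
  intro i
  rw [comp_euler]
  exact MvPolynomial.isHomogeneous_X _ _

theorem euler_apply {p : MvPolynomial (Fin d) 𝕜} {n : ℕ} (hp : p.IsHomogeneous n) :
    (euler : PolyVect 𝕜 d) p = (n : 𝕜) • p := by
  rw [apply_eq_sum, Nat.cast_smul_eq_nsmul, ← hp.sum_X_mul_pderiv]
  refine Finset.sum_congr rfl fun j _ ↦ ?_
  rw [comp_euler, mul_comm]

theorem euler_lie {Y : PolyVect 𝕜 d} {n : ℕ} (hY : Y ∈ coeffDeg 𝕜 d n) :
    ⁅(euler : PolyVect 𝕜 d), Y⁆ = ((n : 𝕜) - 1) • Y := by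
  refine ext_comp fun i ↦ ?_
  rw [comp_lie, euler_apply (hY i), comp_euler, comp_smul, sub_smul, one_smul]
  rfl

theorem evalAt_euler (x : Fin d → 𝕜) : evalAt x euler = x := by
  funext i
  rw [evalAt_apply, comp_euler, MvPolynomial.eval_X]

theorem eval_constField_self {p : MvPolynomial (Fin d) 𝕜} {n : ℕ} (hp : p.IsHomogeneous n)
    (x : Fin d → 𝕜) : eval x (constField x p) = n * eval x p := by
  have h := eval_apply euler x p
  rw [evalAt_euler, euler_apply hp, MvPolynomial.smul_eval] at h
  exact h.symm

/-- Euler's identity: differentiating a homogeneous field at x in the direction x multiplies its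
value by the degree. -/
theorem evalAt_lie_constField_self {Y : PolyVect 𝕜 d} {n : ℕ} (hY : Y ∈ coeffDeg 𝕜 d n)
    (x : Fin d → 𝕜) : evalAt x ⁅constField x, Y⁆ = (n : 𝕜) • evalAt x Y := by
  funext i
  rw [evalAt_apply, comp_lie_constField, eval_constField_self (hY i)]
  rfl

theorem eq_zero_of_evalAt {Y : PolyVect 𝕜 d} (h : ∀ x : Fin d → 𝕜, evalAt x Y = 0) : Y = 0 :=
  ext_comp fun i ↦ MvPolynomial.funext fun x ↦ by
    rw [← evalAt_apply, h, comp_zero, map_zero]; rfl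

/-- Transitivity: by Euler's identity a field of positive degree is determined by its brackets with
the constants. -/
theorem eq_zero_of_lie_constField {Y : PolyVect 𝕜 d} {n : ℕ} (hY : Y ∈ coeffDeg 𝕜 d (n + 1))
    (h : ∀ v : Fin d → 𝕜, ⁅constField v, Y⁆ = 0) : Y = 0 := by
  refine eq_zero_of_evalAt (𝕜 := 𝕜) fun x ↦ ?_
  have := evalAt_lie_constField_self hY x
  rw [h, map_zero] at this
  exact (smul_eq_zero.1 this.symm).resolve_left (Nat.cast_ne_zero.2 n.succ_ne_zero)

theorem mem_coeffDeg_zero_of_lie_constField {Y : PolyVect 𝕜 d}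
    (h : ∀ v : Fin d → 𝕜, ⁅constField v, Y⁆ = 0) : Y ∈ coeffDeg 𝕜 d 0 := by
  have hc : ∀ i, ∃ c, comp Y i = C c := fun i ↦ by
    refine ⟨MvPolynomial.coeff 0 (comp Y i), ?_⟩
    ext m
    rw [MvPolynomial.coeff_C]
    split_ifs with hm
    · rw [hm]
    · obtain ⟨j, hj⟩ : ∃ j, m j ≠ 0 := by
        by_contra hcon
        push Not at hcon
        exact hm (Finsupp.ext fun j ↦ (hcon j).symm)
      have h1 : pderiv j (comp Y i) = 0 := by
        rw [← constField_single, ← comp_lie_constField, h, comp_zero]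
      have h2 := MvPolynomial.coeff_pderiv (i := j) (comp Y i) (m - Finsupp.single j 1)
      rw [h1, MvPolynomial.coeff_zero, tsub_add_cancel_of_le
        (Finsupp.single_le_iff.2 (Nat.one_le_iff_ne_zero.2 hj))] at h2
      exact (mul_eq_zero.1 h2.symm).resolve_right (Nat.cast_add_one_ne_zero _)
  intro i
  obtain ⟨c, hc⟩ := hc i
  rw [hc]
  exact MvPolynomial.isHomogeneous_C _ _

/-- A linear form, as a polynomial. -/
def linPoly : Module.Dual 𝕜 (Fin d → 𝕜) →ₗ[𝕜] MvPolynomial (Fin d) 𝕜 where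
  toFun l := ∑ i, l (Pi.single i 1) • X i
  map_add' l m := by simp [add_smul, Finset.sum_add_distrib]
  map_smul' c l := by simp [Finset.smul_sum, smul_smul]

theorem linPoly_def (l : Module.Dual 𝕜 (Fin d → 𝕜)) :
    linPoly l = ∑ i, l (Pi.single i 1) • X i := rfl

theorem linPoly_isHomogeneous (l : Module.Dual 𝕜 (Fin d → 𝕜)) : (linPoly l).IsHomogeneous 1 :=
  MvPolynomial.IsHomogeneous.sum _ _ _ fun _ _ ↦
    (MvPolynomial.homogeneousSubmodule (Fin d) 𝕜 1).smul_mem _ (MvPolynomial.isHomogeneous_X _ _)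

theorem sum_dual_single (l : Module.Dual 𝕜 (Fin d → 𝕜)) (x : Fin d → 𝕜) :
    ∑ i, l (Pi.single i 1) * x i = l x := by
  conv_rhs => rw [← Finset.univ_sum_single x, map_sum]
  refine Finset.sum_congr rfl fun i _ ↦ ?_
  rw [mul_comm, ← smul_eq_mul, ← map_smul, ← Pi.single_smul, smul_eq_mul, mul_one]

theorem eval_linPoly (l : Module.Dual 𝕜 (Fin d → 𝕜)) (x : Fin d → 𝕜) :
    eval x (linPoly l) = l x := by
  rw [linPoly_def, map_sum, ← sum_dual_single]
  exact Finset.sum_congr rfl fun _ _ ↦ by rw [MvPolynomial.smul_eval, MvPolynomial.eval_X]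

theorem constField_linPoly (v : Fin d → 𝕜) (l : Module.Dual 𝕜 (Fin d → 𝕜)) :
    constField v (linPoly l) = C (l v) := by
  rw [linPoly_def, map_sum, ← sum_dual_single, map_sum]
  refine Finset.sum_congr rfl fun i _ ↦ ?_
  rw [Derivation.map_smul, MvPolynomial.smul_eq_C_mul, map_mul]
  exact congrArg _ (comp_constField v i)

theorem linPoly_ne_zero {l : Module.Dual 𝕜 (Fin d → 𝕜)} {v : Fin d → 𝕜} (h : l v ≠ 0) :
    linPoly l ≠ 0 := fun h0 ↦ h (by rw [← eval_linPoly, h0, map_zero])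

theorem totalDegree_linPoly {l : Module.Dual 𝕜 (Fin d → 𝕜)} {v : Fin d → 𝕜} (h : l v ≠ 0) :
    (linPoly l).totalDegree = 1 :=
  (linPoly_isHomogeneous l).totalDegree (linPoly_ne_zero h)

/-- On the line w + tu the polynomial becomes a polynomial in t that vanishes identically, so its
derivative at t = 0 vanishes. -/
theorem eval_constField_eq_zero {p : MvPolynomial (Fin d) 𝕜} {w u : Fin d → 𝕜}
    (h : ∀ t : 𝕜, eval (w + t • u) p = 0) : eval w (constField u p) = 0 := by
  let f : Fin d → Polynomial 𝕜 := fun i ↦ Polynomial.C (w i) + Polynomial.X * Polynomial.C (u i)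
  have h1 : ∀ (t : 𝕜) (q : MvPolynomial (Fin d) 𝕜),
      (MvPolynomial.aeval f q).eval t = eval (w + t • u) q := by
    intro t q
    induction q using MvPolynomial.induction_on with
    | C a => simp [Polynomial.algebraMap_eq]
    | add p q hp hq => simp [hp, hq]
    | mul_X p i hp =>
      rw [map_mul, Polynomial.eval_mul, hp]
      simp only [f, MvPolynomial.aeval_X, Polynomial.eval_add, Polynomial.eval_C,
        Polynomial.eval_mul, Polynomial.eval_X, map_mul, MvPolynomial.eval_X, Pi.add_apply,
        Pi.smul_apply, smul_eq_mul]
  have h2 : ∀ q : MvPolynomial (Fin d) 𝕜, Polynomial.derivative (MvPolynomial.aeval f q) =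
      MvPolynomial.aeval f (constField u q) := by
    intro q
    induction q using MvPolynomial.induction_on with
    | C a => simp [Polynomial.algebraMap_eq]
    | add p q hp hq => simp [hp, hq]
    | mul_X p i hp =>
      have := comp_constField u i
      rw [comp] at this
      rw [map_mul, Polynomial.derivative_mul, hp, Derivation.leibniz, this]
      simp [f, Polynomial.algebraMap_eq]
      ring
  have h3 : MvPolynomial.aeval f p = 0 := Polynomial.funext fun t ↦ by
    rw [h1, h, Polynomial.eval_zero]
  have h4 := h1 0 (constField u p)
  rw [← h2, h3] at h4
  simpa using h4.symm

/-- The polynomial vector fields with components of degree at most `N`. -/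
def boundedDeg (𝕜 : Type*) [RCLike 𝕜] (d N : ℕ) : Submodule 𝕜 (PolyVect 𝕜 d) where
  carrier := {Y | ∀ i, comp Y i ∈ MvPolynomial.restrictTotalDegree (Fin d) 𝕜 N}
  add_mem' hY hZ i := Submodule.add_mem _ (hY i) (hZ i)
  zero_mem' _ := Submodule.zero_mem _
  smul_mem' c _ hY i := Submodule.smul_mem _ c (hY i)

theorem mem_boundedDeg {N : ℕ} {Y : PolyVect 𝕜 d} :
    Y ∈ boundedDeg 𝕜 d N ↔ ∀ i, (comp Y i).totalDegree ≤ N :=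
  forall_congr' fun _ ↦ MvPolynomial.mem_restrictTotalDegree _ _ _

theorem boundedDeg_mono {M N : ℕ} (h : M ≤ N) : boundedDeg 𝕜 d M ≤ boundedDeg 𝕜 d N :=
  fun _ hY ↦ mem_boundedDeg.2 fun i ↦ (mem_boundedDeg.1 hY i).trans h

theorem coeffDeg_le_boundedDeg (n : ℕ) : coeffDeg 𝕜 d n ≤ boundedDeg 𝕜 d n :=
  fun _ hY ↦ mem_boundedDeg.2 fun i ↦ (hY i).totalDegree_le

instance (N : ℕ) : FiniteDimensional 𝕜 (boundedDeg 𝕜 d N) := by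
  let f : boundedDeg 𝕜 d N →ₗ[𝕜] (Fin d → MvPolynomial.restrictTotalDegree (Fin d) 𝕜 N) :=
    { toFun := fun Y i ↦ ⟨comp Y.1 i, Y.2 i⟩
      map_add' := fun _ _ ↦ rfl
      map_smul' := fun _ _ ↦ rfl }
  refine FiniteDimensional.of_injective f fun Y Z h ↦ Subtype.ext (ext_comp fun i ↦ ?_)
  exact congrArg Subtype.val (congrFun h i)

instance (n : ℕ) : FiniteDimensional 𝕜 (coeffDeg 𝕜 d n) :=
  Submodule.finiteDimensional_of_le (coeffDeg_le_boundedDeg n)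

theorem exists_le_boundedDeg (p : Submodule 𝕜 (PolyVect 𝕜 d)) [FiniteDimensional 𝕜 p] :
    ∃ N, p ≤ boundedDeg 𝕜 d N := by
  obtain ⟨S, hS⟩ := (Submodule.fg_iff_finiteDimensional p).2 inferInstance
  refine ⟨S.sup fun Y ↦ Finset.univ.sup fun i ↦ (comp Y i).totalDegree, ?_⟩
  rw [← hS, Submodule.span_le]
  intro Y hY
  refine mem_boundedDeg.2 fun i ↦ ?_
  exact (Finset.le_sup (f := fun i ↦ (comp Y i).totalDegree) (Finset.mem_univ i)).trans
    (Finset.le_sup (f := fun Y ↦ Finset.univ.sup fun i ↦ (comp Y i).totalDegree) hY)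

/-- The degrees of the fields lⁿY are unbounded, whereas a finite-dimensional space of fields has
bounded degree. -/
theorem not_finiteDimensional_of_pow_smul_mem {p : Submodule 𝕜 (PolyVect 𝕜 d)}
    {l : MvPolynomial (Fin d) 𝕜} (hl : l.totalDegree = 1) {Y : PolyVect 𝕜 d} (hY : Y ≠ 0)
    (h : ∀ n : ℕ, l ^ (n + 1) • Y ∈ p) : ¬ FiniteDimensional 𝕜 p := by
  intro hp
  obtain ⟨N, hN⟩ := exists_le_boundedDeg p
  obtain ⟨i, hi⟩ : ∃ i, comp Y i ≠ 0 := by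
    by_contra hcon
    push Not at hcon
    exact hY (ext_comp hcon)
  have hl0 : l ≠ 0 := by
    rintro rfl
    simp at hl
  have hpow : ∀ n, (l ^ n).totalDegree = n := by
    intro n
    induction n with
    | zero => simp
    | succ n ih =>
      rw [pow_succ, MvPolynomial.totalDegree_mul_of_isDomain (pow_ne_zero _ hl0) hl0, ih, hl]
  have := mem_boundedDeg.1 (hN (h N)) i
  rw [comp_polySmul, MvPolynomial.totalDegree_mul_of_isDomain (pow_ne_zero _ hl0) hi, hpow] at this
  omega

theorem not_finiteDimensional_polyVect (hd : 0 < d) : ¬ FiniteDimensional 𝕜 (PolyVect 𝕜 d) := by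
  intro h
  have : Module.Finite 𝕜 (⊤ : Submodule 𝕜 (PolyVect 𝕜 d)) := Module.Finite.top _ _
  refine not_finiteDimensional_of_pow_smul_mem (p := ⊤) (l := X ⟨0, hd⟩) (Y := euler)
    (MvPolynomial.totalDegree_X _) ?_ (fun _ ↦ Submodule.mem_top) this
  intro h0
  have := comp_euler (𝕜 := 𝕜) (⟨0, hd⟩ : Fin d)
  rw [h0, comp_zero] at this
  exact MvPolynomial.X_ne_zero _ this.symm

end PolynomialVectorFields

end IFFT

end

noncomputable section

namespace IFFT

/-! ### Consequences of maximality -/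

section MaximalSubalgebras

open MvPolynomial (C X pderiv constantCoeff eval IsHomogeneous)

variable {𝕜 : Type*} [RCLike 𝕜] {d : ℕ} {g : LieSubalgebra 𝕜 (PolyVect 𝕜 d)}

theorem IsGraded.le (hgr : IsGraded g) {p : Submodule 𝕜 (PolyVect 𝕜 d)}
    (h : ∀ n, ∀ Y ∈ g, Y ∈ coeffDeg 𝕜 d n → Y ∈ p) : g.toSubmodule ≤ p := by
  rw [hgr]
  exact iSup_le fun n Y hY ↦ h n Y hY.1 hY.2

theorem dim_pos (hmax : IsCoatom g) : 0 < d := by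
  rcases Nat.eq_zero_or_pos d with rfl | hd
  · refine absurd (eq_top_iff.2 fun Y _ ↦ ?_) hmax.1
    rw [show Y = 0 from ext_comp fun i ↦ i.elim0]
    exact g.zero_mem
  · exact hd

theorem ne_top_of_finiteDimensional (hd : 0 < d) (T : LieSubalgebra 𝕜 (PolyVect 𝕜 d))
    [FiniteDimensional 𝕜 T] : T ≠ ⊤ := by
  rintro rfl
  refine not_finiteDimensional_polyVect (𝕜 := 𝕜) hd ?_
  have : FiniteDimensional 𝕜 ((⊤ : LieSubalgebra 𝕜 (PolyVect 𝕜 d)).toSubmodule) := ‹_›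
  exact FiniteDimensional.of_surjective
    ((⊤ : LieSubalgebra 𝕜 (PolyVect 𝕜 d)).toSubmodule.subtype) fun Y ↦ ⟨⟨Y, trivial⟩, rfl⟩

theorem eq_of_le_of_ne_top (hmax : IsCoatom g) {T : LieSubalgebra 𝕜 (PolyVect 𝕜 d)}
    (hT : g ≤ T) (hT' : T ≠ ⊤) : T = g := by
  by_contra hne
  exact hT' (hmax.2 T (lt_of_le_of_ne hT (Ne.symm hne)))

theorem eq_top_of_pow_smul_mem [FiniteDimensional 𝕜 g] (hmax : IsCoatom g)
    {T : LieSubalgebra 𝕜 (PolyVect 𝕜 d)} (hT : g ≤ T) {l : MvPolynomial (Fin d) 𝕜}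
    (hl : l.totalDegree = 1) {Y : PolyVect 𝕜 d} (hY : Y ≠ 0)
    (h : ∀ n : ℕ, l ^ (n + 1) • Y ∈ T) : T = ⊤ := by
  by_contra hne
  obtain rfl := eq_of_le_of_ne_top hmax hT hne
  exact not_finiteDimensional_of_pow_smul_mem (p := T.toSubmodule) hl hY h ‹_›

/-- Because 𝔤 is graded, bracketing with E preserves it. So 𝔤 + 𝕜E is a finite-dimensional
subalgebra, hence proper, hence equal to 𝔤. -/
theorem euler_mem_of_isCoatom [FiniteDimensional 𝕜 g] (hgr : IsGraded g) (hmax : IsCoatom g) :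
    euler ∈ g := by
  have hE : ∀ Y ∈ g, ⁅(euler : PolyVect 𝕜 d), Y⁆ ∈ g := by
    have := hgr.le (p := g.toSubmodule.comap
      (LieAlgebra.ad 𝕜 (PolyVect 𝕜 d) euler : PolyVect 𝕜 d →ₗ[𝕜] PolyVect 𝕜 d))
      fun n Y hY hn ↦ by
        change ⁅(euler : PolyVect 𝕜 d), Y⁆ ∈ g
        rw [euler_lie hn]
        exact g.smul_mem _ hY
    exact fun Y hY ↦ this hY
  let T : LieSubalgebra 𝕜 (PolyVect 𝕜 d) :=
    { g.toSubmodule ⊔ 𝕜 ∙ euler with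
      lie_mem' := fun {Y Z} hY hZ ↦ by
        obtain ⟨a, ha, b, hb, rfl⟩ := Submodule.mem_sup.1 hY
        obtain ⟨a', ha', b', hb', rfl⟩ := Submodule.mem_sup.1 hZ
        obtain ⟨c, rfl⟩ := Submodule.mem_span_singleton.1 hb
        obtain ⟨c', rfl⟩ := Submodule.mem_span_singleton.1 hb'
        refine Submodule.mem_sup_left ?_
        change _ ∈ g
        rw [add_lie, lie_add, lie_add, smul_lie, smul_lie, lie_smul, lie_smul, lie_self, smul_zero,
          smul_zero, add_zero, ← lie_skew a euler]
        exact g.add_mem (g.add_mem (g.lie_mem ha ha')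
          (g.smul_mem _ (g.neg_mem (hE a ha)))) (g.smul_mem _ (hE a' ha')) }
  have hfd : FiniteDimensional 𝕜 T := by
    have : FiniteDimensional 𝕜 g.toSubmodule := ‹_›
    exact inferInstanceAs (FiniteDimensional 𝕜 ↥(g.toSubmodule ⊔ 𝕜 ∙ (euler : PolyVect 𝕜 d)))
  have hle : g ≤ T := fun Y hY ↦ Submodule.mem_sup_left hY
  rw [← eq_of_le_of_ne_top hmax hle (ne_top_of_finiteDimensional (dim_pos hmax) T)]
  exact Submodule.mem_sup_right (Submodule.mem_span_singleton_self _)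

/-- The polynomial vector fields preserving an arbitrary space of polynomials. -/
def preserving (A : Submodule 𝕜 (MvPolynomial (Fin d) 𝕜)) : LieSubalgebra 𝕜 (PolyVect 𝕜 d) where
  carrier := {Y | ∀ p ∈ A, Y p ∈ A}
  add_mem' hY hZ p hp := A.add_mem (hY p hp) (hZ p hp)
  zero_mem' _ _ := A.zero_mem
  smul_mem' c _ hY p hp := A.smul_mem c (hY p hp)
  lie_mem' {Y Z} hY hZ p hp := by
    rw [Derivation.commutator_apply]
    exact A.sub_mem (hY _ (hZ p hp)) (hZ _ (hY p hp))

theorem mem_preserving {A : Submodule 𝕜 (MvPolynomial (Fin d) 𝕜)} {Y : PolyVect 𝕜 d} :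
    Y ∈ preserving A ↔ ∀ p ∈ A, Y p ∈ A := Iff.rfl

/-- If Y is homogeneous of degree n, bracketing it n times with w gives the constant field n! Y(w).
Thus the fields of 𝔤 are tangent to the space of constants of 𝔤. -/
theorem constField_evalAt_mem (hgr : IsGraded g) {w : Fin d → 𝕜} (hw : constField w ∈ g)
    {Y : PolyVect 𝕜 d} (hY : Y ∈ g) : constField (evalAt w Y) ∈ g := by
  have key : ∀ n, ∀ Y ∈ g, Y ∈ coeffDeg 𝕜 d n → constField (evalAt w Y) ∈ g := by
    intro n
    induction n with
    | zero =>
      intro Y hY hn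
      rwa [← eq_constField hn]
    | succ n ih =>
      intro Y hY hn
      have := ih _ (g.lie_mem hw hY) (lie_constField_mem w hn)
      rw [evalAt_lie_constField_self hn, map_smul] at this
      have h0 : ((n + 1 : ℕ) : 𝕜) ≠ 0 := Nat.cast_ne_zero.2 n.succ_ne_zero
      have := g.smul_mem ((n + 1 : ℕ) : 𝕜)⁻¹ this
      rwa [smul_smul, inv_mul_cancel₀ h0, one_smul] at this
  exact hgr.le (p := g.toSubmodule.comap (constField.comp (evalAt w))) key hY

/-- Let W be the space of constants of 𝔤, and suppose v ∉ W. The fields of 𝔤 are tangent to W, so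
they preserve the ideal A of polynomials vanishing on W. The stabilizer of A is
infinite-dimensional, hence everything, yet the constant field v does not preserve A. -/
theorem constField_mem_of_isCoatom [FiniteDimensional 𝕜 g] (hgr : IsGraded g) (hmax : IsCoatom g)
    (v : Fin d → 𝕜) : constField v ∈ g := by
  let W : Submodule 𝕜 (Fin d → 𝕜) := g.toSubmodule.comap constField
  by_contra hv
  obtain ⟨l, hlv, hlW⟩ := Submodule.exists_le_ker_of_notMem (p := W) (v := v) hv
  let A : Submodule 𝕜 (MvPolynomial (Fin d) 𝕜) :=
    { carrier := {p | ∀ w ∈ W, eval w p = 0}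
      add_mem' := fun hp hq w hw ↦ by rw [map_add, hp w hw, hq w hw, add_zero]
      zero_mem' := fun _ _ ↦ map_zero _
      smul_mem' := fun c p hp w hw ↦ by rw [MvPolynomial.smul_eval, hp w hw, mul_zero] }
  have hle : g ≤ preserving A := by
    intro Y hY p hp w hw
    rw [eval_apply]
    refine eval_constField_eq_zero fun t ↦ hp _ ?_
    exact W.add_mem hw (W.smul_mem t (constField_evalAt_mem hgr hw hY))
  have hl0 : ∀ w ∈ W, eval w (linPoly l) = 0 := fun w hw ↦ by
    rw [eval_linPoly]
    exact hlW hw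
  -- The form l vanishes on W, so each lⁿ⁺¹v maps every polynomial into A.
  have htop : preserving A = ⊤ := by
    refine eq_top_of_pow_smul_mem hmax hle (totalDegree_linPoly hlv) (Y := constField v) ?_ ?_
    · intro h0
      apply hlv
      rw [constField_injective (h0.trans (map_zero _).symm), map_zero]
    · intro n p _ w hw
      change eval w (linPoly l ^ (n + 1) * constField v p) = 0
      rw [map_mul, map_pow, hl0 w hw, zero_pow n.succ_ne_zero, zero_mul]
  have hmem : constField v ∈ preserving A := htop ▸ LieSubalgebra.mem_top _
  have := mem_preserving.1 hmem (linPoly l) hl0 0 W.zero_mem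
  rw [constField_linPoly, MvPolynomial.eval_C] at this
  exact hlv this

/-- The derivative of Y along u is brought down to degree one by further brackets with x, where
stability of U applies. It says that 𝔤 respects the foliation of V by translates of U. -/
theorem evalAt_lie_constField_mem [FiniteDimensional 𝕜 g] (hgr : IsGraded g) (hmax : IsCoatom g)
    {U : Submodule 𝕜 (Fin d → 𝕜)}
    (hU : ∀ Y ∈ g, Y ∈ coeffDeg 𝕜 d 1 → ∀ u ∈ U, evalAt u Y ∈ U) {u : Fin d → 𝕜} (hu : u ∈ U)
    (x : Fin d → 𝕜) {Y : PolyVect 𝕜 d} (hY : Y ∈ g) : evalAt x ⁅constField u, Y⁆ ∈ U := by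
  have key : ∀ n, ∀ Y ∈ g, Y ∈ coeffDeg 𝕜 d n → evalAt x ⁅constField u, Y⁆ ∈ U := by
    intro n
    induction n with
    | zero =>
      intro Y _ hn
      rw [lie_constField_eq_zero u hn, map_zero]
      exact U.zero_mem
    | succ n ih =>
      intro Y hY hn
      rcases Nat.eq_zero_or_pos n with rfl | hpos
      · have h1 := hU Y hY hn u hu
        have h2 := evalAt_lie_constField_self hn u
        rw [eq_constField (lie_constField_mem u hn) u, h2, evalAt_constField]
        exact U.smul_mem _ h1
      · obtain ⟨n, rfl⟩ := Nat.exists_eq_succ_of_ne_zero hpos.ne'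
        have h1 := ih _ (g.lie_mem (constField_mem_of_isCoatom hgr hmax x) hY)
          (lie_constField_mem x hn)
        rw [lie_constField_comm,
          evalAt_lie_constField_self (lie_constField_mem u hn)] at h1
        have h0 : ((n + 1 : ℕ) : 𝕜) ≠ 0 := Nat.cast_ne_zero.2 n.succ_ne_zero
        have h2 := U.smul_mem ((n + 1 : ℕ) : 𝕜)⁻¹ h1
        rwa [smul_smul, inv_mul_cancel₀ h0, one_smul] at h2
  exact hgr.le (p := U.comap ((evalAt x).comp
    (LieAlgebra.ad 𝕜 (PolyVect 𝕜 d) (constField u) : PolyVect 𝕜 d →ₗ[𝕜] PolyVect 𝕜 d))) key hY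

/-- The linear vector fields of `g` act irreducibly on `V`. -/
theorem eq_bot_or_eq_top_of_stable [FiniteDimensional 𝕜 g] (hgr : IsGraded g) (hmax : IsCoatom g)
    {U : Submodule 𝕜 (Fin d → 𝕜)}
    (hU : ∀ Y ∈ g, Y ∈ coeffDeg 𝕜 d 1 → ∀ u ∈ U, evalAt u Y ∈ U) : U = ⊥ ∨ U = ⊤ := by
  by_contra hcon
  push Not at hcon
  obtain ⟨u, hu, hu0⟩ := Submodule.exists_mem_ne_zero_of_ne_bot hcon.1
  obtain ⟨c, hc⟩ : ∃ c : Fin d → 𝕜, c ∉ U := by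
    by_contra h
    push Not at h
    exact hcon.2 (eq_top_iff.2 fun c _ ↦ h c)
  obtain ⟨l, hlc, hlU⟩ := Submodule.exists_le_ker_of_notMem hc
  obtain ⟨m, hm, -⟩ := Submodule.exists_le_ker_of_notMem
    (p := (⊥ : Submodule 𝕜 (Fin d → 𝕜))) (v := u) (by simpa using hu0)
  -- A is the space of polynomials constant along U. It is preserved by 𝔤 and by all lⁿ⁺¹c, where l
  -- is a form killing U with l(c) ≠ 0; so maximality would make every field preserve it.
  let A : Submodule 𝕜 (MvPolynomial (Fin d) 𝕜) :=
    { carrier := {p | ∀ u ∈ U, constField u p = 0}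
      add_mem' := fun hp hq w hw ↦ by rw [map_add, hp w hw, hq w hw, add_zero]
      zero_mem' := fun _ _ ↦ map_zero _
      smul_mem' := fun c p hp w hw ↦ by rw [Derivation.map_smul, hp w hw, smul_zero] }
  have hcomm : ∀ (Y : PolyVect 𝕜 d) (w : Fin d → 𝕜) (p : MvPolynomial (Fin d) 𝕜),
      constField w (Y p) = ⁅constField w, Y⁆ p + Y (constField w p) := by
    intro Y w p
    rw [Derivation.commutator_apply, sub_add_cancel]
  have hle : g ≤ preserving A := by
    intro Y hY p hp w hw
    rw [hcomm, hp w hw, map_zero, add_zero]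
    refine MvPolynomial.funext fun x ↦ ?_
    rw [eval_apply, hp _ (evalAt_lie_constField_mem hgr hmax hU hw x hY)]
  have hlA : linPoly l ∈ A := fun w hw ↦ by
    rw [constField_linPoly, show l w = 0 from hlU hw, map_zero]
  have htop : preserving A = ⊤ := by
    refine eq_top_of_pow_smul_mem hmax hle (totalDegree_linPoly hlc) (Y := constField c) ?_ ?_
    · intro h0
      apply hlc
      rw [constField_injective (h0.trans (map_zero _).symm), map_zero]
    · intro n p hp w hw
      change constField w (linPoly l ^ (n + 1) * constField c p) = 0
      rw [Derivation.leibniz, hcomm, lie_constField_constField, hp w hw, map_zero,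
        Derivation.leibniz_pow, hlA w hw]
      simp
  -- The field mc sends l ∈ A to l(c)m, which is not constant along U because m(u) ≠ 0.
  have hmem : (linPoly m • constField c : PolyVect 𝕜 d) ∈ preserving A := htop ▸ LieSubalgebra.mem_top _
  have := mem_preserving.1 hmem (linPoly l) hlA u hu
  change constField u (linPoly m * constField c (linPoly l)) = 0 at this
  rw [constField_linPoly, Derivation.leibniz, apply_C, constField_linPoly, smul_zero, zero_add,
    smul_eq_mul, ← map_mul, MvPolynomial.C_eq_zero] at this
  exact (mul_ne_zero hlc hm) this

end MaximalSubalgebras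

end IFFT

end

noncomputable section

namespace IFFT

/-! ### Semisimplicity of 𝔤 -/

section KillingForm

open MvPolynomial (C X pderiv constantCoeff eval IsHomogeneous)

variable {𝕜 : Type*} [RCLike 𝕜] {d : ℕ} {g : LieSubalgebra 𝕜 (PolyVect 𝕜 d)}

theorem lie_linear_smul_euler {Y : PolyVect 𝕜 d} (hY : Y ∈ coeffDeg 𝕜 d 1)
    (p : MvPolynomial (Fin d) 𝕜) : ⁅Y, p • (euler : PolyVect 𝕜 d)⁆ = Y p • euler := by
  refine ext_comp fun i ↦ ?_
  rw [comp_lie, comp_polySmul, comp_polySmul, comp_euler, Derivation.leibniz,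
    Derivation.smul_apply, euler_apply (hY i)]
  simp only [smul_eq_mul, Nat.cast_one, one_smul, comp]
  ring

theorem lie_smul_euler_smul_euler {p q : MvPolynomial (Fin d) 𝕜} {m : ℕ} (hp : p.IsHomogeneous m)
    (hq : q.IsHomogeneous m) : ⁅p • (euler : PolyVect 𝕜 d), q • (euler : PolyVect 𝕜 d)⁆ = 0 := by
  refine ext_comp fun i ↦ ?_
  rw [comp_lie, comp_polySmul, comp_polySmul, comp_euler, Derivation.smul_apply,
    Derivation.smul_apply, euler_apply (hp.mul (MvPolynomial.isHomogeneous_X _ i)),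
    euler_apply (hq.mul (MvPolynomial.isHomogeneous_X _ i)), comp_zero]
  simp only [smul_eq_mul, MvPolynomial.smul_eq_C_mul]
  ring

theorem smul_euler_mem {p : MvPolynomial (Fin d) 𝕜} (hp : p.IsHomogeneous 1) :
    p • (euler : PolyVect 𝕜 d) ∈ coeffDeg 𝕜 d 2 := by
  intro i
  rw [comp_polySmul, comp_euler]
  exact hp.mul (MvPolynomial.isHomogeneous_X _ i)

/-- The Lie algebra of the infinitesimal projective transformations. -/
def projective (𝕜 : Type*) [RCLike 𝕜] (d : ℕ) : LieSubalgebra 𝕜 (PolyVect 𝕜 d) where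
  carrier := {Y | ∃ a ∈ coeffDeg 𝕜 d 0, ∃ b ∈ coeffDeg 𝕜 d 1, ∃ p : MvPolynomial (Fin d) 𝕜,
    p.IsHomogeneous 1 ∧ Y = a + b + p • euler}
  add_mem' := by
    rintro _ _ ⟨a, ha, b, hb, p, hp, rfl⟩ ⟨a', ha', b', hb', p', hp', rfl⟩
    exact ⟨a + a', add_mem ha ha', b + b', add_mem hb hb', p + p', hp.add hp', by
      rw [add_smul]; abel⟩
  zero_mem' := ⟨0, zero_mem _, 0, zero_mem _, 0, MvPolynomial.isHomogeneous_zero _ _ _, by simp⟩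
  smul_mem' := by
    rintro c _ ⟨a, ha, b, hb, p, hp, rfl⟩
    exact ⟨c • a, Submodule.smul_mem _ c ha, c • b, Submodule.smul_mem _ c hb, c • p,
      (MvPolynomial.homogeneousSubmodule (Fin d) 𝕜 1).smul_mem c hp, by
        rw [smul_add, smul_add, smul_assoc]⟩
  lie_mem' := by
    rintro _ _ ⟨a, ha, b, hb, p, hp, rfl⟩ ⟨a', ha', b', hb', q, hq, rfl⟩
    refine ⟨⁅a, b'⁆ + ⁅b, a'⁆, add_mem (lie_mem_coeffDeg_add ha hb') (lie_mem_coeffDeg_add hb ha'),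
      ⁅b, b'⁆ + ⁅a, q • euler⁆ + ⁅p • euler, a'⁆,
      add_mem (add_mem (lie_mem_coeffDeg_add hb hb') (lie_mem_coeffDeg_add ha (smul_euler_mem hq)))
        (lie_mem_coeffDeg_add (smul_euler_mem hp) ha'), b q - b' p,
      (isHomogeneous_apply hb hq).sub (isHomogeneous_apply hb' hp), ?_⟩
    have h1 := lie_linear_smul_euler hb q
    have h2 := lie_linear_smul_euler hb' p
    rw [← lie_skew] at h2
    have h3 := lie_smul_euler_smul_euler hp hq
    have h4 : ⁅a, a'⁆ = 0 := by
      rw [eq_constField ha 0, eq_constField ha' 0, lie_constField_constField]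
    have h5 : (b q - b' p) • (euler : PolyVect 𝕜 d) = b q • euler - b' p • euler :=
      ext_comp fun i ↦ sub_mul (b q) (b' p) (comp euler i)
    rw [add_lie, add_lie, lie_add, lie_add, lie_add, lie_add, lie_add, lie_add, h1, h3, h4,
      h5, ← h2]
    abel

instance : FiniteDimensional 𝕜 (projective 𝕜 d) := by
  have hle : (projective 𝕜 d).toSubmodule ≤ boundedDeg 𝕜 d 2 := by
    rintro _ ⟨a, ha, b, hb, p, hp, rfl⟩
    exact add_mem (add_mem (boundedDeg_mono (by norm_num) (coeffDeg_le_boundedDeg 0 ha))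
      (boundedDeg_mono (by norm_num) (coeffDeg_le_boundedDeg 1 hb)))
      (coeffDeg_le_boundedDeg 2 (smul_euler_mem hp))
  exact Submodule.finiteDimensional_of_le hle

/-- Without quadratic fields, transitivity leaves only fields of degree at most one, so 𝔤 lies in
the finite-dimensional projective algebra. By maximality it equals that algebra, which contains the
quadratic field x₀E. -/
theorem exists_quadratic [FiniteDimensional 𝕜 g] (hgr : IsGraded g) (hmax : IsCoatom g) :
    ∃ Q ∈ g, Q ∈ coeffDeg 𝕜 d 2 ∧ Q ≠ 0 := by
  by_contra! hcon
  have hzero : ∀ n, ∀ Y ∈ g, Y ∈ coeffDeg 𝕜 d (n + 2) → Y = 0 := by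
    intro n
    induction n with
    | zero => exact hcon
    | succ n ih =>
      exact fun Y hY hn ↦ eq_zero_of_lie_constField hn fun v ↦
        ih _ (g.lie_mem (constField_mem_of_isCoatom hgr hmax v) hY) (lie_constField_mem v hn)
  have hle : g ≤ projective 𝕜 d := hgr.le (p := (projective 𝕜 d).toSubmodule) fun n Y hY hn ↦ by
    match n with
    | 0 => exact ⟨Y, hn, 0, zero_mem _, 0, MvPolynomial.isHomogeneous_zero _ _ _, by simp⟩
    | 1 => exact ⟨0, zero_mem _, Y, hn, 0, MvPolynomial.isHomogeneous_zero _ _ _, by simp⟩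
    | n + 2 =>
      rw [hzero n Y hY hn]
      exact zero_mem _
  have hd := dim_pos hmax
  have heq := eq_of_le_of_ne_top hmax hle (ne_top_of_finiteDimensional hd _)
  have hX : (X ⟨0, hd⟩ : MvPolynomial (Fin d) 𝕜).IsHomogeneous 1 := MvPolynomial.isHomogeneous_X _ _
  have hmem : (X ⟨0, hd⟩ : MvPolynomial (Fin d) 𝕜) • (euler : PolyVect 𝕜 d) ∈ g := by
    rw [← heq]
    exact ⟨0, zero_mem _, 0, zero_mem _, _, hX, by simp⟩
  have h0 := congrArg (comp · ⟨0, hd⟩) (hcon _ hmem (smul_euler_mem hX))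
  simp only [comp_polySmul, comp_euler, comp_zero] at h0
  exact mul_ne_zero (MvPolynomial.X_ne_zero _) (MvPolynomial.X_ne_zero _) h0

theorem totalDegree_pderiv_le {p : MvPolynomial (Fin d) 𝕜} {N : ℕ} (hp : p.totalDegree ≤ N + 1)
    (j : Fin d) : (pderiv j p).totalDegree ≤ N := by
  refine Finset.sup_le fun m hm ↦ ?_
  rw [MvPolynomial.mem_support_iff, MvPolynomial.coeff_pderiv] at hm
  have h1 := (MvPolynomial.le_totalDegree
    (MvPolynomial.mem_support_iff.2 (left_ne_zero_of_mul hm))).trans hp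
  rw [Finsupp.sum_add_index' (fun _ ↦ rfl) (fun _ _ _ ↦ rfl), Finsupp.sum_single_index rfl] at h1
  omega

theorem lie_constField_mem_boundedDeg {Y : PolyVect 𝕜 d} {N : ℕ} (v : Fin d → 𝕜)
    (hY : Y ∈ boundedDeg 𝕜 d (N + 1)) : ⁅constField v, Y⁆ ∈ boundedDeg 𝕜 d N := by
  intro i
  rw [comp_lie_constField, constField_apply]
  exact Submodule.sum_mem _ fun j _ ↦ Submodule.smul_mem _ _
    ((MvPolynomial.mem_restrictTotalDegree _ _ _).2
      (totalDegree_pderiv_le (mem_boundedDeg.1 hY i) j))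

theorem lie_linear_constField {Y : PolyVect 𝕜 d} (hY : Y ∈ coeffDeg 𝕜 d 1) (v : Fin d → 𝕜) :
    ⁅constField v, Y⁆ = constField (evalAt v Y) := by
  rw [eq_constField (lie_constField_mem v hY) v, evalAt_lie_constField_self hY, Nat.cast_one,
    one_smul]

section

variable [FiniteDimensional 𝕜 g] (hgr : IsGraded g) (hmax : IsCoatom g)

/-- The constant vector fields, as elements of `g`. -/
def cst : (Fin d → 𝕜) →ₗ[𝕜] g :=
  LinearMap.codRestrict g.toSubmodule constField (constField_mem_of_isCoatom hgr hmax)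

theorem coe_cst (v : Fin d → 𝕜) : (cst hgr hmax v : PolyVect 𝕜 d) = constField v := rfl

/-- The Euler field, as an element of `g`. -/
def eul : g := ⟨euler, euler_mem_of_isCoatom hgr hmax⟩

theorem exists_cst_mem_ideal (I : LieIdeal 𝕜 g) (N : ℕ) :
    ∀ Y ∈ I, Y ≠ 0 → (Y : PolyVect 𝕜 d) ∈ boundedDeg 𝕜 d N → ∃ v ≠ 0, cst hgr hmax v ∈ I := by
  have key : ∀ Y ∈ I, Y ≠ 0 → (Y : PolyVect 𝕜 d) ∈ coeffDeg 𝕜 d 0 →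
      ∃ v ≠ 0, cst hgr hmax v ∈ I := by
    intro Y hY hY0 h
    have hv := eq_constField h 0
    refine ⟨evalAt 0 (Y : PolyVect 𝕜 d), fun h0 ↦ hY0 (Subtype.ext ?_), ?_⟩
    · rw [hv, h0, map_zero]
      rfl
    · rwa [show cst hgr hmax (evalAt 0 (Y : PolyVect 𝕜 d)) = Y from Subtype.ext hv.symm]
  induction N with
  | zero =>
    refine fun Y hY hY0 h ↦ key Y hY hY0 fun i ↦ ?_
    exact (MvPolynomial.totalDegree_zero_iff_isHomogeneous _).1
      (Nat.le_zero.1 (mem_boundedDeg.1 h i))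
  | succ N ih =>
    intro Y hY hY0 h
    by_cases hall : ∀ v : Fin d → 𝕜, ⁅constField v, (Y : PolyVect 𝕜 d)⁆ = 0
    · exact key Y hY hY0 (mem_coeffDeg_zero_of_lie_constField hall)
    · push Not at hall
      obtain ⟨v, hv⟩ := hall
      refine ih ⁅cst hgr hmax v, Y⁆ (lie_mem_right 𝕜 g I _ _ hY) (fun h0 ↦ hv ?_)
        (lie_constField_mem_boundedDeg v h)
      exact congrArg Subtype.val h0

/-- Brackets with constants lower the degree of a nonzero element of I until a nonzero constant is
reached; irreducibility of 𝔤₀ on V then yields all of them. -/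
theorem cst_mem_ideal {I : LieIdeal 𝕜 g} (hI : I ≠ ⊥) (v : Fin d → 𝕜) : cst hgr hmax v ∈ I := by
  have : FiniteDimensional 𝕜 g.toSubmodule := ‹_›
  obtain ⟨Y, hY, hY0⟩ := Submodule.exists_mem_ne_zero_of_ne_bot
    (p := I.toSubmodule) (by simpa using hI)
  obtain ⟨N, hN⟩ := exists_le_boundedDeg g.toSubmodule
  obtain ⟨u, hu0, hu⟩ := exists_cst_mem_ideal hgr hmax I N Y hY hY0 (hN Y.2)
  have htop : I.toSubmodule.comap (cst hgr hmax) = ⊤ := by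
    refine (eq_bot_or_eq_top_of_stable hgr hmax ?_).resolve_left ?_
    · intro Y hY hY1 u hu
      have := lie_mem_left 𝕜 g I (cst hgr hmax u) ⟨Y, hY⟩ hu
      rwa [show ⁅cst hgr hmax u, (⟨Y, hY⟩ : g)⁆ = cst hgr hmax (evalAt u Y) from
        Subtype.ext (lie_linear_constField hY1 u)] at this
    · exact fun h ↦ hu0 ((Submodule.eq_bot_iff _).1 h u hu)
  exact (htop ▸ Submodule.mem_top : v ∈ I.toSubmodule.comap (cst hgr hmax))

include hgr hmax in
-- A nonzero abelian ideal would contain all constants v, w, hence also [v, Q] for a quadratic Q ∈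
-- 𝔤. Then [w, [v, Q]] = 0 for all v and w, which forces Q = 0.
theorem isKilling_of_isCoatom : LieAlgebra.IsKilling 𝕜 g := by
  have : LieAlgebra.HasTrivialRadical 𝕜 g := by
    refine LieAlgebra.hasTrivialRadical_iff_no_abelian_ideals 𝕜 g |>.2 fun I hI ↦ ?_
    by_contra hne
    obtain ⟨Q, hQ, hQ2, hQ0⟩ := exists_quadratic hgr hmax
    apply hQ0
    refine eq_zero_of_lie_constField hQ2 fun v ↦
      eq_zero_of_lie_constField (lie_constField_mem v hQ2) fun w ↦ ?_
    have h := trivial_lie_zero I I ⟨_, cst_mem_ideal hgr hmax hne w⟩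
      ⟨_, lie_mem_left 𝕜 g I _ ⟨Q, hQ⟩ (cst_mem_ideal hgr hmax hne v)⟩
    exact congrArg (fun x : I ↦ ((x : g) : PolyVect 𝕜 d)) h
  infer_instance

include hgr hmax in
theorem killingForm_nondegenerate_of_isCoatom : (killingForm 𝕜 g).Nondegenerate :=
  have := isKilling_of_isCoatom hgr hmax
  LieAlgebra.IsKilling.killingForm_nondegenerate 𝕜 g

end

end KillingForm

end IFFT

end

noncomputable section

namespace IFFT

/-! ### The Killing form by degree, and the centre of 𝔤₀ -/

section LinearFields

open MvPolynomial (C X pderiv constantCoeff eval IsHomogeneous)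

variable {𝕜 : Type*} [RCLike 𝕜] {d : ℕ} {g : LieSubalgebra 𝕜 (PolyVect 𝕜 d)}

theorem evalAt_eq_jac_mulVec {Y : PolyVect 𝕜 d} (hY : Y ∈ coeffDeg 𝕜 d 1) (v : Fin d → 𝕜) :
    evalAt v Y = (jac Y).mulVec v := by
  funext i
  rw [evalAt_apply, comp_eq_of_linear hY, map_sum]
  exact Finset.sum_congr rfl fun j _ ↦ by rw [MvPolynomial.smul_eval, MvPolynomial.eval_X]

theorem eq_of_jac_eq {Y Z : PolyVect 𝕜 d} (hY : Y ∈ coeffDeg 𝕜 d 1) (hZ : Z ∈ coeffDeg 𝕜 d 1)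
    (h : jac Y = jac Z) : Y = Z :=
  ext_comp fun i ↦ by rw [comp_eq_of_linear hY, comp_eq_of_linear hZ, h]

theorem jac_zero : jac (0 : PolyVect 𝕜 d) = 0 := by
  ext i j; simp [jac, comp]

/-- The Jacobian matrix at the origin, as a linear map. -/
def jacL : PolyVect 𝕜 d →ₗ[𝕜] Matrix (Fin d) (Fin d) 𝕜 where
  toFun := jac
  map_add' := jac_add
  map_smul' := jac_smul

theorem jac_euler : jac (euler : PolyVect 𝕜 d) = 1 := by
  ext i j
  rw [jac, comp_euler, MvPolynomial.pderiv_X, Matrix.one_apply]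
  by_cases h : i = j
  · simp [h]
  · simp [h]

theorem jac_lie_constField_mulVec {Q : PolyVect 𝕜 d} (hQ : Q ∈ coeffDeg 𝕜 d 2) (v w : Fin d → 𝕜) :
    (jac ⁅constField v, Q⁆).mulVec w = (jac ⁅constField w, Q⁆).mulVec v := by
  have hv := lie_constField_mem v hQ
  have hw := lie_constField_mem w hQ
  rw [← evalAt_eq_jac_mulVec hv, ← evalAt_eq_jac_mulVec hw]
  apply constField_injective
  rw [← lie_linear_constField hv, ← lie_linear_constField hw, lie_constField_comm]

theorem jac_comm_of_lie_eq_zero {Y Z : PolyVect 𝕜 d} (hY : Y ∈ coeffDeg 𝕜 d 1)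
    (hZ : Z ∈ coeffDeg 𝕜 d 1) (h : ⁅Y, Z⁆ = 0) : jac Y * jac Z = jac Z * jac Y := by
  have := jac_lie hY hZ
  rw [h, jac_zero] at this
  exact (sub_eq_zero.1 this.symm).symm

/-- Write A_v for the matrix of [v, Q]. Symmetry A_v w = A_w v and commutation with z give zA_v w =
zA_w v = A_w zv = A_{zv} w. -/
theorem jac_lie_constField_mul {z Q : PolyVect 𝕜 d} (hz : z ∈ coeffDeg 𝕜 d 1)
    (hQ : Q ∈ coeffDeg 𝕜 d 2) (h : ∀ v : Fin d → 𝕜, ⁅z, ⁅constField v, Q⁆⁆ = 0) (v : Fin d → 𝕜) :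
    jac z * jac ⁅constField v, Q⁆ = jac ⁅constField ((jac z).mulVec v), Q⁆ := by
  have hcomm := fun w ↦ jac_comm_of_lie_eq_zero hz (lie_constField_mem w hQ) (h w)
  apply Matrix.toLin'.injective
  refine LinearMap.ext fun w ↦ ?_
  rw [Matrix.toLin'_apply, Matrix.toLin'_apply, jac_lie_constField_mulVec hQ (Matrix.mulVec _ _),
    Matrix.mulVec_mulVec, ← hcomm, ← Matrix.mulVec_mulVec, ← Matrix.mulVec_mulVec,
    jac_lie_constField_mulVec hQ w]

theorem IsGraded.eq_top (hgr : IsGraded g) {q : Submodule 𝕜 g}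
    (h : ∀ n, ∀ Y : g, (Y : PolyVect 𝕜 d) ∈ coeffDeg 𝕜 d n → Y ∈ q) : q = ⊤ := by
  have hle := hgr.le (p := q.map g.toSubmodule.subtype) fun n Y hY hn ↦
    ⟨⟨Y, hY⟩, h n ⟨Y, hY⟩ hn, rfl⟩
  refine eq_top_iff.2 fun Y _ ↦ ?_
  obtain ⟨Z, hZ, hZY⟩ := hle Y.2
  rwa [← show Z = Y from Subtype.ext hZY]

theorem lie_mem_h0 {Y Z : PolyVect 𝕜 d} (hY : Y ∈ g0 g) (hZ : Z ∈ g0 g) : ⁅Y, Z⁆ ∈ h0 g :=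
  Submodule.subset_span ⟨Y, hY, Z, hZ, rfl⟩

theorem mem_g0 {Y : PolyVect 𝕜 d} : Y ∈ g0 g ↔ Y ∈ g ∧ Y ∈ coeffDeg 𝕜 d 1 := Iff.rfl

/-- The inclusion of `h₀` in `g`. -/
def inclH (g : LieSubalgebra 𝕜 (PolyVect 𝕜 d)) : h0 g →ₗ⁅𝕜⁆ g where
  toFun x := ⟨x, (h0_le_g0 g x.2).1⟩
  map_add' _ _ := rfl
  map_smul' _ _ := rfl
  map_lie' := rfl

theorem coe_inclH (x : h0 g) : (inclH g x : PolyVect 𝕜 d) = x := rfl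

section

variable [FiniteDimensional 𝕜 g]

omit [FiniteDimensional 𝕜 g] in
theorem killingForm_lie (Y Z W : g) : killingForm 𝕜 g ⁅Y, Z⁆ W = killingForm 𝕜 g Y ⁅Z, W⁆ :=
  LieModule.traceForm_apply_lie_apply 𝕜 g g Y Z W

variable (hgr : IsGraded g) (hmax : IsCoatom g)

include hgr hmax

/-- Both fields are eigenvectors of ad E, with eigenvalues m - 1 and n - 1, so invariance gives (m +
n - 2)κ(Y, Z) = 0. -/
theorem killingForm_eq_zero_of_degree {m n : ℕ} {Y Z : g} (hY : (Y : PolyVect 𝕜 d) ∈ coeffDeg 𝕜 d m)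
    (hZ : (Z : PolyVect 𝕜 d) ∈ coeffDeg 𝕜 d n) (hmn : m + n ≠ 2) : killingForm 𝕜 g Y Z = 0 := by
  have hEY : ⁅eul hgr hmax, Y⁆ = ((m : 𝕜) - 1) • Y := Subtype.ext (euler_lie hY)
  have hEZ : ⁅eul hgr hmax, Z⁆ = ((n : 𝕜) - 1) • Z := Subtype.ext (euler_lie hZ)
  have h := killingForm_lie Y (eul hgr hmax) Z
  rw [← lie_skew, hEY, hEZ, map_neg, map_smul, map_smul, LinearMap.neg_apply,
    LinearMap.smul_apply, smul_eq_mul, smul_eq_mul] at h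
  have h2 : ((m : 𝕜) + n - 2) * killingForm 𝕜 g Y Z = 0 := by linear_combination -h
  refine (mul_eq_zero.1 h2).resolve_left fun h3 ↦ hmn ?_
  have h4 : ((m + n : ℕ) : 𝕜) = (2 : ℕ) := by
    push_cast
    linear_combination h3
  exact_mod_cast h4

theorem eq_zero_of_killingForm {m n : ℕ} (hmn : m + n = 2) {Y : g}
    (hY : (Y : PolyVect 𝕜 d) ∈ coeffDeg 𝕜 d m)
    (h : ∀ Z : g, (Z : PolyVect 𝕜 d) ∈ coeffDeg 𝕜 d n → killingForm 𝕜 g Y Z = 0) : Y = 0 := by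
  have htop : LinearMap.ker (killingForm 𝕜 g Y) = ⊤ := hgr.eq_top fun k Z hZ ↦ by
    by_cases hk : m + k = 2
    · obtain rfl : k = n := by omega
      exact h Z hZ
    · exact killingForm_eq_zero_of_degree hgr hmax hY hZ hk
  refine (killingForm_nondegenerate_of_isCoatom hgr hmax).1 Y fun Z ↦ ?_
  exact LinearMap.congr_fun (LinearMap.ker_eq_top.1 htop) Z

/-- The degree that could pair with m would be 2 - m < 0. -/
theorem eq_zero_of_three_le_degree {m : ℕ} (hm : 3 ≤ m) {Y : g}
    (hY : (Y : PolyVect 𝕜 d) ∈ coeffDeg 𝕜 d m) : Y = 0 := by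
  have htop : LinearMap.ker (killingForm 𝕜 g Y) = ⊤ := hgr.eq_top fun k Z hZ ↦
    killingForm_eq_zero_of_degree hgr hmax hY hZ (by omega)
  refine (killingForm_nondegenerate_of_isCoatom hgr hmax).1 Y fun Z ↦ ?_
  exact LinearMap.congr_fun (LinearMap.ker_eq_top.1 htop) Z

variable [Algebra 𝕜 ℂ] [LieAlgebra.IsSimple ℂ (ℂ ⊗[𝕜] h0 g)]

theorem exists_killingForm_inclH : ∃ s : 𝕜, s ≠ 0 ∧
    ∀ x y : h0 g, killingForm 𝕜 g (inclH g x) (inclH g y) = s * killingForm 𝕜 (h0 g) x y := by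
  have := isSimple_of_baseChange 𝕜 (h0 g)
  obtain ⟨s, hs⟩ := exists_eq_smul_killingForm
    (LieAlgebra.IsKilling.killingForm_nondegenerate 𝕜 (h0 g))
    ((killingForm 𝕜 g).compl₁₂ (inclH g : h0 g →ₗ[𝕜] g) (inclH g : h0 g →ₗ[𝕜] g))
    fun x y z ↦ by
      change killingForm 𝕜 g (inclH g ⁅x, y⁆) (inclH g z) =
        killingForm 𝕜 g (inclH g x) (inclH g ⁅y, z⁆)
      rw [LieHom.map_lie, LieHom.map_lie, killingForm_lie]
  have hs' : ∀ x y : h0 g, killingForm 𝕜 g (inclH g x) (inclH g y) =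
    s * killingForm 𝕜 (h0 g) x y := fun x y ↦ LinearMap.congr_fun₂ hs x y
  refine ⟨s, ?_, hs'⟩
  -- If s = 0, then for x, y ∈ 𝔥₀ and Z ∈ 𝔤₀, κ([x, y], Z) = κ(x, [y, Z]) = 0 because [y, Z] ∈ 𝔥₀.
  -- Nondegeneracy on degree one then makes 𝔥₀ abelian.
  rintro rfl
  refine LieAlgebra.IsSimple.non_abelian (R := 𝕜) (L := h0 g) ⟨fun x y ↦ Subtype.ext ?_⟩
  have hx := h0_le_g0 g x.2
  have hy := h0_le_g0 g y.2
  have h0 : ⁅inclH g x, inclH g y⁆ = 0 := by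
    refine eq_zero_of_killingForm hgr hmax (m := 1) (n := 1) rfl (lie_mem_coeffDeg hx.2 hy.2) ?_
    intro Z hZ
    rw [killingForm_lie]
    have := hs' x ⟨_, lie_mem_h0 hy (mem_g0.2 ⟨Z.2, hZ⟩)⟩
    rwa [zero_mul] at this
  change ((⁅inclH g x, inclH g y⁆ : g) : PolyVect 𝕜 d) = 0
  rw [h0]
  rfl

/-- Here x is the κ-orthogonal projection of Y on 𝔥₀. For Z, W in 𝔤₀, κ([Y - x, Z], W) = κ(Y - x,
[Z, W]) = 0. -/
theorem exists_sub_central {Y : PolyVect 𝕜 d} (hY : Y ∈ g0 g) :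
    ∃ x ∈ h0 g, ∀ Z ∈ g0 g, ⁅Y - x, Z⁆ = 0 := by
  have := isSimple_of_baseChange 𝕜 (h0 g)
  have hκ := LieAlgebra.IsKilling.killingForm_nondegenerate 𝕜 (h0 g)
  obtain ⟨s, hs, hs'⟩ := exists_killingForm_inclH hgr hmax
  let f : Module.Dual 𝕜 (h0 g) := (killingForm 𝕜 g ⟨Y, hY.1⟩).comp (inclH g : h0 g →ₗ[𝕜] g)
  let x : h0 g := s⁻¹ • (LinearMap.BilinForm.toDual _ hκ).symm f
  have hx : ∀ y : h0 g, killingForm 𝕜 g (inclH g x) (inclH g y) = killingForm 𝕜 g ⟨Y, hY.1⟩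
      (inclH g y) := by
    intro y
    rw [hs', map_smul, LinearMap.smul_apply, LinearMap.BilinForm.apply_toDual_symm_apply,
      smul_eq_mul, mul_inv_cancel_left₀ hs]
    rfl
  have hxg := h0_le_g0 g x.2
  refine ⟨x, x.2, fun Z hZ ↦ ?_⟩
  have h0 : ⁅(⟨Y, hY.1⟩ : g) - inclH g x, (⟨Z, hZ.1⟩ : g)⁆ = 0 := by
    refine eq_zero_of_killingForm hgr hmax (m := 1) (n := 1) rfl
      (lie_mem_coeffDeg (sub_mem hY.2 hxg.2) hZ.2) fun W hW ↦ ?_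
    rw [killingForm_lie, map_sub, LinearMap.sub_apply]
    exact sub_eq_zero.2 (hx ⟨_, lie_mem_h0 hZ (mem_g0.2 ⟨W.2, hW⟩)⟩).symm
  exact congrArg Subtype.val h0

omit [Algebra 𝕜 ℂ] [LieAlgebra.IsSimple ℂ (ℂ ⊗[𝕜] h0 g)] in
theorem jac_eq_smul_one_of_mulVec_eq {M : Matrix (Fin d) (Fin d) 𝕜}
    (hM : ∀ Y ∈ g0 g, M * jac Y = jac Y * M) {c : 𝕜} {v : Fin d → 𝕜} (hv : v ≠ 0)
    (hc : M.mulVec v = c • v) : M = c • (1 : Matrix (Fin d) (Fin d) 𝕜) := by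
  let U : Submodule 𝕜 (Fin d → 𝕜) := Module.End.eigenspace (Matrix.toLin' M) c
  have hU : ∀ w, w ∈ U ↔ M.mulVec w = c • w := fun w ↦ by
    rw [Module.End.mem_eigenspace_iff, Matrix.toLin'_apply]
  have htop : U = ⊤ := by
    refine (eq_bot_or_eq_top_of_stable hgr hmax fun Y hY hY1 w hw ↦ ?_).resolve_left fun h ↦
      hv ((Submodule.eq_bot_iff _).1 h v ((hU v).2 hc))
    rw [hU] at hw ⊢
    rw [evalAt_eq_jac_mulVec hY1, Matrix.mulVec_mulVec, hM Y ⟨hY, hY1⟩, ← Matrix.mulVec_mulVec, hw,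
      Matrix.mulVec_smul]
  apply Matrix.toLin'.injective
  ext1 w
  refine LinearMap.ext fun t ↦ ?_
  have := (hU (Pi.single w t)).1 (htop ▸ Submodule.mem_top)
  simpa [Matrix.toLin'_apply, Matrix.smul_mulVec] using this

/-- No nonzero vector is killed by `h₀`. -/
theorem exists_jac_mulVec_ne_zero {q : Fin d → 𝕜} (hq : q ≠ 0) :
    ∃ x ∈ h0 g, (jac x).mulVec q ≠ 0 := by
  by_contra! hcon
  let U : Submodule 𝕜 (Fin d → 𝕜) :=
    { carrier := {q | ∀ x ∈ h0 g, (jac x).mulVec q = 0}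
      add_mem' := fun hv hw x hx ↦ by rw [Matrix.mulVec_add, hv x hx, hw x hx, add_zero]
      zero_mem' := fun _ _ ↦ Matrix.mulVec_zero _
      smul_mem' := fun c v hv x hx ↦ by rw [Matrix.mulVec_smul, hv x hx, smul_zero] }
  have htop : U = ⊤ := by
    refine (eq_bot_or_eq_top_of_stable hgr hmax (U := U) fun Y hY hY1 w hw x hx ↦ ?_).resolve_left
      fun h ↦ hq ((Submodule.eq_bot_iff _).1 h q hcon)
    have hx0 := h0_le_g0 g hx
    have h1 := hw _ (lie_mem_h0 ⟨hY, hY1⟩ hx0)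
    rwa [jac_lie hY1 hx0.2, Matrix.sub_mulVec, ← Matrix.mulVec_mulVec, ← Matrix.mulVec_mulVec,
      hw x hx, Matrix.mulVec_zero, sub_zero, ← evalAt_eq_jac_mulVec hY1] at h1
  have := isSimple_of_baseChange 𝕜 (h0 g)
  have := LieAlgebra.IsSimple.nontrivial 𝕜 (h0 g)
  obtain ⟨a, ha⟩ := exists_ne (0 : h0 g)
  refine ha (Subtype.ext (eq_of_jac_eq (h0_le_g0 g a.2).2 (zero_mem _)
    (Matrix.mulVec_injective (funext fun w ↦ ?_))))
  have hw : w ∈ U := htop ▸ Submodule.mem_top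
  rw [hw a a.2, show ((0 : h0 g) : PolyVect 𝕜 d) = 0 from rfl, jac_zero, Matrix.zero_mulVec]

/-- By Schur's lemma it suffices to find one eigenvector of the matrix z over 𝕜, which is not
automatic when 𝕜 = ℝ. The elements x of 𝔥₀ whose matrix product zx is still in 𝔤₀ form an ideal J of
𝔥₀, so J is zero or everything. The first case contradicts the existence of a quadratic field; in
the second, multiplication by z is an endomorphism of the adjoint module of 𝔥₀, hence a scalar by
absolute simplicity. -/
theorem eq_smul_euler_of_central {z : PolyVect 𝕜 d} (hz : z ∈ g0 g)
    (hc : ∀ Y ∈ g0 g, ⁅z, Y⁆ = 0) : ∃ c : 𝕜, z = c • euler := by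
  have := isSimple_of_baseChange 𝕜 (h0 g)
  have hM : ∀ Y ∈ g0 g, jac z * jac Y = jac Y * jac z := fun Y hY ↦
    jac_comm_of_lie_eq_zero hz.2 hY.2 (hc Y hY)
  obtain ⟨a, ha⟩ : ∃ a : h0 g, a ≠ 0 :=
    have := LieAlgebra.IsSimple.nontrivial 𝕜 (h0 g)
    exists_ne 0
  have hh0 : ∀ x : h0 g, (x : PolyVect 𝕜 d) ∈ g0 g := fun x ↦ h0_le_g0 g x.2
  have hbr : ∀ k y y' : PolyVect 𝕜 d, k ∈ g0 g → y ∈ g0 g → y' ∈ g0 g → jac y' = jac z * jac y →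
      jac ⁅k, y'⁆ = jac z * jac ⁅k, y⁆ := by
    intro k y y' hk hy hy' h
    rw [jac_lie hk.2 hy'.2, jac_lie hk.2 hy.2, h, mul_sub, mul_assoc, ← mul_assoc (jac k),
      ← hM k hk, mul_assoc]
  let J : LieIdeal 𝕜 (h0 g) :=
    { carrier := {x | ∃ y ∈ g0 g, jac y = jac z * jac (x : PolyVect 𝕜 d)}
      add_mem' := by
        rintro x x' ⟨y, hy, h⟩ ⟨y', hy', h'⟩
        exact ⟨y + y', add_mem hy hy', by
          rw [jac_add, h, h', ← mul_add, ← jac_add]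
          rfl⟩
      zero_mem' := ⟨0, zero_mem _, by
        rw [jac_zero, show ((0 : h0 g) : PolyVect 𝕜 d) = 0 from rfl, jac_zero, mul_zero]⟩
      smul_mem' := by
        rintro c x ⟨y, hy, h⟩
        exact ⟨c • y, (g0 g).smul_mem c hy, by
          rw [jac_smul, h, ← mul_smul_comm, ← jac_smul]
          rfl⟩
      lie_mem := by
        rintro k x ⟨y, hy, h⟩
        exact ⟨⁅(k : PolyVect 𝕜 d), y⁆, (g0 g).lie_mem (hh0 k) hy, hbr _ _ _ (hh0 k) (hh0 x) hy h⟩ }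
  suffices hscal : ∃ (c : 𝕜) (v : Fin d → 𝕜), v ≠ 0 ∧ (jac z).mulVec v = c • v by
    obtain ⟨c, v, hv, hcv⟩ := hscal
    refine ⟨c, eq_of_jac_eq hz.2 (Submodule.smul_mem _ c euler_mem) ?_⟩
    rw [jac_smul, jac_euler]
    exact jac_eq_smul_one_of_mulVec_eq hgr hmax hM hv hcv
  obtain hJ | hJ := LieAlgebra.IsSimple.eq_bot_or_eq_top (R := 𝕜) J
  · exfalso
    -- If zY ∈ 𝔤₀, the 𝔥₀-component x of Y satisfies [k, x] = [k, Y] ∈ J = 0 for all k ∈ 𝔥₀. So x =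
    -- 0, and Y is central.
    have hcen : ∀ Y ∈ g0 g, (∃ Y' ∈ g0 g, jac Y' = jac z * jac Y) → ∀ Z ∈ g0 g, ⁅Y, Z⁆ = 0 := by
      rintro Y hY ⟨Y', hY', hjac⟩ Z hZ
      obtain ⟨x, hx, hxc⟩ := exists_sub_central hgr hmax hY
      have hkx : ∀ k : h0 g, ⁅k, (⟨x, hx⟩ : h0 g)⁆ = 0 := by
        intro k
        have h1 : ⁅(k : PolyVect 𝕜 d), Y⁆ = ⁅(k : PolyVect 𝕜 d), x⁆ := by
          have := hxc k (hh0 k)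
          rw [← lie_skew, neg_eq_zero, lie_sub] at this
          exact sub_eq_zero.1 this
        have h2 : ⁅k, (⟨x, hx⟩ : h0 g)⁆ ∈ J :=
          ⟨⁅(k : PolyVect 𝕜 d), Y'⁆, (g0 g).lie_mem (hh0 k) hY', by
            rw [hbr _ _ _ (hh0 k) hY hY' hjac, h1]
            rfl⟩
        rwa [hJ, LieSubmodule.mem_bot] at h2
      have hx0 : (⟨x, hx⟩ : h0 g) = 0 := by
        have hx' : (⟨x, hx⟩ : h0 g) ∈ LieAlgebra.center 𝕜 (h0 g) :=
          (LieModule.mem_maxTrivSubmodule 𝕜 (h0 g) (h0 g) _).2 hkx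
        rwa [LieAlgebra.center_eq_bot, LieSubmodule.mem_bot] at hx'
      have := hxc Z hZ
      rwa [show x = 0 from congrArg Subtype.val hx0, sub_zero] at this
    obtain ⟨Q, hQ, hQ2, hQ0⟩ := exists_quadratic hgr hmax
    have hA : ∀ v : Fin d → 𝕜, ⁅constField v, Q⁆ ∈ g0 g := fun v ↦
      ⟨g.lie_mem (constField_mem_of_isCoatom hgr hmax v) hQ, lie_constField_mem v hQ2⟩
    have hAc : ∀ v : Fin d → 𝕜, ∀ Z ∈ g0 g,
        jac ⁅constField v, Q⁆ * jac Z = jac Z * jac ⁅constField v, Q⁆ := fun v Z hZ ↦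
      jac_comm_of_lie_eq_zero (hA v).2 hZ.2 (hcen _ (hA v) ⟨_, hA ((jac z).mulVec v),
        (jac_lie_constField_mul hz.2 hQ2 (fun v ↦ hc _ (hA v)) v).symm⟩ Z hZ)
    -- Since zA_v = A_{zv} is in 𝔤₀, every A_v is central in 𝔤₀. The symmetric map B(v, w) = A_v w
    -- is then 𝔤₀-linear in each variable separately. Hence YZB(v, w) and ZYB(v, w) both equal B(Zv,
    -- Yw), and 𝔥₀ kills the image of B, which must vanish.
    have hB : ∀ v w : Fin d → 𝕜, ∀ Z ∈ g0 g, (jac ⁅constField ((jac Z).mulVec v), Q⁆).mulVec w =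
        (jac Z).mulVec ((jac ⁅constField v, Q⁆).mulVec w) := by
      intro v w Z hZ
      rw [jac_lie_constField_mulVec hQ2 _ w, jac_lie_constField_mulVec hQ2 v w,
        Matrix.mulVec_mulVec, hAc w Z hZ, Matrix.mulVec_mulVec]
    have hB' : ∀ v w : Fin d → 𝕜, ∀ Z ∈ g0 g, (jac ⁅constField v, Q⁆).mulVec ((jac Z).mulVec w) =
        (jac Z).mulVec ((jac ⁅constField v, Q⁆).mulVec w) := by
      intro v w Z hZ
      rw [Matrix.mulVec_mulVec, hAc v Z hZ, Matrix.mulVec_mulVec]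
    have hkill : ∀ x ∈ h0 g, ∀ v w : Fin d → 𝕜, (jac x).mulVec
        ((jac ⁅constField v, Q⁆).mulVec w) = 0 := by
      intro x hx v w
      have hx' : x ∈ Submodule.span 𝕜 {Z | ∃ X ∈ g0 g, ∃ Y ∈ g0 g, ⁅X, Y⁆ = Z} := hx
      clear hx
      induction hx' using Submodule.span_induction with
      | mem x hx =>
        obtain ⟨Y, hY, Z, hZ, rfl⟩ := hx
        rw [jac_lie hY.2 hZ.2, Matrix.sub_mulVec, ← Matrix.mulVec_mulVec, ← Matrix.mulVec_mulVec,
          sub_eq_zero, ← hB' v w Y hY, ← hB _ _ _ hZ, ← hB v w Z hZ, ← hB' _ _ _ hY]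
      | zero => rw [jac_zero, Matrix.zero_mulVec]
      | add x y _ _ hx hy => rw [jac_add, Matrix.add_mulVec, hx, hy, add_zero]
      | smul c x _ hx => rw [jac_smul, Matrix.smul_mulVec, hx, smul_zero]
    apply hQ0
    refine eq_zero_of_lie_constField hQ2 fun v ↦ eq_of_jac_eq (lie_constField_mem v hQ2)
      (zero_mem _) ?_
    rw [jac_zero]
    by_contra hne
    obtain ⟨w, hw⟩ : ∃ w, (jac ⁅constField v, Q⁆).mulVec w ≠ 0 := by
      by_contra! hcon
      exact hne (Matrix.mulVec_injective (funext fun w ↦ by rw [hcon, Matrix.zero_mulVec]))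
    obtain ⟨x, hx, hx'⟩ := exists_jac_mulVec_ne_zero hgr hmax hw
    exact hx' (hkill x hx v w)
  · have hex : ∀ x : h0 g, ∃ y : h0 g,
        jac (y : PolyVect 𝕜 d) = jac z * jac (x : PolyVect 𝕜 d) := by
      -- By perfectness, multiplication by z sends 𝔥₀ not merely into 𝔤₀ but into 𝔥₀.
      let p : Submodule 𝕜 (h0 g) := ((h0 g).toSubmodule.map jacL).comap
        (LinearMap.mulLeft 𝕜 (jac z) ∘ₗ jacL ∘ₗ (h0 g).toSubmodule.subtype)
      have hp : p = ⊤ := eq_top_of_lie_mem p fun k x ↦ by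
        obtain ⟨y, hy, hyx⟩ : x ∈ J := hJ ▸ LieSubmodule.mem_top _
        exact ⟨_, lie_mem_h0 (hh0 k) hy, hbr _ _ _ (hh0 k) (hh0 x) hy hyx⟩
      intro x
      obtain ⟨y, hy, hyx⟩ : x ∈ p := hp ▸ Submodule.mem_top
      exact ⟨⟨y, hy⟩, hyx⟩
    choose f hf using hex
    have hinj : ∀ x y : h0 g, jac (x : PolyVect 𝕜 d) = jac (y : PolyVect 𝕜 d) → x = y :=
      fun x y h ↦ Subtype.ext (eq_of_jac_eq (hh0 x).2 (hh0 y).2 h)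
    let F : h0 g →ₗ[𝕜] h0 g :=
      { toFun := f
        map_add' := fun x y ↦ hinj _ _ <| by
          change _ = jac ((f x : PolyVect 𝕜 d) + (f y : PolyVect 𝕜 d))
          rw [hf, jac_add, hf, hf, ← mul_add, ← jac_add]
          rfl
        map_smul' := fun c x ↦ hinj _ _ <| by
          change _ = jac (c • (f x : PolyVect 𝕜 d))
          rw [hf, jac_smul, hf, ← mul_smul_comm, ← jac_smul]
          rfl }
    obtain ⟨c, hcF⟩ := exists_smul_of_commutes F fun x y ↦ hinj _ _ <| by
      change jac (f ⁅x, y⁆ : PolyVect 𝕜 d) = jac ⁅(x : PolyVect 𝕜 d), (f y : PolyVect 𝕜 d)⁆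
      rw [hbr _ _ _ (hh0 x) (hh0 y) (hh0 (f y)) (hf y), hf]
      rfl
    obtain ⟨w, hw⟩ : ∃ w, (jac (a : PolyVect 𝕜 d)).mulVec w ≠ 0 := by
      by_contra! hcon
      refine ha (hinj _ _ (Matrix.mulVec_injective (funext fun w ↦ ?_)))
      rw [hcon, show ((0 : h0 g) : PolyVect 𝕜 d) = 0 from rfl, jac_zero, Matrix.zero_mulVec]
    refine ⟨c, _, hw, ?_⟩
    have h1 : jac (f a : PolyVect 𝕜 d) = c • jac (a : PolyVect 𝕜 d) := by
      rw [show f a = c • a from hcF a, ← jac_smul]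
      rfl
    rw [Matrix.mulVec_mulVec, ← hf, h1, Matrix.smul_mulVec]

end

end LinearFields

end IFFT

end

noncomputable section

namespace IFFT

/-! ### The quadratic fields dual to the constants -/

section DualFamily

open MvPolynomial (C X pderiv constantCoeff eval IsHomogeneous)

variable {𝕜 : Type*} [RCLike 𝕜] {d : ℕ} {g : LieSubalgebra 𝕜 (PolyVect 𝕜 d)}

theorem euler_apply_monomial (m : Fin d →₀ ℕ) (a : 𝕜) :
    (euler : PolyVect 𝕜 d) (MvPolynomial.monomial m a) =
      (m.degree : 𝕜) • MvPolynomial.monomial m a :=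
  euler_apply (MvPolynomial.isHomogeneous_monomial a rfl)

theorem coeff_euler_apply (p : MvPolynomial (Fin d) 𝕜) (m : Fin d →₀ ℕ) :
    MvPolynomial.coeff m ((euler : PolyVect 𝕜 d) p) = m.degree * MvPolynomial.coeff m p := by
  induction p using MvPolynomial.induction_on' with
  | monomial n a =>
    rw [euler_apply_monomial, MvPolynomial.coeff_smul, smul_eq_mul, MvPolynomial.coeff_monomial]
    split_ifs with h
    · rw [h]
    · rw [mul_zero, mul_zero]
  | add p q hp hq => rw [map_add, MvPolynomial.coeff_add, MvPolynomial.coeff_add, hp, hq, mul_add]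

theorem mem_coeffDeg_of_euler_lie {Y : PolyVect 𝕜 d} {n : ℕ}
    (h : ⁅(euler : PolyVect 𝕜 d), Y⁆ = ((n : 𝕜) - 1) • Y) : Y ∈ coeffDeg 𝕜 d n := by
  intro i m hm
  have h1 := congrArg (fun Z ↦ MvPolynomial.coeff m (comp Z i)) h
  simp only [comp_lie, comp_smul, comp_euler, MvPolynomial.coeff_sub, coeff_euler_apply,
    MvPolynomial.coeff_smul, smul_eq_mul] at h1
  have h2 : ((m.degree : 𝕜) - n) * MvPolynomial.coeff m (comp Y i) = 0 := by
    change _ - MvPolynomial.coeff m (comp Y i) = _ at h1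
    linear_combination h1
  have h3 : (m.degree : 𝕜) = n := sub_eq_zero.1 ((mul_eq_zero.1 h2).resolve_right hm)
  rw [show Finsupp.weight (1 : Fin d → ℕ) m = m.degree from
    (DFunLike.congr_fun Finsupp.degree_eq_weight_one m).symm]
  exact_mod_cast h3

theorem evalAt_zero_euler_lie (Y : PolyVect 𝕜 d) :
    evalAt 0 ⁅(euler : PolyVect 𝕜 d), Y⁆ = -evalAt 0 Y := by
  funext i
  rw [evalAt_apply, comp_lie, map_sub, eval_apply, evalAt_euler, map_zero, comp_euler, Pi.neg_apply,
    evalAt_apply]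
  simp [comp]

theorem trace_jac_h0 {x : PolyVect 𝕜 d} (hx : x ∈ h0 g) : (jac x).trace = 0 := by
  have hx' : x ∈ Submodule.span 𝕜 {Z | ∃ X ∈ g0 g, ∃ Y ∈ g0 g, ⁅X, Y⁆ = Z} := hx
  clear hx
  induction hx' using Submodule.span_induction with
  | mem x hx =>
    obtain ⟨Y, hY, Z, hZ, rfl⟩ := hx
    rw [jac_lie hY.2 hZ.2, Matrix.trace_sub, Matrix.trace_mul_comm, sub_self]
  | zero => rw [jac_zero, Matrix.trace_zero]
  | add x y _ _ hx hy => rw [jac_add, Matrix.trace_add, hx, hy, add_zero]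
  | smul c x _ hx => rw [jac_smul, Matrix.trace_smul, hx, smul_zero]

theorem lie_cst_of_linear {Y : PolyVect 𝕜 d} (hY : Y ∈ coeffDeg 𝕜 d 1) (v : Fin d → 𝕜) :
    ⁅Y, constField v⁆ = -constField ((jac Y).mulVec v) := by
  rw [← lie_skew, lie_linear_constField hY, evalAt_eq_jac_mulVec hY]

variable [FiniteDimensional 𝕜 g] (hgr : IsGraded g) (hmax : IsCoatom g)

include hgr hmax in
-- The field εᵢ represents, through κ, the linear form "i-th coordinate of the value at 0".
theorem exists_dual_constFields : ∃ ε : Fin d → g,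
    ∀ Y i, killingForm 𝕜 g Y (ε i) = evalAt 0 (Y : PolyVect 𝕜 d) i := by
  have hβ := killingForm_nondegenerate_of_isCoatom hgr hmax
  refine ⟨fun i ↦ (LinearMap.BilinForm.toDual _ hβ).symm
    (LinearMap.proj i ∘ₗ evalAt 0 ∘ₗ g.toSubmodule.subtype), fun Y i ↦ ?_⟩
  rw [LieModule.traceForm_comm, LinearMap.BilinForm.apply_toDual_symm_apply]
  rfl

variable {ε : Fin d → g}
  (hε : ∀ Y i, killingForm 𝕜 g Y (ε i) = evalAt 0 (Y : PolyVect 𝕜 d) i)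

include hgr hmax hε

/-- Bracketing with E changes the sign of the value at 0, so invariance gives [E, εᵢ] = εᵢ, which
characterizes degree two. -/
theorem dual_constFields_mem (i : Fin d) : (ε i : PolyVect 𝕜 d) ∈ coeffDeg 𝕜 d 2 := by
  refine mem_coeffDeg_of_euler_lie ?_
  have h : ⁅eul hgr hmax, ε i⁆ - ε i = 0 := by
    refine (killingForm_nondegenerate_of_isCoatom hgr hmax).2 _ fun Y ↦ ?_
    rw [map_sub, ← killingForm_lie, hε, hε, ← lie_skew]
    change evalAt 0 (-⁅(euler : PolyVect 𝕜 d), (Y : PolyVect 𝕜 d)⁆) i - _ = 0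
    rw [map_neg, evalAt_zero_euler_lie, neg_neg, sub_self]
  have h1 : ⁅(euler : PolyVect 𝕜 d), (ε i : PolyVect 𝕜 d)⁆ = ε i := congrArg Subtype.val (sub_eq_zero.1 h)
  rw [h1]
  norm_num

theorem killingForm_cst_dual (v : Fin d → 𝕜) (i : Fin d) :
    killingForm 𝕜 g (cst hgr hmax v) (ε i) = v i := by
  rw [hε, coe_cst, evalAt_constField]

variable [Algebra 𝕜 ℂ] [LieAlgebra.IsSimple ℂ (ℂ ⊗[𝕜] h0 g)]

omit hε in
theorem exists_h0_add_euler {Y : g} (hY : (Y : PolyVect 𝕜 d) ∈ coeffDeg 𝕜 d 1) :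
    ∃ (x : h0 g) (c : 𝕜), Y = inclH g x + c • eul hgr hmax := by
  obtain ⟨x, hx, hc⟩ := exists_sub_central hgr hmax (mem_g0.2 ⟨Y.2, hY⟩)
  obtain ⟨c, hc⟩ := eq_smul_euler_of_central hgr hmax
    (sub_mem (mem_g0.2 ⟨Y.2, hY⟩) (mem_g0.2 (h0_le_g0 g hx))) hc
  exact ⟨⟨x, hx⟩, c, Subtype.ext (sub_eq_iff_eq_add'.1 hc)⟩

omit hε [Algebra 𝕜 ℂ] [LieAlgebra.IsSimple ℂ (ℂ ⊗[𝕜] h0 g)] in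
theorem euler_lie_linear {Y : g} (hY : (Y : PolyVect 𝕜 d) ∈ coeffDeg 𝕜 d 1) :
    ⁅eul hgr hmax, Y⁆ = 0 := Subtype.ext <| by
  change ⁅(euler : PolyVect 𝕜 d), (Y : PolyVect 𝕜 d)⁆ = 0
  rw [euler_lie hY, Nat.cast_one, sub_self, zero_smul]

omit hε in
-- E commutes with 𝔤₀ and 𝔥₀ is perfect: κ([x, y], E) = κ(x, [y, E]) = 0.
theorem killingForm_inclH_euler (x : h0 g) :
    killingForm 𝕜 g (inclH g x) (eul hgr hmax) = 0 := by
  have := isSimple_of_baseChange 𝕜 (h0 g)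
  have htop := eq_top_of_lie_mem (LinearMap.ker
    ((killingForm 𝕜 g).flip (eul hgr hmax) ∘ₗ (inclH g : h0 g →ₗ[𝕜] g))) fun x y ↦ by
      change killingForm 𝕜 g (inclH g ⁅x, y⁆) (eul hgr hmax) = 0
      rw [LieHom.map_lie, killingForm_lie, ← lie_skew,
        euler_lie_linear hgr hmax (h0_le_g0 g y.2).2, neg_zero, map_zero]
  exact LinearMap.congr_fun (LinearMap.ker_eq_top.1 htop) x

omit hε in
theorem killingForm_euler_ne_zero : killingForm 𝕜 g (eul hgr hmax) (eul hgr hmax) ≠ 0 := by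
  intro h0
  have hE : eul hgr hmax = 0 := by
    refine eq_zero_of_killingForm hgr hmax (m := 1) (n := 1) rfl euler_mem fun Z hZ ↦ ?_
    obtain ⟨x, c, rfl⟩ := exists_h0_add_euler hgr hmax hZ
    rw [map_add, map_smul, h0, smul_zero, LieModule.traceForm_comm, killingForm_inclH_euler, add_zero]
  have h1 := congrArg (fun Y : g ↦ jac (Y : PolyVect 𝕜 d) ⟨0, dim_pos hmax⟩ ⟨0, dim_pos hmax⟩) hE
  change jac (euler : PolyVect 𝕜 d) _ _ = jac (0 : PolyVect 𝕜 d) _ _ at h1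
  rw [jac_euler, jac_zero] at h1
  simp at h1

end DualFamily

end IFFT

end

noncomputable section

namespace IFFT

/-! ### An explicit dual pair for 𝔤 and the constants 2d, s and -1/2 -/

section DualFamilyOfKillingForm

variable {𝕜 : Type*} [RCLike 𝕜] {d : ℕ} {g : LieSubalgebra 𝕜 (PolyVect 𝕜 d)}
  [FiniteDimensional 𝕜 g] (hgr : IsGraded g) (hmax : IsCoatom g) {κ : Type*}

/-- The family consisting of the constant fields, their duals, the Euler field and a family in
`h₀`. -/
def famL (ε : Fin d → g) (u : κ → h0 g) : Fin d ⊕ Fin d ⊕ Unit ⊕ κ → g :=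
  Sum.elim (fun i ↦ cst hgr hmax (Pi.single i 1))
    (Sum.elim ε (Sum.elim (fun _ ↦ eul hgr hmax) fun k ↦ inclH g (u k)))

/-- The family dual to `famL`. -/
def famR (ε : Fin d → g) (b s : 𝕜) (w : κ → h0 g) : Fin d ⊕ Fin d ⊕ Unit ⊕ κ → g :=
  Sum.elim ε (Sum.elim (fun i ↦ cst hgr hmax (Pi.single i 1))
    (Sum.elim (fun _ ↦ b⁻¹ • eul hgr hmax) fun k ↦ s⁻¹ • inclH g (w k)))

theorem sum_famL_famR [Fintype κ] {N : Type*} [AddCommGroup N] [Module 𝕜 N] (f : g →ₗ[𝕜] g →ₗ[𝕜] N)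
    (ε : Fin d → g) (b s : 𝕜) (u w : κ → h0 g) :
    ∑ i, f (famL hgr hmax ε u i) (famR hgr hmax ε b s w i) =
      ∑ i, f (cst hgr hmax (Pi.single i 1)) (ε i) + (∑ i, f (ε i) (cst hgr hmax (Pi.single i 1)) +
        (b⁻¹ • f (eul hgr hmax) (eul hgr hmax) +
          s⁻¹ • ∑ k, f (inclH g (u k)) (inclH g (w k)))) := by
  simp only [Fintype.sum_sum_type, famL, famR, Sum.elim_inl, Sum.elim_inr, map_smul,
    Finset.univ_unique, Finset.sum_singleton, Finset.smul_sum]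

variable {ε : Fin d → g}
  (hε : ∀ Y i, killingForm 𝕜 g Y (ε i) = evalAt 0 (Y : PolyVect 𝕜 d) i)
  [Algebra 𝕜 ℂ] [LieAlgebra.IsSimple ℂ (ℂ ⊗[𝕜] h0 g)] [Fintype κ]

include hε

theorem isDualPair_fam {u w : κ → h0 g} (hd : IsDualPair (killingForm 𝕜 (h0 g)) u w) {s : 𝕜}
    (hs0 : s ≠ 0) (hs : ∀ x y : h0 g,
      killingForm 𝕜 g (inclH g x) (inclH g y) = s * killingForm 𝕜 (h0 g) x y) :
    IsDualPair (killingForm 𝕜 g) (famL hgr hmax ε u)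
      (famR hgr hmax ε (killingForm 𝕜 g (eul hgr hmax) (eul hgr hmax)) s w) := by
  have hE := killingForm_euler_ne_zero hgr hmax
  set b := killingForm 𝕜 g (eul hgr hmax) (eul hgr hmax) with hb
  let F : g →ₗ[𝕜] g := ∑ i, ((killingForm 𝕜 g).flip (famR hgr hmax ε b s w i)).smulRight
    (famL hgr hmax ε u i)
  have hF : ∀ x, F x = ∑ i, killingForm 𝕜 g x (famR hgr hmax ε b s w i) • famL hgr hmax ε u i :=
    fun x ↦ by
      simp only [F, LinearMap.sum_apply, LinearMap.smulRight_apply]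
      rfl
  have hF' : ∀ x, F x = ∑ i, killingForm 𝕜 g x (ε i) • cst hgr hmax (Pi.single i 1) +
      (∑ i, killingForm 𝕜 g x (cst hgr hmax (Pi.single i 1)) • ε i +
        (killingForm 𝕜 g x (b⁻¹ • eul hgr hmax) • eul hgr hmax +
          ∑ k, killingForm 𝕜 g x (s⁻¹ • inclH g (w k)) • inclH g (u k))) := fun x ↦ by
    rw [hF]
    simp only [Fintype.sum_sum_type, famL, famR, Sum.elim_inl, Sum.elim_inr,
      Finset.univ_unique, Finset.sum_singleton]
  have hcst : ∀ i : Fin d, (cst hgr hmax (Pi.single i 1) : PolyVect 𝕜 d) ∈ coeffDeg 𝕜 d 0 :=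
    fun i ↦ constField_mem _
  have hε2 := dual_constFields_mem hgr hmax hε
  have hh1 : ∀ x : h0 g, (inclH g x : PolyVect 𝕜 d) ∈ coeffDeg 𝕜 d 1 := fun x ↦ (h0_le_g0 g x.2).2
  have h00 : ∀ {m n : ℕ} {Y Z : g}, (Y : PolyVect 𝕜 d) ∈ coeffDeg 𝕜 d m →
      (Z : PolyVect 𝕜 d) ∈ coeffDeg 𝕜 d n → m + n ≠ 2 → killingForm 𝕜 g Y Z = 0 :=
    fun hY hZ hmn ↦ killingForm_eq_zero_of_degree hgr hmax hY hZ hmn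
  have hEE : ((eul hgr hmax : g) : PolyVect 𝕜 d) ∈ coeffDeg 𝕜 d 1 := euler_mem
  suffices htop : LinearMap.eqLocus F LinearMap.id = ⊤ by
    intro x
    rw [← hF]
    exact (htop ▸ Submodule.mem_top : x ∈ LinearMap.eqLocus F LinearMap.id)
  -- The reproducing identity is checked degree by degree, where most pairings vanish. In degree two
  -- it is verified by pairing both sides with the constants.
  refine hgr.eq_top fun n Y hY ↦ ?_
  rw [LinearMap.mem_eqLocus, LinearMap.id_apply, hF']
  match n with
  | 0 =>
    have h1 : ∀ i, killingForm 𝕜 g Y (cst hgr hmax (Pi.single i 1)) = 0 := fun i ↦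
      h00 hY (hcst i) (by norm_num)
    have h2 : killingForm 𝕜 g Y (eul hgr hmax) = 0 := h00 hY hEE (by norm_num)
    have h3 : ∀ x, killingForm 𝕜 g Y (inclH g x) = 0 := fun x ↦ h00 hY (hh1 x) (by norm_num)
    simp only [map_smul, h1, h2, h3, smul_zero, zero_smul, Finset.sum_const_zero, add_zero, hε]
    simp only [← map_smul, ← map_sum]
    refine Subtype.ext ?_
    rw [coe_cst]
    conv_rhs => rw [eq_constField hY 0]
    congr 1
    simp [← Pi.single_smul, Finset.univ_sum_single]
  | 1 =>
    have h1 : ∀ i, killingForm 𝕜 g Y (cst hgr hmax (Pi.single i 1)) = 0 := fun i ↦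
      h00 hY (hcst i) (by norm_num)
    have h2 : ∀ i, killingForm 𝕜 g Y (ε i) = 0 := fun i ↦ h00 hY (hε2 i) (by norm_num)
    simp only [h1, h2, zero_smul, Finset.sum_const_zero, zero_add]
    obtain ⟨x, c, rfl⟩ := exists_h0_add_euler hgr hmax hY
    have h3 : ∀ y, killingForm 𝕜 g (eul hgr hmax) (inclH g y) = 0 := fun y ↦ by
      rw [LieModule.traceForm_comm, killingForm_inclH_euler]
    simp only [map_add, map_smul, LinearMap.add_apply, LinearMap.smul_apply, h3,
      killingForm_inclH_euler, hs, ← hb, mul_zero, add_zero, zero_add, smul_eq_mul]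
    rw [add_comm]
    congr 1
    · conv_rhs => rw [← hd x, map_sum]
      refine Finset.sum_congr rfl fun k _ ↦ ?_
      rw [inv_mul_cancel_left₀ hs0, map_smul]
    · rw [mul_comm c, inv_mul_cancel_left₀ hE]
  | 2 =>
    have h1 : ∀ i, killingForm 𝕜 g Y (ε i) = 0 := fun i ↦ h00 hY (hε2 i) (by norm_num)
    have h2 : killingForm 𝕜 g Y (eul hgr hmax) = 0 := h00 hY hEE (by norm_num)
    have h3 : ∀ x, killingForm 𝕜 g Y (inclH g x) = 0 := fun x ↦ h00 hY (hh1 x) (by norm_num)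
    simp only [map_smul, h1, h2, h3, smul_zero, zero_smul, Finset.sum_const_zero, add_zero,
      zero_add]
    rw [← sub_eq_zero]
    refine eq_zero_of_killingForm hgr hmax (m := 2) (n := 0) rfl (sub_mem ?_ hY) fun Z hZ ↦ ?_
    · change g.toSubmodule.subtype _ ∈ _
      rw [map_sum]
      exact sum_mem fun i _ ↦ Submodule.smul_mem _ _ (hε2 i)
    · have hZc : Z = ∑ i, evalAt 0 (Z : PolyVect 𝕜 d) i • cst hgr hmax (Pi.single i 1) := by
        simp only [← map_smul, ← map_sum]
        refine Subtype.ext ?_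
        rw [coe_cst]
        conv_lhs => rw [eq_constField hZ 0]
        congr 1
        simp [← Pi.single_smul, Finset.univ_sum_single]
      rw [map_sub, LinearMap.sub_apply, sub_eq_zero]
      conv_rhs => rw [hZc]
      simp only [map_sum, map_smul, LinearMap.sum_apply, LinearMap.smul_apply, smul_eq_mul]
      refine Finset.sum_congr rfl fun i _ ↦ ?_
      rw [LieModule.traceForm_comm 𝕜 g g (ε i), hε, mul_comm]
  | n + 3 =>
    rw [eq_zero_of_three_le_degree hgr hmax (by omega) hY]
    simp

/-- (ad E)² is the identity on 𝔤₋₁ and on 𝔤₁, each of dimension d, and zero on 𝔤₀. -/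
theorem killingForm_euler : killingForm 𝕜 g (eul hgr hmax) (eul hgr hmax) = 2 * d := by
  have := isSimple_of_baseChange 𝕜 (h0 g)
  obtain ⟨u, w, hd⟩ := exists_isDualPair (killingForm 𝕜 (h0 g))
    (LieAlgebra.IsKilling.killingForm_nondegenerate 𝕜 (h0 g))
  obtain ⟨s, hs0, hs⟩ := exists_killingForm_inclH hgr hmax
  have hD := isDualPair_fam hgr hmax hε hd hs0 hs
  have h1 := hD.trace_eq (LieAlgebra.ad 𝕜 g (eul hgr hmax) ∘ₗ LieAlgebra.ad 𝕜 g (eul hgr hmax))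
  rw [killingForm_apply_apply, h1]
  have h2 := sum_famL_famR hgr hmax ((killingForm 𝕜 g) ∘ₗ (LieAlgebra.ad 𝕜 g (eul hgr hmax) ∘ₗ
    LieAlgebra.ad 𝕜 g (eul hgr hmax))) ε (killingForm 𝕜 g (eul hgr hmax) (eul hgr hmax)) s u w
  refine h2.trans ?_
  have hc : ∀ v : Fin d → 𝕜, ⁅eul hgr hmax, cst hgr hmax v⁆ = -cst hgr hmax v := fun v ↦ by
    refine Subtype.ext ((euler_lie (constField_mem v)).trans ?_)
    change _ = -constField v
    rw [← map_smul, ← map_neg]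
    congr 1
    simp
  have hq : ∀ i, ⁅eul hgr hmax, ε i⁆ = ε i := fun i ↦ by
    refine Subtype.ext ((euler_lie (dual_constFields_mem hgr hmax hε i)).trans ?_)
    norm_num
  have hl : ∀ x : h0 g, ⁅eul hgr hmax, inclH g x⁆ = 0 := fun x ↦
    euler_lie_linear hgr hmax (h0_le_g0 g x.2).2
  simp only [LinearMap.comp_apply, LieAlgebra.ad_apply, hc, hq, hl, lie_neg, neg_neg, lie_self,
    map_zero, LinearMap.zero_apply, smul_zero, Finset.sum_const_zero, add_zero,
    LieModule.traceForm_comm 𝕜 g g (ε _) (cst _ _ _), killingForm_cst_dual hgr hmax hε,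
    Pi.single_eq_same, Finset.sum_const, Finset.card_univ, Fintype.card_fin]
  rw [nsmul_eq_mul]
  ring

include hgr hmax in
-- The trace of ad x ad y is split along the grading: 𝔥₀ gives its own Killing form, E gives
-- nothing, and 𝔤₋₁ and its dual 𝔤₁ each give the trace of the product of the matrices.
theorem killingForm_inclH_eq {s : 𝕜} (hs0 : s ≠ 0) (hs : ∀ x y : h0 g,
      killingForm 𝕜 g (inclH g x) (inclH g y) = s * killingForm 𝕜 (h0 g) x y) (x y : h0 g) :
    s * killingForm 𝕜 (h0 g) x y = killingForm 𝕜 (h0 g) x y +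
      2 * (jac (x : PolyVect 𝕜 d) * jac (y : PolyVect 𝕜 d)).trace := by
  have := isSimple_of_baseChange 𝕜 (h0 g)
  obtain ⟨u, w, hd⟩ := exists_isDualPair (killingForm 𝕜 (h0 g))
    (LieAlgebra.IsKilling.killingForm_nondegenerate 𝕜 (h0 g))
  have hD := isDualPair_fam hgr hmax hε hd hs0 hs
  have h1 := hD.trace_eq (LieAlgebra.ad 𝕜 g (inclH g x) ∘ₗ LieAlgebra.ad 𝕜 g (inclH g y))
  have h2 := sum_famL_famR hgr hmax ((killingForm 𝕜 g) ∘ₗ (LieAlgebra.ad 𝕜 g (inclH g x) ∘ₗ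
    LieAlgebra.ad 𝕜 g (inclH g y))) ε (killingForm 𝕜 g (eul hgr hmax) (eul hgr hmax)) s u w
  have h3 := hd.trace_eq (LieAlgebra.ad 𝕜 (h0 g) x ∘ₗ LieAlgebra.ad 𝕜 (h0 g) y)
  rw [← killingForm_apply_apply] at h1 h3
  rw [← hs, h1]
  refine h2.trans ?_
  simp only [LinearMap.comp_apply, LieAlgebra.ad_apply] at h3 ⊢
  have hc : ∀ (x : h0 g) (v : Fin d → 𝕜), ⁅inclH g x, cst hgr hmax v⁆ =
      -cst hgr hmax ((jac (x : PolyVect 𝕜 d)).mulVec v) := fun x v ↦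
    Subtype.ext (lie_cst_of_linear (h0_le_g0 g x.2).2 v)
  have hl : ⁅inclH g y, eul hgr hmax⁆ = 0 := by
    rw [← lie_skew, euler_lie_linear hgr hmax (h0_le_g0 g y.2).2, neg_zero]
  have hsw : ∀ Y Z : g, killingForm 𝕜 g ⁅inclH g x, ⁅inclH g y, Y⁆⁆ Z =
      killingForm 𝕜 g ⁅inclH g y, ⁅inclH g x, Z⁆⁆ Y := by
    intro Y Z
    rw [← lie_skew (inclH g x), map_neg, LinearMap.neg_apply, killingForm_lie,
      ← lie_skew (inclH g y), map_neg, LinearMap.neg_apply, neg_neg, killingForm_lie,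
      LieModule.traceForm_comm]
  have hm : ∀ x y : h0 g, ∑ i, killingForm 𝕜 g ⁅inclH g x, ⁅inclH g y,
      cst hgr hmax (Pi.single i 1)⁆⁆ (ε i) =
      (jac (x : PolyVect 𝕜 d) * jac (y : PolyVect 𝕜 d)).trace := by
    intro x y
    refine Finset.sum_congr rfl fun i _ ↦ ?_
    rw [hc, lie_neg, hc, neg_neg, killingForm_cst_dual hgr hmax hε, Matrix.mulVec_mulVec,
      Matrix.mulVec_single_one]
    rfl
  simp only [hsw (ε _), hm, hl, lie_zero, map_zero, LinearMap.zero_apply, smul_zero, zero_add,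
    ← LieHom.map_lie, hs]
  rw [← Finset.mul_sum, ← h3, smul_eq_mul, inv_mul_cancel_left₀ hs0, Matrix.trace_mul_comm]
  ring

/-- Both sides pair with Z = x + cE to -tr Z = -cd, since elements of 𝔥₀ are traceless and κ(E, E) =
2d. -/
theorem sum_lie_dual : ∑ i, ⁅cst hgr hmax (Pi.single i 1), ε i⁆ = (-(1 / 2 : 𝕜)) • eul hgr hmax := by
  have hε2 := dual_constFields_mem hgr hmax hε
  rw [← sub_eq_zero]
  refine eq_zero_of_killingForm hgr hmax (m := 1) (n := 1) rfl (sub_mem ?_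
    (Submodule.smul_mem _ _ euler_mem)) fun Z hZ ↦ ?_
  · change g.toSubmodule.subtype _ ∈ _
    rw [map_sum]
    exact sum_mem fun i _ ↦ lie_constField_mem _ (hε2 i)
  have h1 : ∀ Z : g, (Z : PolyVect 𝕜 d) ∈ coeffDeg 𝕜 d 1 →
      killingForm 𝕜 g (∑ i, ⁅cst hgr hmax (Pi.single i 1), ε i⁆) Z =
        -(jac (Z : PolyVect 𝕜 d)).trace := by
    intro Z hZ
    rw [map_sum, LinearMap.sum_apply, Matrix.trace, ← Finset.sum_neg_distrib]
    refine Finset.sum_congr rfl fun i _ ↦ ?_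
    rw [killingForm_lie, ← lie_skew, map_neg, ← killingForm_lie, ← lie_skew, map_neg,
      LinearMap.neg_apply, neg_neg,
      show ⁅Z, cst hgr hmax (Pi.single i 1)⁆ = -cst hgr hmax
        ((jac (Z : PolyVect 𝕜 d)).mulVec (Pi.single i 1)) from Subtype.ext (lie_cst_of_linear hZ _),
      map_neg, LinearMap.neg_apply, killingForm_cst_dual hgr hmax hε, Matrix.mulVec_single_one]
    rfl
  rw [map_sub, LinearMap.sub_apply, h1 Z hZ, map_smul, LinearMap.smul_apply, smul_eq_mul]
  obtain ⟨x, c, rfl⟩ := exists_h0_add_euler hgr hmax hZ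
  rw [map_add, map_smul, killingForm_euler hgr hmax hε, LieModule.traceForm_comm,
    killingForm_inclH_euler]
  change -(jac ((x : PolyVect 𝕜 d) + c • euler)).trace - _ = 0
  rw [jac_add, jac_smul, jac_euler, Matrix.trace_add, trace_jac_h0 x.2, Matrix.trace_smul,
    Matrix.trace_one, Fintype.card_fin, smul_eq_mul, smul_eq_mul]
  ring

end DualFamilyOfKillingForm

end IFFT

end

noncomputable section

namespace IFFT

/-! ### The module 𝔤₋₁ and the ratio s -/

section ConstantFields

variable {𝕜 : Type*} [RCLike 𝕜] {d : ℕ} {g : LieSubalgebra 𝕜 (PolyVect 𝕜 d)}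
  [FiniteDimensional 𝕜 g] (hgr : IsGraded g) (hmax : IsCoatom g)

/-- The identification of `V` with the space `g₋₁` of constant fields. -/
def constFieldEquiv : (Fin d → 𝕜) ≃ₗ[𝕜] gMinusOne g where
  toFun v := ⟨constField v, constField_mem_of_isCoatom hgr hmax v, constField_mem v⟩
  invFun Y := evalAt 0 (Y : PolyVect 𝕜 d)
  map_add' v w := Subtype.ext (map_add constField v w)
  map_smul' c v := Subtype.ext (map_smul constField c v)
  left_inv v := evalAt_constField 0 v
  right_inv Y := Subtype.ext (eq_constField Y.2.2 0).symm

instance : FiniteDimensional 𝕜 (gMinusOne g) :=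
  Submodule.finiteDimensional_of_le (S₂ := coeffDeg 𝕜 d 0) fun _ hY ↦ hY.2

include hgr hmax in
theorem finrank_gMinusOne : Module.finrank 𝕜 (gMinusOne g) = d := by
  rw [← (constFieldEquiv hgr hmax).finrank_eq, Module.finrank_fin_fun]

theorem lie_constFieldEquiv (x : h0 g) (v : Fin d → 𝕜) :
    ⁅x, constFieldEquiv hgr hmax v⁆ =
      -constFieldEquiv hgr hmax ((jac (x : PolyVect 𝕜 d)).mulVec v) :=
  Subtype.ext (lie_cst_of_linear (h0_le_g0 g x.2).2 v)

include hgr hmax in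
theorem traceForm_gMinusOne (x y : h0 g) : LieModule.traceForm 𝕜 (h0 g) (gMinusOne g) x y =
    (jac (x : PolyVect 𝕜 d) * jac (y : PolyVect 𝕜 d)).trace := by
  rw [LieModule.traceForm_apply_apply, trace_eq_sum_dual
    (fun i ↦ constFieldEquiv hgr hmax (Pi.single i 1))
    (fun i ↦ LinearMap.proj i ∘ₗ (constFieldEquiv hgr hmax).symm.toLinearMap) fun Y ↦ ?_]
  · refine Finset.sum_congr rfl fun i _ ↦ ?_
    simp only [LinearMap.comp_apply, LieModule.toEnd_apply_apply, lie_constFieldEquiv, lie_neg,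
      neg_neg, LinearEquiv.coe_coe, LinearEquiv.symm_apply_apply, LinearMap.proj_apply,
      Matrix.mulVec_single_one]
    rfl
  · simp only [← map_smul, ← map_sum]
    rw [← LinearEquiv.eq_symm_apply]
    funext j
    simp [Finset.sum_apply, Pi.single_apply]

variable [Algebra 𝕜 ℂ] [LieAlgebra.IsSimple ℂ (ℂ ⊗[𝕜] h0 g)]

include hgr hmax in
-- Since 𝔤₀ = 𝔥₀ + 𝕜E and E acts on V by scalars, a subspace stable under 𝔥₀ is stable under 𝔤₀.
theorem isIrreducible_gMinusOne : LieModule.IsIrreducible 𝕜 (h0 g) (gMinusOne g) := by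
  have hnt : Nontrivial (gMinusOne g) :=
    have : Nonempty (Fin d) := ⟨⟨0, dim_pos hmax⟩⟩
    (constFieldEquiv hgr hmax).symm.toEquiv.nontrivial
  refine LieModule.IsIrreducible.mk fun N hN ↦ ?_
  let U : Submodule 𝕜 (Fin d → 𝕜) := N.toSubmodule.comap (constFieldEquiv hgr hmax).toLinearMap
  have hU : ∀ v, v ∈ U ↔ constFieldEquiv hgr hmax v ∈ N := fun _ ↦ Iff.rfl
  have hstab : ∀ Y ∈ g, Y ∈ coeffDeg 𝕜 d 1 → ∀ v ∈ U, evalAt v Y ∈ U := by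
    intro Y hY hY1 v hv
    obtain ⟨x, c, hx⟩ := exists_h0_add_euler hgr hmax (Y := ⟨Y, hY⟩) hY1
    have hx' : Y = (x : PolyVect 𝕜 d) + c • euler := congrArg Subtype.val hx
    rw [hx', map_add, map_smul, evalAt_euler]
    refine U.add_mem ?_ (U.smul_mem c hv)
    have h1 := N.neg_mem (N.lie_mem (x := x) ((hU v).1 hv))
    rw [lie_constFieldEquiv, neg_neg] at h1
    rw [evalAt_eq_jac_mulVec (h0_le_g0 g x.2).2]
    exact h1
  rcases eq_bot_or_eq_top_of_stable hgr hmax hstab with h | h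
  · refine absurd ((LieSubmodule.eq_bot_iff N).2 fun Y hY ↦ ?_) hN
    obtain ⟨v, rfl⟩ := (constFieldEquiv hgr hmax).surjective Y
    rw [(Submodule.eq_bot_iff _).1 h v hY, map_zero]
  · refine eq_top_iff.2 fun Y _ ↦ ?_
    obtain ⟨v, rfl⟩ := (constFieldEquiv hgr hmax).surjective Y
    exact (hU v).1 (h ▸ Submodule.mem_top)

include hgr hmax in
-- Eliminates the ratio t of the trace form of 𝔤₋₁ to the Killing form of 𝔥₀ between s = 1 + 2t and
-- the trace identity rd = t dim 𝔥₀.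
theorem killingForm_ratio {κ : Type*} [Fintype κ] {u w : κ → h0 g}
    (hd : IsDualPair (killingForm 𝕜 (h0 g)) u w) {s : 𝕜} (hs0 : s ≠ 0)
    (hs : ∀ x y : h0 g,
      killingForm 𝕜 g (inclH g x) (inclH g y) = s * killingForm 𝕜 (h0 g) x y) {r : 𝕜}
    (hr : ∀ Y : gMinusOne g, casEnd 𝕜 (gMinusOne g) u w Y = r • Y) :
    s * Module.finrank 𝕜 (h0 g) = Module.finrank 𝕜 (h0 g) + 2 * r * d := by
  have := isSimple_of_baseChange 𝕜 (h0 g)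
  have hκ := LieAlgebra.IsKilling.killingForm_nondegenerate 𝕜 (h0 g)
  obtain ⟨ε, hε⟩ := exists_dual_constFields hgr hmax
  obtain ⟨t, ht⟩ := exists_eq_smul_killingForm hκ (LieModule.traceForm 𝕜 (h0 g) (gMinusOne g))
    fun x y z ↦ LieModule.traceForm_apply_lie_apply 𝕜 (h0 g) (gMinusOne g) x y z
  have h1 := trace_casEnd hd ht
  rw [show casEnd 𝕜 (gMinusOne g) u w = r • LinearMap.id from LinearMap.ext hr, map_smul,
    LinearMap.trace_id, finrank_gMinusOne hgr hmax, smul_eq_mul] at h1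
  obtain ⟨x, y, hxy⟩ : ∃ x y, killingForm 𝕜 (h0 g) x y ≠ 0 := by
    by_contra! hcon
    have := LieAlgebra.IsSimple.nontrivial 𝕜 (h0 g)
    obtain ⟨x, hx⟩ := exists_ne (0 : h0 g)
    exact hx (hκ.1 x (hcon x))
  have h2 := killingForm_inclH_eq hgr hmax hε hs0 hs x y
  rw [← traceForm_gMinusOne hgr hmax, ht, LinearMap.smul_apply, LinearMap.smul_apply,
    smul_eq_mul] at h2
  have h3 : s = 1 + 2 * t := mul_right_cancel₀ hxy (by linear_combination h2)
  rw [h3]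
  linear_combination -2 * h1

end ConstantFields

end IFFT

end

noncomputable section

namespace IFFT

/-! ### Values of Lie derivatives at a point -/

section Values

open MvPolynomial (C X pderiv constantCoeff eval IsHomogeneous)

variable {𝕜 : Type*} [RCLike 𝕜] {d : ℕ}

theorem partialFun_mul (i : Fin d) (f h : SmoothFun 𝕜 d) :
    partialFun i (f * h) = partialFun i f * h + f * partialFun i h := by
  have hf : ContDiff 𝕜 ∞ f.1 := f.2
  have hh : ContDiff 𝕜 ∞ h.1 := h.2
  refine Subtype.ext (funext fun x ↦ ?_)
  change fderiv 𝕜 (f.1 * h.1) x _ = fderiv 𝕜 f.1 x _ * h.1 x + f.1 x * fderiv 𝕜 h.1 x _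
  rw [fderiv_mul (hf.differentiable (by simp)).differentiableAt
      (hh.differentiable (by simp)).differentiableAt]
  simp only [add_apply, smul_apply, smul_eq_mul]
  ring

theorem partialFun_coord (i j : Fin d) :
    partialFun (𝕜 := 𝕜) i (coord j) = algebraMap 𝕜 _ (if j = i then 1 else 0) := by
  refine Subtype.ext (funext fun x ↦ ?_)
  change fderiv 𝕜 (ContinuousLinearMap.proj (R := 𝕜) (φ := fun _ : Fin d ↦ 𝕜) j) x _ = _
  rw [ContinuousLinearMap.fderiv, ContinuousLinearMap.proj_apply, Pi.single_apply]
  rfl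

theorem partialFun_algebraMap (i : Fin d) (c : 𝕜) :
    partialFun i (algebraMap 𝕜 (SmoothFun 𝕜 d) c) = 0 := by
  refine Subtype.ext (funext fun x ↦ ?_)
  change fderiv 𝕜 (fun _ ↦ c) x _ = _
  rw [fderiv_fun_const]
  rfl

theorem partialFun_aeval (i : Fin d) (p : MvPolynomial (Fin d) 𝕜) :
    partialFun i (MvPolynomial.aeval (coord (𝕜 := 𝕜)) p) = MvPolynomial.aeval coord (pderiv i p) := by
  induction p using MvPolynomial.induction_on with
  | C a => rw [MvPolynomial.aeval_C, partialFun_algebraMap, MvPolynomial.pderiv_C, map_zero]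
  | add p q hp hq => rw [map_add, map_add, map_add, map_add, hp, hq]
  | mul_X p j hp =>
    rw [map_mul, partialFun_mul, hp, MvPolynomial.aeval_X, partialFun_coord, Derivation.leibniz,
      MvPolynomial.pderiv_X, map_add, smul_eq_mul, smul_eq_mul, map_mul, map_mul,
      MvPolynomial.aeval_X, Pi.single_apply, add_comm, mul_comm (coord j)]
    by_cases h : j = i
    · simp [h]
    · simp [h]

theorem coeff_partialBase (i : Fin d) (P : Symbol 𝕜 d) (n : Fin d →₀ ℕ) :
    MvPolynomial.coeff n (partialBase i P) = partialFun i (MvPolynomial.coeff n P) :=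
  coeff_sum_partialFun i P n

theorem partialBase_C_mul (i : Fin d) (f : SmoothFun 𝕜 d) (P : Symbol 𝕜 d) :
    partialBase i (C f * P) = C (partialFun i f) * P + C f * partialBase i P := by
  ext1 n
  simp only [coeff_partialBase, MvPolynomial.coeff_C_mul, MvPolynomial.coeff_add, partialFun_mul]

theorem baseFun_eq_C (p : MvPolynomial (Fin d) 𝕜) :
    (baseFun p : Symbol 𝕜 d) = C (MvPolynomial.aeval coord p) := rfl

theorem partialBase_baseFun_mul (i : Fin d) (p : MvPolynomial (Fin d) 𝕜) (P : Symbol 𝕜 d) :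
    partialBase i (baseFun p * P) = baseFun (pderiv i p) * P + baseFun p * partialBase i P := by
  rw [baseFun_eq_C, baseFun_eq_C, partialBase_C_mul, partialFun_aeval]

theorem partialBase_X_mul (i j : Fin d) (P : Symbol 𝕜 d) :
    partialBase i (X j * P) = X j * partialBase i P := by
  classical
  ext1 n
  simp only [coeff_partialBase, MvPolynomial.coeff_X_mul']
  split_ifs
  · rfl
  · exact map_zero _

theorem partialBase_pderiv (i j : Fin d) (P : Symbol 𝕜 d) :
    partialBase i (pderiv j P) = pderiv j (partialBase i P) := by
  ext1 n
  simp only [coeff_partialBase, MvPolynomial.coeff_pderiv]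
  have h := partialFun_mul i (MvPolynomial.coeff (n + Finsupp.single j 1) P)
    (algebraMap 𝕜 (SmoothFun 𝕜 d) (n j + 1))
  rw [partialFun_algebraMap, mul_zero, add_zero, map_add, map_natCast, map_one] at h
  exact h

/-- Evaluation of smooth functions at a point. -/
def evalFun (x : Fin d → 𝕜) : SmoothFun 𝕜 d →+* 𝕜 :=
  (Pi.evalRingHom (fun _ : Fin d → 𝕜 ↦ 𝕜) x).comp (SmoothFun 𝕜 d).val.toRingHom

/-- The value at a point of a symbol, as a polynomial. -/
def valueHom (x : Fin d → 𝕜) : Symbol 𝕜 d →+* MvPolynomial (Fin d) 𝕜 :=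
  MvPolynomial.map (evalFun x)

theorem evalFun_aeval (x : Fin d → 𝕜) (p : MvPolynomial (Fin d) 𝕜) :
    evalFun x (MvPolynomial.aeval coord p) = eval x p := by
  induction p using MvPolynomial.induction_on with
  | C a =>
    rw [MvPolynomial.aeval_C, MvPolynomial.eval_C]
    rfl
  | add p q hp hq => rw [map_add, map_add, map_add, hp, hq]
  | mul_X p j hp =>
    rw [map_mul, map_mul, map_mul, hp, MvPolynomial.aeval_X, MvPolynomial.eval_X]
    rfl

theorem valueHom_baseFun (x : Fin d → 𝕜) (p : MvPolynomial (Fin d) 𝕜) :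
    valueHom x (baseFun p : Symbol 𝕜 d) = C (eval x p) := by
  rw [baseFun_eq_C, valueHom, MvPolynomial.map_C, evalFun_aeval]

theorem valueHom_pderiv (x : Fin d → 𝕜) (j : Fin d) (P : Symbol 𝕜 d) :
    valueHom x (pderiv j P) = pderiv j (valueHom x P) :=
  (MvPolynomial.pderiv_map).symm

theorem valueHom_X (x : Fin d → 𝕜) (j : Fin d) : valueHom x (X j : Symbol 𝕜 d) = X j :=
  MvPolynomial.map_X _ _

theorem valueHom_C (x : Fin d → 𝕜) (f : SmoothFun 𝕜 d) :
    valueHom x (C f : Symbol 𝕜 d) = C (f.1 x) :=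
  MvPolynomial.map_C _ _

theorem valueHom_smul (x : Fin d → 𝕜) (c : 𝕜) (P : Symbol 𝕜 d) :
    valueHom x (c • P) = c • valueHom x P := by
  rw [← algebraMap_smul (SmoothFun 𝕜 d) c P, MvPolynomial.smul_eq_C_mul, map_mul, valueHom_C,
    MvPolynomial.smul_eq_C_mul]
  rfl

theorem symbol_ext {P Q : Symbol 𝕜 d} (h : ∀ x, valueHom x P = valueHom x Q) : P = Q := by
  ext1 n
  refine Subtype.ext (funext fun x ↦ ?_)
  have := congrArg (MvPolynomial.coeff n) (h x)
  rwa [valueHom, MvPolynomial.coeff_map, MvPolynomial.coeff_map] at this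

/-- The action on the fibre of `V × (⨁ₖ ∨ᵏ V ⊗ Δ^δ V)` of a linear vector field with Jacobian
matrix `A`. -/
def fibreAct (δ : ℝ) : Matrix (Fin d) (Fin d) 𝕜 →ₗ[𝕜]
    Module.End 𝕜 (MvPolynomial (Fin d) 𝕜) :=
  LinearMap.mk₂ 𝕜 (fun A Q ↦ -∑ i, ∑ j, A i j • (X i * pderiv j Q) + ((δ : 𝕜) * A.trace) • Q)
    (fun A B Q ↦ by
      simp only [Matrix.add_apply, Matrix.trace_add, add_smul, mul_add, Finset.sum_add_distrib]
      abel)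
    (fun c A Q ↦ by
      simp only [Matrix.smul_apply, Matrix.trace_smul, Finset.smul_sum, smul_add, smul_neg,
        smul_eq_mul, mul_smul, smul_comm c (δ : 𝕜)])
    (fun A P Q ↦ by
      simp only [map_add, mul_add, smul_add, Finset.sum_add_distrib]
      abel)
    (fun c A Q ↦ by
      simp only [Derivation.map_smul, mul_smul_comm, smul_comm _ c, ← Finset.smul_sum, smul_add,
        smul_neg])

theorem fibreAct_apply (δ : ℝ) (A : Matrix (Fin d) (Fin d) 𝕜) (Q : MvPolynomial (Fin d) 𝕜) :
    fibreAct δ A Q =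
      -∑ i, ∑ j, A i j • (X i * pderiv j Q) + ((δ : 𝕜) * A.trace) • Q := rfl

theorem fibreAct_smul_one (δ : ℝ) (c : 𝕜) {Q : MvPolynomial (Fin d) 𝕜} {k : ℕ}
    (hQ : Q.IsHomogeneous k) :
    fibreAct δ (c • (1 : Matrix (Fin d) (Fin d) 𝕜)) Q = (c * (d * δ - k)) • Q := by
  rw [map_smul, LinearMap.smul_apply, mul_smul]
  congr 1
  rw [fibreAct_apply, Matrix.trace_one, Fintype.card_fin]
  have h : ∑ i, ∑ j, (1 : Matrix (Fin d) (Fin d) 𝕜) i j • (X i * pderiv j Q) = (k : 𝕜) • Q := by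
    rw [Nat.cast_smul_eq_nsmul, ← hQ.sum_X_mul_pderiv]
    refine Finset.sum_congr rfl fun i _ ↦ ?_
    simp [Matrix.one_apply]
  rw [h, sub_smul, mul_comm, neg_add_eq_sub]

theorem fibreAct_of_trace_eq_zero (δ : ℝ) {Y : PolyVect 𝕜 d} (h : (jac Y).trace = 0)
    (Q : MvPolynomial (Fin d) 𝕜) : fibreAct δ (jac Y) Q = rho Y Q := by
  rw [fibreAct_apply, h, mul_zero, zero_smul, add_zero, apply_eq_sum, Finset.sum_comm,
    ← Finset.sum_neg_distrib]
  refine Finset.sum_congr rfl fun j _ ↦ ?_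
  rw [comp, rho_X, Finset.mul_sum, ← Finset.sum_neg_distrib]
  refine Finset.sum_congr rfl fun i _ ↦ ?_
  rw [mul_smul_comm, neg_smul, mul_comm]

/-- The Jacobian matrix at a point of a polynomial vector field. -/
def jacAt (x : Fin d → 𝕜) (Y : PolyVect 𝕜 d) : Matrix (Fin d) (Fin d) 𝕜 :=
  fun i j ↦ eval x (pderiv j (comp Y i))

theorem jacAt_eq (x : Fin d → 𝕜) (Y : PolyVect 𝕜 d) (i j : Fin d) :
    jacAt x Y i j = evalAt x ⁅constField (Pi.single j (1 : 𝕜)), Y⁆ i := by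
  rw [evalAt_apply, comp_lie_constField, constField_single]
  rfl

theorem lieDeriv_apply (δ : ℝ) (Y : PolyVect 𝕜 d) (P : Symbol 𝕜 d) :
    lieDeriv δ Y P = lieDerivFun δ Y P := rfl

theorem valueHom_lieDeriv (δ : ℝ) (x : Fin d → 𝕜) (Y : PolyVect 𝕜 d) (P : Symbol 𝕜 d) :
    valueHom x (lieDeriv δ Y P) =
      ∑ i, evalAt x Y i • valueHom x (partialBase i P) + fibreAct δ (jacAt x Y) (valueHom x P) := by
  rw [lieDeriv_apply, lieDerivFun, fibreAct_apply]
  simp only [map_add, map_sub, map_sum, map_mul, valueHom_smul, valueHom_baseFun, valueHom_pderiv,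
    valueHom_X, ← MvPolynomial.smul_eq_C_mul, smul_mul_assoc]
  rw [sub_eq_add_neg, add_assoc, mul_smul, Matrix.trace, Finset.sum_smul]
  rfl

theorem valueHom_lieDeriv_of_evalAt_eq_zero (δ : ℝ) {x : Fin d → 𝕜} {Y : PolyVect 𝕜 d}
    (h : evalAt x Y = 0) (P : Symbol 𝕜 d) :
    valueHom x (lieDeriv δ Y P) = fibreAct δ (jacAt x Y) (valueHom x P) := by
  rw [valueHom_lieDeriv, h]
  simp

theorem lieDeriv_constField (δ : ℝ) (i : Fin d) (P : Symbol 𝕜 d) :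
    lieDeriv δ (constField (Pi.single i (1 : 𝕜))) P = partialBase i P := by
  refine symbol_ext fun x ↦ ?_
  have hJ : jacAt x (constField (Pi.single i (1 : 𝕜))) = 0 := by
    ext k j
    rw [jacAt_eq, lie_constField_constField, map_zero]
    rfl
  rw [valueHom_lieDeriv, hJ, map_zero, evalAt_constField, LinearMap.zero_apply, add_zero,
    Finset.sum_eq_single i]
  · simp
  · intro j _ hj
    simp [Pi.single_eq_of_ne hj]
  · simp

/-- When Y vanishes to second order at x, differentiating once leaves only second derivatives of Y
at x; no derivative of P along the base survives. -/
theorem valueHom_partialBase_lieDeriv (δ : ℝ) {x : Fin d → 𝕜} {Y : PolyVect 𝕜 d}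
    (h : evalAt x Y = 0) (hJ : jacAt x Y = 0) (i : Fin d) (P : Symbol 𝕜 d) :
    valueHom x (partialBase i (lieDeriv δ Y P)) =
      fibreAct δ (jacAt x ⁅constField (Pi.single i (1 : 𝕜)), Y⁆) (valueHom x P) := by
  have h1 : ∀ k, eval x (comp Y k) = 0 := fun k ↦ congrFun h k
  have h2 : ∀ k j, eval x (pderiv j (comp Y k)) = 0 := fun k j ↦ congrFun (congrFun hJ k) j
  have h3 : ∀ k j, eval x (pderiv i (pderiv j (comp Y k))) =
      jacAt x ⁅constField (Pi.single i (1 : 𝕜)), Y⁆ k j := by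
    intro k j
    rw [jacAt_eq, evalAt_apply, lie_constField_comm, comp_lie_constField, comp_lie_constField,
      constField_single, constField_single]
  rw [lieDeriv_apply, lieDerivFun, fibreAct_apply]
  simp only [map_add, map_sub, map_sum, map_smul, mul_assoc, partialBase_baseFun_mul,
    partialBase_X_mul, partialBase_pderiv, map_mul, valueHom_smul, valueHom_baseFun,
    valueHom_pderiv, valueHom_X, h1, h2, h3, map_zero, zero_mul, add_zero, Finset.sum_const_zero,
    ← MvPolynomial.smul_eq_C_mul]
  rw [zero_sub, mul_smul, Matrix.trace, Finset.sum_smul]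
  rfl

end Values

end IFFT

end

noncomputable section

namespace IFFT

/-! ### Translation to a point and the fibrewise form of the Casimir operator -/

section Translation

variable {𝕜 : Type*} [RCLike 𝕜] {d : ℕ}

/-- The polynomial vector field `Y` of degree at most two, translated by `x`. -/
def translate (x : Fin d → 𝕜) (Y : PolyVect 𝕜 d) : PolyVect 𝕜 d :=
  Y - ⁅constField x, Y⁆ + (1 / 2 : 𝕜) • ⁅constField x, ⁅constField x, Y⁆⁆

theorem translate_constant (x : Fin d → 𝕜) {Y : PolyVect 𝕜 d} (hY : Y ∈ coeffDeg 𝕜 d 0) :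
    translate x Y = Y := by
  rw [translate, lie_constField_eq_zero x hY, lie_zero (M := PolyVect 𝕜 d) (constField x),
    smul_zero, sub_zero, add_zero]

theorem translate_linear (x : Fin d → 𝕜) {Y : PolyVect 𝕜 d} (hY : Y ∈ coeffDeg 𝕜 d 1) :
    translate x Y = Y - ⁅constField x, Y⁆ := by
  rw [translate, lie_constField_eq_zero x (lie_constField_mem x hY), smul_zero, add_zero]

theorem lie_constField_translate (x v : Fin d → 𝕜) (Y : PolyVect 𝕜 d) :
    ⁅constField v, translate x Y⁆ = translate x ⁅constField v, Y⁆ := by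
  rw [translate, translate, lie_add (constField v) (Y - _), lie_sub (constField v) Y,
    lie_smul (1 / 2 : 𝕜) (constField v) (⁅constField x, ⁅constField x, Y⁆⁆ : PolyVect 𝕜 d),
    lie_constField_comm v x ⁅constField x, Y⁆, lie_constField_comm v x Y]

theorem evalAt_translate_linear (x : Fin d → 𝕜) {Y : PolyVect 𝕜 d} (hY : Y ∈ coeffDeg 𝕜 d 1) :
    evalAt x (translate x Y) = 0 := by
  rw [translate_linear x hY, map_sub, evalAt_lie_constField_self hY, Nat.cast_one, one_smul,
    sub_self]

/-- By Euler's identity the three terms are 1, -2 and (1/2)·2·1 times Y(x), and they cancel. -/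
theorem evalAt_translate_quadratic (x : Fin d → 𝕜) {Y : PolyVect 𝕜 d} (hY : Y ∈ coeffDeg 𝕜 d 2) :
    evalAt x (translate x Y) = 0 := by
  rw [translate, map_add, map_sub, map_smul, evalAt_lie_constField_self (lie_constField_mem x hY),
    evalAt_lie_constField_self hY, Nat.cast_one, one_smul, smul_smul]
  norm_num
  rw [two_smul]
  abel

theorem jacAt_translate_linear (x : Fin d → 𝕜) {Y : PolyVect 𝕜 d} (hY : Y ∈ coeffDeg 𝕜 d 1) :
    jacAt x (translate x Y) = jac Y := by
  ext i j
  rw [jacAt_eq, lie_constField_translate, translate_constant x (lie_constField_mem _ hY),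
    lie_linear_constField hY, evalAt_constField, evalAt_eq_jac_mulVec hY, Matrix.mulVec_single_one]
  rfl

theorem jacAt_translate_quadratic (x : Fin d → 𝕜) {Y : PolyVect 𝕜 d} (hY : Y ∈ coeffDeg 𝕜 d 2) :
    jacAt x (translate x Y) = 0 := by
  ext i j
  rw [jacAt_eq, lie_constField_translate, evalAt_translate_linear x (lie_constField_mem _ hY)]
  rfl

variable {g : LieSubalgebra 𝕜 (PolyVect 𝕜 d)} [FiniteDimensional 𝕜 g] (hgr : IsGraded g)
  (hmax : IsCoatom g)

/-- The translation by `x` on `g`. -/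
def translateL (x : Fin d → 𝕜) : g →ₗ[𝕜] g where
  toFun Y := Y - ⁅cst hgr hmax x, Y⁆ + (1 / 2 : 𝕜) • ⁅cst hgr hmax x, ⁅cst hgr hmax x, Y⁆⁆
  map_add' Y Z := by simp only [lie_add, smul_add]; abel
  map_smul' c Y := by
    simp only [lie_smul, smul_add, smul_sub, smul_comm c (1 / 2 : 𝕜), RingHom.id_apply]

theorem translateL_apply (x : Fin d → 𝕜) (Y : g) : translateL hgr hmax x Y =
    Y - ⁅cst hgr hmax x, Y⁆ + (1 / 2 : 𝕜) • ⁅cst hgr hmax x, ⁅cst hgr hmax x, Y⁆⁆ := rfl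

theorem lie_cst_cst_cst (x : Fin d → 𝕜) (Y : g) :
    ⁅cst hgr hmax x, ⁅cst hgr hmax x, ⁅cst hgr hmax x, Y⁆⁆⁆ = 0 := by
  let D : g →ₗ[𝕜] g := LieAlgebra.ad 𝕜 g (cst hgr hmax x)
  have htop : LinearMap.ker (D ∘ₗ D ∘ₗ D) = ⊤ := hgr.eq_top fun n Y hY ↦ by
    change ⁅cst hgr hmax x, ⁅cst hgr hmax x, ⁅cst hgr hmax x, Y⁆⁆⁆ = 0
    have h0 : ∀ {Z : g}, (Z : PolyVect 𝕜 d) ∈ coeffDeg 𝕜 d 0 → ⁅cst hgr hmax x, Z⁆ = 0 :=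
      fun hZ ↦ Subtype.ext (lie_constField_eq_zero x hZ)
    have h1 : ∀ {n : ℕ} {Z : g}, (Z : PolyVect 𝕜 d) ∈ coeffDeg 𝕜 d (n + 1) →
        ((⁅cst hgr hmax x, Z⁆ : g) : PolyVect 𝕜 d) ∈ coeffDeg 𝕜 d n :=
      fun hZ ↦ lie_constField_mem x hZ
    match n with
    | 0 => rw [h0 hY, lie_zero, lie_zero]
    | 1 => rw [h0 (h1 hY), lie_zero]
    | 2 => rw [h0 (h1 (h1 hY))]
    | n + 3 => rw [eq_zero_of_three_le_degree hgr hmax (by omega) hY, lie_zero, lie_zero, lie_zero]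
  exact LinearMap.congr_fun (LinearMap.ker_eq_top.1 htop) Y

/-- Translation by x is exp(-ad x), a finite sum since (ad x)³ = 0 on 𝔤. As ad x is skew for κ, its
adjoint is translation by -x, which is its inverse; so it is an isometry. -/
theorem isDualPair_translateL {ι : Type*} [Fintype ι] {u w : ι → g}
    (hd : IsDualPair (killingForm 𝕜 g) u w) (x : Fin d → 𝕜) :
    IsDualPair (killingForm 𝕜 g) (fun i ↦ translateL hgr hmax x (u i))
      fun i ↦ translateL hgr hmax x (w i) := by
  intro Y
  have hsk : ∀ Y Z : g, killingForm 𝕜 g Y ⁅cst hgr hmax x, Z⁆ =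
      killingForm 𝕜 g (-⁅cst hgr hmax x, Y⁆) Z := fun Y Z ↦ by
    rw [← killingForm_lie, lie_skew]
  have h1 : ∀ Y Z : g, killingForm 𝕜 g Y (translateL hgr hmax x Z) =
      killingForm 𝕜 g (translateL hgr hmax (-x) Y) Z := by
    intro Y Z
    simp only [translateL_apply, map_add, map_sub, map_smul, hsk, map_neg, neg_lie, lie_neg,
      LinearMap.add_apply, LinearMap.neg_apply, neg_neg, sub_neg_eq_add, LinearMap.smul_apply]
  have h2 := congrArg (translateL hgr hmax x) (hd (translateL hgr hmax (-x) Y))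
  simp only [map_sum, map_smul, ← h1] at h2
  rw [h2]
  have h3 := lie_cst_cst_cst hgr hmax x Y
  simp only [translateL_apply, map_neg, neg_lie, lie_neg, lie_add, lie_smul, sub_neg_eq_add,
    neg_neg, h3, smul_zero, add_zero]
  module

variable [Algebra 𝕜 ℂ] [LieAlgebra.IsSimple ℂ (ℂ ⊗[𝕜] h0 g)]

include hgr hmax in
/-- The Casimir operator of symbols acts fibrewise. -/
theorem valueHom_symbolCasimir {ι κ : Type*} [Fintype ι] [DecidableEq ι] [Fintype κ]
    (δ : ℝ) (hβ : (killingForm 𝕜 g).Nondegenerate) (e : Module.Basis ι 𝕜 g)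
    {u w : κ → h0 g} (hd : IsDualPair (killingForm 𝕜 (h0 g)) u w) {s : 𝕜}
    (hs0 : s ≠ 0) (hs : ∀ x y : h0 g,
      killingForm 𝕜 g (inclH g x) (inclH g y) = s * killingForm 𝕜 (h0 g) x y)
    (x : Fin d → 𝕜) (P : Symbol 𝕜 d) :
    valueHom x (symbolCasimir g δ hβ e P) =
      fibreAct δ ((-(1 / 2 : 𝕜)) • 1) (valueHom x P) +
        ((2 * d : 𝕜)⁻¹ • fibreAct δ 1 (fibreAct δ 1 (valueHom x P)) +
          s⁻¹ • ∑ k, rho (u k : PolyVect 𝕜 d) (rho (w k : PolyVect 𝕜 d) (valueHom x P))) := by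
  obtain ⟨ε, hε⟩ := exists_dual_constFields hgr hmax
  have hε2 := dual_constFields_mem hgr hmax hε
  have hD := isDualPair_translateL hgr hmax (isDualPair_fam hgr hmax hε hd hs0 hs) x
  let Λ : g →ₗ[𝕜] Module.End 𝕜 (Symbol 𝕜 d) := (lieDeriv δ).comp g.toSubmodule.subtype
  let f : g →ₗ[𝕜] g →ₗ[𝕜] Symbol 𝕜 d := LinearMap.mk₂ 𝕜 (fun Y Z ↦ Λ Y (Λ Z P))
    (fun _ _ _ ↦ by rw [map_add, LinearMap.add_apply])
    (fun _ _ _ ↦ by rw [map_smul, LinearMap.smul_apply])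
    (fun _ _ _ ↦ by rw [map_add, LinearMap.add_apply, map_add])
    (fun _ _ _ ↦ by rw [map_smul, LinearMap.smul_apply, map_smul])
  have h1 := (isDualPair_dualBasis _ hβ e).sum_eq (N := Symbol 𝕜 d) hβ hD f
  have h2 := sum_famL_famR (N := Symbol 𝕜 d) hgr hmax (f.compl₁₂ (translateL hgr hmax x) (translateL hgr hmax x)) ε
    (killingForm 𝕜 g (eul hgr hmax) (eul hgr hmax)) s u w
  have h3 : symbolCasimir g δ hβ e P = ∑ i, f (e i)
      ((killingForm 𝕜 g).flip.dualBasis hβ.flip e i) := by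
    rw [symbolCasimir, casimir, LinearMap.sum_apply]
    rfl
  rw [h3, h1.trans h2]
  simp only [map_add, map_sum, valueHom_smul]
  have hΛ : ∀ Y Z : g, f.compl₁₂ (translateL hgr hmax x) (translateL hgr hmax x) Y Z =
      lieDeriv δ (translate x (Y : PolyVect 𝕜 d)) (lieDeriv δ (translate x (Z : PolyVect 𝕜 d)) P) :=
    fun _ _ ↦ rfl
  simp only [hΛ]
  have hlin : ∀ (Y : PolyVect 𝕜 d), Y ∈ coeffDeg 𝕜 d 1 → ∀ Q : Symbol 𝕜 d,
      valueHom x (lieDeriv δ (translate x Y) Q) = fibreAct δ (jac Y) (valueHom x Q) := by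
    intro Y hY Q
    rw [valueHom_lieDeriv_of_evalAt_eq_zero δ (evalAt_translate_linear x hY),
      jacAt_translate_linear x hY]
  -- The translated εᵢ vanishes to second order at x, so only the fibre action of [eᵢ, εᵢ] remains,
  -- and these brackets add up to -E/2. In the opposite order, `t2`, nothing remains.
  have t1 : ∑ i, valueHom x (lieDeriv δ (translate x (cst hgr hmax (Pi.single i 1) : PolyVect 𝕜 d))
      (lieDeriv δ (translate x (ε i : PolyVect 𝕜 d)) P)) =
      fibreAct δ ((-(1 / 2 : 𝕜)) • 1) (valueHom x P) := by
    have hterm : ∀ i, valueHom x (lieDeriv δ (translate x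
        (cst hgr hmax (Pi.single i 1) : PolyVect 𝕜 d))
        (lieDeriv δ (translate x (ε i : PolyVect 𝕜 d)) P)) =
        fibreAct δ (jacL ((⁅cst hgr hmax (Pi.single i 1), ε i⁆ : g) : PolyVect 𝕜 d))
          (valueHom x P) := by
      intro i
      rw [coe_cst, translate_constant x (constField_mem _), lieDeriv_constField,
        valueHom_partialBase_lieDeriv δ (evalAt_translate_quadratic x (hε2 i))
          (jacAt_translate_quadratic x (hε2 i)), lie_constField_translate,
        jacAt_translate_linear x (lie_constField_mem _ (hε2 i))]
      rfl
    rw [Finset.sum_congr rfl fun i _ ↦ hterm i, ← LinearMap.sum_apply, ← map_sum, ← map_sum,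
      ← AddSubmonoidClass.coe_finsetSum, sum_lie_dual hgr hmax hε]
    change fibreAct δ (jac ((-(1 / 2 : 𝕜)) • (euler : PolyVect 𝕜 d))) _ = _
    rw [jac_smul, jac_euler]
  have t2 : ∑ i, valueHom x (lieDeriv δ (translate x (ε i : PolyVect 𝕜 d))
      (lieDeriv δ (translate x (cst hgr hmax (Pi.single i 1) : PolyVect 𝕜 d)) P)) = 0 :=
    Finset.sum_eq_zero fun i _ ↦ by
      rw [valueHom_lieDeriv_of_evalAt_eq_zero δ (evalAt_translate_quadratic x (hε2 i)),
        jacAt_translate_quadratic x (hε2 i), map_zero, LinearMap.zero_apply]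
  have hE : ((eul hgr hmax : g) : PolyVect 𝕜 d) = euler := rfl
  rw [t1, t2, hE, hlin _ euler_mem, hlin _ euler_mem, jac_euler, killingForm_euler hgr hmax hε,
    zero_add]
  congr 3
  refine Finset.sum_congr rfl fun k _ ↦ ?_
  rw [coe_inclH, coe_inclH, hlin _ (h0_le_g0 g (u k).2).2, hlin _ (h0_le_g0 g (w k).2).2,
    fibreAct_of_trace_eq_zero δ (trace_jac_h0 (u k).2),
    fibreAct_of_trace_eq_zero δ (trace_jac_h0 (w k).2)]

end Translation

end IFFT

end

noncomputable section

namespace IFFT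

/-! ### Eigenvalues and diagonalizability on symbols -/

section SymbolCasimir

variable {𝕜 : Type*} [RCLike 𝕜] {d : ℕ} {g : LieSubalgebra 𝕜 (PolyVect 𝕜 d)}

variable (g) in
/-- The symmetric power `∨ᵏ V`, as an `h₀`-module. -/
def symPowLie (k : ℕ) : LieSubmodule 𝕜 (h0 g) (SymAlg 𝕜 d) where
  toSubmodule := symPow 𝕜 d k
  lie_mem {Y Q} hQ := by
    refine isHomogeneous_apply (X := rho (Y : PolyVect 𝕜 d)) (fun j ↦ ?_) hQ
    rw [comp, rho_X]
    exact MvPolynomial.IsHomogeneous.sum _ _ _ fun _ _ ↦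
      (MvPolynomial.homogeneousSubmodule (Fin d) 𝕜 1).smul_mem _ (MvPolynomial.isHomogeneous_X _ _)

theorem finiteDimensional_homogeneousSubmodule (k : ℕ) :
    FiniteDimensional 𝕜 (MvPolynomial.homogeneousSubmodule (Fin d) 𝕜 k) := by
  have hle : MvPolynomial.homogeneousSubmodule (Fin d) 𝕜 k ≤
      MvPolynomial.restrictTotalDegree (Fin d) 𝕜 k := fun Q hQ ↦
    (MvPolynomial.mem_restrictTotalDegree _ _ _).2 (MvPolynomial.IsHomogeneous.totalDegree_le hQ)
  exact Submodule.finiteDimensional_of_le hle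

instance (k : ℕ) : FiniteDimensional 𝕜 (symPow 𝕜 d k) :=
  finiteDimensional_homogeneousSubmodule k

instance (k : ℕ) : FiniteDimensional 𝕜 (symPowLie g k) :=
  inferInstanceAs (FiniteDimensional 𝕜 (symPow 𝕜 d k))

/-- The symbol `f Q`, for a smooth function `f` and a symmetric tensor `Q`. -/
def funMul (f : SmoothFun 𝕜 d) : SymAlg 𝕜 d →ₗ[𝕜] Symbol 𝕜 d where
  toFun (Q : MvPolynomial (Fin d) 𝕜) :=
    MvPolynomial.C f * MvPolynomial.map (algebraMap 𝕜 (SmoothFun 𝕜 d)) Q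
  map_add' (Q R : MvPolynomial (Fin d) 𝕜) := by
    rw [← mul_add, ← map_add]
    rfl
  map_smul' c (Q : MvPolynomial (Fin d) 𝕜) := by
    change _ * MvPolynomial.map _ (c • Q) = _
    rw [MvPolynomial.smul_eq_C_mul, map_mul, MvPolynomial.map_C, mul_left_comm,
      ← MvPolynomial.smul_eq_C_mul, algebraMap_smul]
    rfl

theorem valueHom_C_mul_map (x : Fin d → 𝕜) (f : SmoothFun 𝕜 d) (Q : MvPolynomial (Fin d) 𝕜) :
    valueHom x (MvPolynomial.C f * MvPolynomial.map (algebraMap 𝕜 (SmoothFun 𝕜 d)) Q) =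
      f.1 x • Q := by
  rw [map_mul, valueHom_C, ← MvPolynomial.smul_eq_C_mul, valueHom, MvPolynomial.map_map,
    show (evalFun x).comp (algebraMap 𝕜 (SmoothFun 𝕜 d)) = RingHom.id 𝕜 from rfl,
    MvPolynomial.map_id]

theorem value_funMul (x : Fin d → 𝕜) (f : SmoothFun 𝕜 d) (Q : SymAlg 𝕜 d) :
    value x (funMul f Q) = f.1 x • Q :=
  valueHom_C_mul_map x f Q

theorem coe_casEnd {κ : Type*} [Fintype κ] (u w : κ → h0 g)
    (N : LieSubmodule 𝕜 (h0 g) (SymAlg 𝕜 d)) (q : N) :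
    (casEnd 𝕜 N u w q : SymAlg 𝕜 d) = casEnd 𝕜 (SymAlg 𝕜 d) u w q :=
  casEnd_map u w N.incl q

variable [FiniteDimensional 𝕜 g] (hgr : IsGraded g) (hmax : IsCoatom g)
  [Algebra 𝕜 ℂ] [LieAlgebra.IsSimple ℂ (ℂ ⊗[𝕜] h0 g)]
  {ι κ : Type*} [Fintype ι] [DecidableEq ι] [Fintype κ]
  (δ : ℝ) (hβ : (killingForm 𝕜 g).Nondegenerate) (e : Module.Basis ι 𝕜 g)
  {u w : κ → h0 g} (hd : IsDualPair (killingForm 𝕜 (h0 g)) u w) {s : 𝕜}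
  (hs0 : s ≠ 0) (hs : ∀ x y : h0 g,
    killingForm 𝕜 g (inclH g x) (inclH g y) = s * killingForm 𝕜 (h0 g) x y)

include hgr hmax hd hs0 hs

/-- With c = dδ - k the eigenvalue of E on the fibre, the scalar arises from -c/2 + c²/2d = c(c -
d)/2d. -/
theorem symbolCasimir_eq_smul {k : ℕ} {r : 𝕜} {P : Symbol 𝕜 d}
    (hP : ∀ x, value x P ∈ symPow 𝕜 d k)
    (hr : ∀ x, casEnd 𝕜 (SymAlg 𝕜 d) u w (value x P) = r • value x P) :
    symbolCasimir g δ hβ e P =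
      (1 / (2 * d) * (d * δ - k) * (d * (δ - 1) - k) + s⁻¹ * r : 𝕜) • P := by
  refine symbol_ext fun x ↦ ?_
  have hk : (valueHom x P).IsHomogeneous k := hP x
  have h1 : ∑ k, rho (u k : PolyVect 𝕜 d) (rho (w k : PolyVect 𝕜 d) (valueHom x P)) =
      r • valueHom x P := (casEnd_apply u w (value x P)).symm.trans (hr x)
  have h2 : fibreAct δ 1 (valueHom x P) = ((d : 𝕜) * δ - k) • valueHom x P := by
    have := fibreAct_smul_one δ 1 hk
    rwa [one_smul, one_mul] at this
  have hd0 : (d : 𝕜) ≠ 0 := Nat.cast_ne_zero.2 (dim_pos hmax).ne'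
  rw [valueHom_symbolCasimir hgr hmax δ hβ e hd hs0 hs, h1, fibreAct_smul_one δ _ hk, h2, map_smul,
    h2, valueHom_smul, smul_smul, smul_smul, smul_smul, ← add_smul, ← add_smul]
  congr 1
  field_simp
  ring

/-- A symbol is a finite sum of products fQ with Q a monomial in ξ. The operator acts fibrewise, so
the factor f is inert and an eigenvector decomposition of Q in ∨ᵏV gives one of fQ. -/
theorem iSup_eigenspace_symbolCasimir
    (hirr : ∀ (k : ℕ) (A : LieSubmodule 𝕜 (h0 g) (symPowLie g k)), LieModule.IsIrreducible 𝕜 (h0 g) A →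
      ∃ a : 𝕜, ∀ x : A, casEnd 𝕜 A u w x = a • x) :
    ⨆ a : 𝕜, Module.End.eigenspace (M := Symbol 𝕜 d) (symbolCasimir g δ hβ e) a = ⊤ := by
  have key : ∀ (k : ℕ) (f : SmoothFun 𝕜 d) (q : symPowLie g k), funMul f (q : SymAlg 𝕜 d) ∈
      ⨆ a : 𝕜, Module.End.eigenspace (M := Symbol 𝕜 d) (symbolCasimir g δ hβ e) a := by
    intro k f q
    have := isSimple_of_baseChange 𝕜 (h0 g)
    let m : symPowLie g k →ₗ[𝕜] Symbol 𝕜 d := funMul f ∘ₗ (symPowLie g k).toSubmodule.subtype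
    have hm : ∀ (q : symPowLie g k) (x : Fin d → 𝕜),
        value x (m q) = f.1 x • (q : SymAlg 𝕜 d) := fun q x ↦ value_funMul x f q
    have htop : (⊤ : Submodule 𝕜 (symPowLie g k)) ≤ (⨆ a : 𝕜,
        Module.End.eigenspace (M := Symbol 𝕜 d) (symbolCasimir g δ hβ e) a).comap m := by
      rw [← iSup_eigenspace_casEnd hd (hirr k)]
      refine iSup_le fun a q hq ↦ ?_
      have hC := symbolCasimir_eq_smul hgr hmax δ hβ e hd hs0 hs (k := k) (r := a) (P := m q)
        (fun x ↦ by rw [hm]; exact Submodule.smul_mem _ _ q.2) fun x ↦ by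
          have h1 := congrArg Subtype.val (Module.End.mem_eigenspace_iff.1 hq)
          rw [hm, map_smul, ← coe_casEnd, h1, smul_comm]
          rfl
      exact Submodule.mem_iSup_of_mem _ (Module.End.mem_eigenspace_iff.2 hC)
    exact Submodule.mem_comap.1 (htop (Submodule.mem_top (x := q)))
  refine eq_top_iff.2 fun P _ ↦ ?_
  rw [P.as_sum]
  refine Submodule.sum_mem _ fun n _ ↦ ?_
  have hn : (MvPolynomial.monomial n (1 : 𝕜) : MvPolynomial (Fin d) 𝕜).IsHomogeneous n.degree :=
    MvPolynomial.isHomogeneous_monomial 1 rfl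
  have h : (MvPolynomial.C (P.coeff n) * MvPolynomial.map (algebraMap 𝕜 (SmoothFun 𝕜 d))
    (MvPolynomial.monomial n 1) : Symbol 𝕜 d) ∈ _ := key n.degree (P.coeff n) ⟨_, hn⟩
  rwa [MvPolynomial.map_monomial, map_one, MvPolynomial.C_mul_monomial, mul_one] at h

end SymbolCasimir

end IFFT

end

/-! ### The theorem -/

set_option maxHeartbeats 1000000 in
theorem mainTheorem1 {𝕜 : Type*} [RCLike 𝕜] [Algebra 𝕜 ℂ] [IsScalarTower ℝ 𝕜 ℂ] {d : ℕ}
    (g : LieSubalgebra 𝕜 (IFFT.PolyVect 𝕜 d)) [FiniteDimensional 𝕜 g]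
    (hgraded : IFFT.IsGraded g) (hmax : IsCoatom g)
    [LieAlgebra.IsSimple ℂ (ℂ ⊗[𝕜] IFFT.h0 g)]
    (C : LieSubalgebra ℂ (ℂ ⊗[𝕜] IFFT.h0 g)) [C.IsCartanSubalgebra]
    (B : (LieAlgebra.IsKilling.rootSystem C).Base)
    (δ : ℝ) {ι : Type*} [Fintype ι] [DecidableEq ι] (e : Module.Basis ι 𝕜 g) :
    ∃ hβ : (killingForm 𝕜 g).Nondegenerate,
      (⨆ a : 𝕜, Module.End.eigenspace (M := IFFT.Symbol 𝕜 d) (IFFT.symbolCasimir g δ hβ e) a) = ⊤ ∧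
      (∃ μ, IFFT.IsHighestWeight 𝕜 (IFFT.gMinusOne g) B μ) ∧
      ∀ (k : ℕ) (I : LieSubmodule 𝕜 (IFFT.h0 g) (IFFT.SymAlg 𝕜 d)),
        I.toSubmodule ≤ IFFT.symPow 𝕜 d k → LieModule.IsIrreducible 𝕜 (IFFT.h0 g) I →
        (∃ ν, IFFT.IsHighestWeight 𝕜 I B ν) ∧
        ∀ μ ν : Module.Dual ℂ C,
          IFFT.IsHighestWeight 𝕜 (IFFT.gMinusOne g) B μ → IFFT.IsHighestWeight 𝕜 I B ν →
          ∃ a : ℝ,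
            (a : ℂ) = 1 / (2 * d) * (d * δ - k) * (d * (δ - 1) - k)
              + (Module.finrank 𝕜 (IFFT.h0 g) : ℂ)
                / (2 * IFFT.weightForm μ (μ + IFFT.sumPosRoots B) * d
                    + Module.finrank 𝕜 (IFFT.h0 g))
                * IFFT.weightForm ν (ν + IFFT.sumPosRoots B) ∧
            ∀ P ∈ IFFT.sections I.toSubmodule,
              IFFT.symbolCasimir g δ hβ e P = (a : 𝕜) • P := by
  have := IFFT.isSimple_of_baseChange 𝕜 (IFFT.h0 g)
  have hβ := IFFT.killingForm_nondegenerate_of_isCoatom hgraded hmax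
  have hirr := IFFT.isIrreducible_gMinusOne hgraded hmax
  obtain ⟨u, w, hd⟩ := IFFT.exists_isDualPair (killingForm 𝕜 (IFFT.h0 g))
    (LieAlgebra.IsKilling.killingForm_nondegenerate 𝕜 (IFFT.h0 g))
  obtain ⟨s, hs0, hs⟩ := IFFT.exists_killingForm_inclH hgraded hmax
  refine ⟨hβ, ?_, IFFT.exists_isHighestWeight 𝕜 _ B, fun k I hI hIirr ↦ ?_⟩
  · refine IFFT.iSup_eigenspace_symbolCasimir hgraded hmax δ hβ e hd hs0 hs fun k A hA ↦ ?_
    obtain ⟨ν, hν⟩ := IFFT.exists_isHighestWeight 𝕜 A B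
    obtain ⟨r, -, hr⟩ := IFFT.casEnd_eq_of_isHighestWeight (E := A) hν hd
    exact ⟨r, hr⟩
  · have hfd : FiniteDimensional 𝕜 I := Submodule.finiteDimensional_of_le hI
    refine ⟨IFFT.exists_isHighestWeight 𝕜 I B, fun μ ν hμ hν ↦ ?_⟩
    obtain ⟨r, hr, hrV⟩ := IFFT.casEnd_eq_of_isHighestWeight hμ hd
    have ⟨t, ht, htI⟩ := IFFT.casEnd_eq_of_isHighestWeight (E := I) (u := u) (w := w) hν hd
    have hratio := IFFT.killingForm_ratio hgraded hmax hd hs0 hs hrV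
    have hn : (Module.finrank 𝕜 (IFFT.h0 g) : 𝕜) ≠ 0 := by
      have := LieAlgebra.IsSimple.nontrivial 𝕜 (IFFT.h0 g)
      exact Nat.cast_ne_zero.2 Module.finrank_pos.ne'
    refine ⟨1 / (2 * d) * (d * δ - k) * (d * (δ - 1) - k) + Module.finrank 𝕜 (IFFT.h0 g)
      / (2 * r * d + Module.finrank 𝕜 (IFFT.h0 g)) * t, ?_, fun P hP ↦ ?_⟩
    · rw [hr, ht]
      push_cast
      ring
    · have hx : ∀ x, IFFT.casEnd 𝕜 (IFFT.SymAlg 𝕜 d) u w (IFFT.value x P) =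
          (t : 𝕜) • IFFT.value x P := fun x ↦ by
        have h := congrArg Subtype.val (htI ⟨IFFT.value x P, hP x⟩)
        rwa [IFFT.coe_casEnd] at h
      refine (IFFT.symbolCasimir_eq_smul hgraded hmax δ hβ e hd hs0 hs
        (fun x ↦ hI (hP x)) hx).trans (congrArg (fun c : 𝕜 ↦ c • P) ?_)
      -- Inverts s dim 𝔥₀ = dim 𝔥₀ + 2rd with r = (μ, μ+S). The denominator is nonzero because s and
      -- dim 𝔥₀ are.
      have hs' : s⁻¹ = (Module.finrank 𝕜 (IFFT.h0 g) : 𝕜) /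
          (2 * (r : 𝕜) * d + Module.finrank 𝕜 (IFFT.h0 g)) := by
        rw [add_comm, ← hratio, div_mul_cancel_right₀ hn]
      rw [hs']
      push_cast
      ring
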